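/- **Setting.** Let $m,c>0$, $e\neq0$, and let $X\subseteq\mathbb R^4$ be open, with Minkowski metric $\mathrm{diag}(-1,1,1,1)$. Let $A_0$ be a smooth four-potential on $X$ whose field $F_0=dA_0$ has $\lambda_E=0$ and $\lambda_B>0$ (the eigenvalues of the mixed tensor $F_0$ are $\pm\lambda_E,\pm i\lambda_B$), and let $(\hat e_0,\hat e_1,\hat e_2,\hat e_3)$ be a smooth orthonormal tetrad with $F_0\cdot\hat e_0=F_0\cdot\hat e_1=0$, $F_0\cdot\hat e_2=-\lambda_B\hat e_3$, $F_0\cdot\hat e_3=\lambda_B\hat e_2$. Put $\Omega_B=e\lambda_B/(mc)$. On the phase space with coordinates $(R,U,\mu,\theta)$, $R\in X$, $U\in\mathbb R^4$, $\mu=mw^2/(2\Omega_B)$ with $w>0$, put $\rho=w/\Omega_B$, $\hat a=\hat e_2\cos\theta-\hat e_3\sin\theta$, and let $g$ be the vector field with $g^r=-\rho\hat a$ and no other components. Let $\psi:X\to\mathbb R$ and $\tilde A:X\to\mathbb C^4$ be smooth, $k=\nabla\psi$, $\tilde F=i(k\tilde A-\tilde A k)$, and for $\epsilon>0$ $$\gamma_w=\frac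 ec\,\tilde A\cdot dr\;e^{i\psi/\epsilon}+\mathrm{c.c.}$$ All $\mathcal O$-symbols are for $\epsilon\to0^+$, uniformly on compact sets of phase space; quotients such as $(e^{-ix}-1)/x$ are continued to $x=0$. $\mathcal L$, $i$, $d$ are the Lie derivative, interior product and exterior derivative. The guiding-center transform of $\gamma_w$ is $\Gamma_w=\exp(-\epsilon\mathcal L_g)\gamma_w$. **1. Homotopy formula.** $\mathcal L_V^j\eta=(i_Vd)^j\eta+(di_V)^j\eta$ for $j\ge1$, every smooth vector field $V$ and every smooth form $\eta$ of degree $\ge1$ on an open subset of phase space. **2. Splitting.** For every $j\ge1$, $\frac{(-\epsilon)^j}{j!}\mathcal L_g^j\gamma_w=\frac{(-\epsilon)^j}{j!}(i_gd)^j\gamma_w+d\big[\frac{(-\epsilon)^j}{j!}i_g(di_g)^{j-1}\gamma_w\big]$, hence for every $N\ge 0$ $$\sum_{j=0}^N\frac{(-\epsilon)^j}{j!}\mathcal L_g^j\gamma_w=\Big[\gamma_w+\sum_{j=1}^N\frac{(-\epsilon)^j}{j!}(i_gd)^j\gamma_w\Big]+d\Big[\sum_{j=1}^N\frac{(-\epsilon)^j}{j!}i_g(di_g)^{j-1}\gamma_w\Big].$$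 For $j\ge1$, $(i_gd)^j\gamma$ depends on a one-form $\gamma$ only through $d\gamma$; $\tilde F$ is unchanged under $\tilde A\mapsto\tilde A+ik\Lambda$; and $d\gamma_w=\frac{e}{2\epsilon c}\tilde F:dr\wedge dr\,e^{i\psi/\epsilon}+\mathrm{c.c.}+\mathcal O(1)$. **3. Leading terms.** For every $j\ge1$, with c.c. understood, $$[(i_gd)^j\gamma_w]_r=-\tfrac{ie}{c}(\tfrac i\epsilon)^j(g^r\!\cdot k)^{j-1}g^r\!\cdot\tilde F\,e^{i\psi/\epsilon}+\mathcal O(\epsilon^{1-j}),$$ $$[(i_gd)^j\gamma_w]_{\nu}=-\tfrac{e}{\epsilon c}(j-1)\big(\tfrac{i g^r\cdot k}{\epsilon}\big)^{j-2}\tfrac{\partial g^r}{\partial\nu}\cdot\tilde F\cdot g^r\,e^{i\psi/\epsilon}+\mathcal O(\epsilon^{2-j})\quad(\nu=\mu,\theta),$$ $$i_g(di_g)^j\gamma_w=\tfrac ec(\tfrac i\epsilon)^j(g^r\!\cdot k)^jg^r\!\cdot\tilde A\,e^{i\psi/\epsilon}+\mathcal O(\epsilon^{1-j}).$$ With $x=g^r\cdot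 k$, the sums over $j\ge1$ of these leading terms with weights $(-\epsilon)^j/j!$ (for the third one: of the leading term of $i_g(di_g)^{j-1}\gamma_w$ with weight $(-\epsilon)^j/j!$) converge to $$\tfrac ec\Big(-ig^r\!\cdot\tilde F\,\tfrac{e^{-ix}-1}{x}\Big)e^{i\psi/\epsilon},\qquad \tfrac ec\Big(-\epsilon\tfrac{\partial g^r}{\partial\nu}\cdot\tilde F\cdot g^r\,\tfrac{(1+ix)e^{-ix}-1}{x^2}\Big)e^{i\psi/\epsilon},\qquad -\tfrac{i\epsilon e}{c}g^r\!\cdot\tilde A\,\tfrac{e^{-ix}-1}{x}\,e^{i\psi/\epsilon}.$$ **4. Gauge transformation.** Let $$S_T=\frac{i\epsilon e}{c}\,g^r\!\cdot\tilde A\,\frac{e^{-ig^r\cdot k}-1}{g^r\cdot k}\,e^{i\psi/\epsilon}+\mathrm{c.c.},\qquad \Gamma'_w=\Gamma_w+dS_T.$$ Then $$\Gamma'_w=\frac ec\Big[\tilde A+\rho\hat a\cdot\tilde F\,\frac{e^{i\rho\hat a\cdot k}-1}{i\rho\hat a\cdot k}+\mathcal O(\epsilon)\Big]\cdot dR\,e^{i\psi/\epsilon}-\Big[\frac{\epsilon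 e\rho^2}{2c\lambda_B}F_0:\tilde F\,\frac{(1-i\rho\hat a\cdot k)e^{i\rho\hat a\cdot k}-1}{(\rho\hat a\cdot k)^2}+\mathcal O(\epsilon^2)\Big]d\theta\,e^{i\psi/\epsilon}+\mathcal O(\epsilon^2)d\mu+\mathcal O(\epsilon^2)\cdot dU+\mathrm{c.c.},$$ so that, apart from the term $\frac ec\tilde A\cdot dR\,e^{i\psi/\epsilon}+\mathrm{c.c.}$, the displayed terms depend on the wave potential only through $\tilde F$, with no expansion in $k_\perp\rho$. This holds in each of the following two senses of $\Gamma_w$. (a) Smooth data: $\Gamma_w=\varphi_{-\epsilon}^*\gamma_w$ for any smooth local flow $\varphi_s$ of $g$. Moreover the Taylor coefficients at $s=0$ of $s\mapsto\varphi_{-s}^*\gamma_w$ are $\frac{(-1)^j}{j!}\mathcal L_g^j\gamma_w$. (b) Real-analytic data ($A_0$, the tetrad, $\tilde A$, $\psi$): on every compact set, for all sufficiently small $\epsilon>0$, the series $\Gamma_w=\sum_{j\ge0}\frac{(-\epsilon)^j}{j!}\mathcal L_g^j\gamma_w$, $\sum_{j\ge1}\frac{(-\epsilon)^j}{j!}(i_gd)^j\gamma_w$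 and $\sum_{j\ge1}\frac{(-\epsilon)^j}{j!}i_g(di_g)^{j-1}\gamma_w$ converge, the last one to a differentiable function, and $$\Gamma_w=\Big[\gamma_w+\sum_{j\ge1}\frac{(-\epsilon)^j}{j!}(i_gd)^j\gamma_w\Big]+d\Big[\sum_{j\ge1}\frac{(-\epsilon)^j}{j!}i_g(di_g)^{j-1}\gamma_w\Big].$$ The $r$-, $\mu$- and $\theta$-components of the second sum are the closed forms of part 3 plus c.c., up to $\mathcal O(\epsilon)$, $\mathcal O(\epsilon^2)$ and $\mathcal O(\epsilon^2)$ respectively, and the last sum is $-S_T+\mathcal O(\epsilon^2)$. -/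

import Mathlib

open Set
open scoped ContDiff

noncomputable section

namespace GCWave

/-! ### Differential forms: interior product and Lie derivative -/

section Forms

variable {E : Type*} [NormedAddCommGroup E] [NormedSpace ℝ E]

/-- The interior product `i_V η`: contraction of the first slot of `η` with the vector field `V`. -/
def intProd {n : ℕ} (V : E → E) (η : E → E [⋀^Fin (n + 1)]→L[ℝ] ℝ) :
    E → E [⋀^Fin n]→L[ℝ] ℝ :=
  fun x => (η x).curryLeft (V x)

/-- The Lie derivative of an `n`-form `η` along the vector field `V`. In components it is
`V^γ η_{β₁…βₙ,γ} + ∑ᵢ V^γ_{,βᵢ} η_{β₁…γ…βₙ}`; see `lieDeriv_apply`. -/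
def lieDeriv {n : ℕ} (V : E → E) (η : E → E [⋀^Fin n]→L[ℝ] ℝ) :
    E → E [⋀^Fin n]→L[ℝ] ℝ :=
  fun x => fderiv ℝ η x (V x) +
    (η x).fderivCompContinuousLinearMap (ContinuousLinearMap.id ℝ E) (fderiv ℝ V x)

theorem lieDeriv_apply {n : ℕ} (V : E → E) (η : E → E [⋀^Fin n]→L[ℝ] ℝ) (x : E)
    (v : Fin n → E) :
    lieDeriv V η x v = fderiv ℝ η x (V x) v +
      ∑ i, η x (Function.update v i (fderiv ℝ V x (v i))) := by
  simp only [lieDeriv, ContinuousAlternatingMap.add_apply,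
    ContinuousAlternatingMap.fderivCompContinuousLinearMap_apply]
  congr 1
  refine Finset.sum_congr rfl fun i _ => ?_
  congr 1
  funext j
  by_cases h : j = i
  · subst h; simp
  · simp [h]

/-- The operator `i_V d`. -/
def intD {n : ℕ} (V : E → E) (η : E → E [⋀^Fin n]→L[ℝ] ℝ) : E → E [⋀^Fin n]→L[ℝ] ℝ :=
  intProd V (extDeriv η)

/-- The operator `d i_V`. -/
def dInt {n : ℕ} (V : E → E) (η : E → E [⋀^Fin (n + 1)]→L[ℝ] ℝ) :
    E → E [⋀^Fin (n + 1)]→L[ℝ] ℝ :=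
  extDeriv (intProd V η)

/-- A function regarded as a zero-form. -/
def zeroForm (f : E → ℝ) : E → E [⋀^Fin 0]→L[ℝ] ℝ :=
  fun x => ContinuousAlternatingMap.constOfIsEmpty ℝ E (Fin 0) (f x)

/-- The pull-back of an `n`-form under a map. -/
def pullback {n : ℕ} (f : E → E) (η : E → E [⋀^Fin n]→L[ℝ] ℝ) : E → E [⋀^Fin n]→L[ℝ] ℝ :=
  fun x => (η (f x)).compContinuousLinearMap (fderiv ℝ f x)

/-- `φ` is a smooth local flow of the vector field `V` on `S`, for times in `(-δ, δ)`, with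
trajectories in `D`. -/
def IsLocalFlow (V : E → E) (D S : Set E) (δ : ℝ) (φ : ℝ → E → E) : Prop :=
  0 < δ ∧ IsOpen S ∧
  ContDiffOn ℝ ∞ (fun p : ℝ × E => φ p.1 p.2) (Ioo (-δ) δ ×ˢ S) ∧
  (∀ x ∈ S, φ 0 x = x) ∧
  ∀ t ∈ Ioo (-δ) δ, ∀ x ∈ S, φ t x ∈ D ∧ HasDerivAt (fun s => φ s x) (V (φ t x)) t

end Forms

/-! ### Spacetime and phase space -/

/-- Minkowski spacetime, in Cartesian coordinates. -/
abbrev Spacetime : Type := Fin 4 → ℝ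

/-- Phase space with the coordinates `(R, U, μ, θ)`. -/
abbrev PhaseSpace : Type := Spacetime × Spacetime × ℝ × ℝ

/-- The coordinate vectors `∂/∂R^α`, `∂/∂U^α`, `∂/∂μ`, `∂/∂θ` of phase space. -/
def vR (α : Fin 4) : PhaseSpace := (Pi.single α 1, 0, 0, 0)
def vU (α : Fin 4) : PhaseSpace := (0, Pi.single α 1, 0, 0)
def vMu : PhaseSpace := (0, 0, 1, 0)
def vTheta : PhaseSpace := (0, 0, 0, 1)

/-- One-forms on phase space. -/
abbrev OneForm : Type := PhaseSpace → PhaseSpace [⋀^Fin 1]→L[ℝ] ℝ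

/-- Zero-forms on phase space. -/
abbrev ZeroForm : Type := PhaseSpace → PhaseSpace [⋀^Fin 0]→L[ℝ] ℝ

/-- The diagonal of the Minkowski metric `diag(-1, 1, 1, 1)`. -/
def eta (α : Fin 4) : ℝ := if α = 0 then -1 else 1

/-- The Minkowski scalar product of two (contravariant) four-vectors. -/
def mink (u v : Spacetime) : ℝ := ∑ α, eta α * u α * v α

/-- Addition of the complex conjugate: `z + c.c.`, as a real number. -/
def cc (z : ℂ) : ℝ := 2 * z.re

theorem cc_eq (z : ℂ) : (cc z : ℂ) = z + (starRingEnd ℂ) z := by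
  rw [Complex.add_conj]; rfl

/-! ### The zero-order electromagnetic field -/

/-- The field tensor `F_{αβ} = A_{β,α} - A_{α,β}` of a covariant four-potential. -/
def fieldTensor (A : Spacetime → Fin 4 → ℝ) (r : Spacetime) (α β : Fin 4) : ℝ :=
  fderiv ℝ A r (Pi.single α 1) β - fderiv ℝ A r (Pi.single β 1) α

/-- The Lorentz scalar `λ₁ = (1/2) F_{μν} F^{μν}`. -/
def lorentz1 (F : Fin 4 → Fin 4 → ℝ) : ℝ :=
  (1 / 2) * ∑ α, ∑ β, F α β * (eta α * eta β * F α β)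

/-- The contravariant components `(1/2) ε^{μναβ} F_{αβ}` of the dual field tensor, with
`ε^{0123} = -1`. -/
def dualTensor (F : Fin 4 → Fin 4 → ℝ) (μ ν : Fin 4) : ℝ :=
  (1 / 2) * ∑ σ : Equiv.Perm (Fin 4),
    if σ 0 = μ ∧ σ 1 = ν then -((Equiv.Perm.sign σ : ℤ) : ℝ) * F (σ 2) (σ 3) else 0

/-- The Lorentz pseudoscalar `λ₂ = (1/4) ℱ_{μν} F^{μν}`. -/
def lorentz2 (F : Fin 4 → Fin 4 → ℝ) : ℝ :=
  (1 / 4) * ∑ μ, ∑ ν, dualTensor F μ ν * F μ ν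

/-- `λ_E`: the real eigenvalues of the mixed field tensor are `± λ_E`. -/
def lambdaE (F : Fin 4 → Fin 4 → ℝ) : ℝ :=
  SignType.sign (lorentz2 F) *
    √((1 / 2) * (√(lorentz1 F ^ 2 + 4 * lorentz2 F ^ 2) - lorentz1 F))

/-- `λ_B`: the imaginary eigenvalues of the mixed field tensor are `± i λ_B`. -/
def lambdaB (F : Fin 4 → Fin 4 → ℝ) : ℝ :=
  √((1 / 2) * (√(lorentz1 F ^ 2 + 4 * lorentz2 F ^ 2) + lorentz1 F))

/-- The action `(F · v)^α = F^α_β v^β` of the mixed field tensor on a four-vector. -/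
def mixedApply (F : Fin 4 → Fin 4 → ℝ) (v : Spacetime) : Spacetime :=
  fun α => ∑ β, eta α * F α β * v β

/-! ### The setting -/

/-- A relativistic charged particle in an electromagnetic field whose zero-order part satisfies
`λ_E = 0`, `λ_B > 0` in a region `X` of spacetime, an adapted orthonormal tetrad, and an eikonal
wave with (covariant, complex) amplitude `Ã` and phase `ψ`. -/
structure Setting where
  /-- mass, charge, speed of light -/
  m : ℝ
  e : ℝ
  c : ℝ
  m_pos : 0 < m
  c_pos : 0 < c
  e_ne : e ≠ 0
  /-- region of spacetime -/
  X : Set Spacetime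
  isOpen_X : IsOpen X
  /-- zero-order four-potential (covariant components) -/
  A0 : Spacetime → Fin 4 → ℝ
  /-- orthonormal tetrad -/
  tet : Fin 4 → Spacetime → Spacetime
  /-- wave amplitude (covariant components) -/
  At : Spacetime → Fin 4 → ℂ
  /-- wave phase -/
  ψ : Spacetime → ℝ
  smooth_A0 : ContDiffOn ℝ ∞ A0 X
  smooth_tet : ∀ a, ContDiffOn ℝ ∞ (tet a) X
  smooth_At : ContDiffOn ℝ ∞ At X
  smooth_ψ : ContDiffOn ℝ ∞ ψ X
  lambdaE_eq : ∀ r ∈ X, lambdaE (fieldTensor A0 r) = 0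
  lambdaB_pos : ∀ r ∈ X, 0 < lambdaB (fieldTensor A0 r)
  tet_orthonormal : ∀ r ∈ X, ∀ a b, mink (tet a r) (tet b r) = if a = b then eta a else 0
  F_tet0 : ∀ r ∈ X, mixedApply (fieldTensor A0 r) (tet 0 r) = 0
  F_tet1 : ∀ r ∈ X, mixedApply (fieldTensor A0 r) (tet 1 r) = 0
  F_tet2 : ∀ r ∈ X, mixedApply (fieldTensor A0 r) (tet 2 r) =
    -lambdaB (fieldTensor A0 r) • tet 3 r
  F_tet3 : ∀ r ∈ X, mixedApply (fieldTensor A0 r) (tet 3 r) =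
    lambdaB (fieldTensor A0 r) • tet 2 r

namespace Setting

variable (W : Setting)

/-- The fields and the wave are real-analytic functions of spacetime position. -/
def IsAnalytic : Prop :=
  AnalyticOnNhd ℝ W.A0 W.X ∧ (∀ a, AnalyticOnNhd ℝ (W.tet a) W.X) ∧
    AnalyticOnNhd ℝ W.At W.X ∧ AnalyticOnNhd ℝ W.ψ W.X

/-- The zero-order field tensor `F₀ = dA₀`. -/
def F0 (r : Spacetime) : Fin 4 → Fin 4 → ℝ := fieldTensor W.A0 r

/-- The gyrofrequency `Ω_B = e λ_B / (m c)`. -/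
def OmegaB (r : Spacetime) : ℝ := W.e * lambdaB (W.F0 r) / (W.m * W.c)

/-- The domain of the guiding-center coordinates: `R ∈ X`, and `μ = m w² / (2 Ω_B)` for some
perpendicular speed `w > 0`, i.e. `μ` is nonzero and has the sign of the charge. -/
def dom : Set PhaseSpace := {z | z.1 ∈ W.X ∧ 0 < W.e * z.2.2.1}

/-- The perpendicular speed `w`, from `μ = m w² / (2 Ω_B)`. -/
def w (z : PhaseSpace) : ℝ := √(2 * W.OmegaB z.1 * z.2.2.1 / W.m)

/-- The gyroradius `ρ = w / Ω_B`. -/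
def rho (z : PhaseSpace) : ℝ := W.w z / W.OmegaB z.1

/-- The unit vector `â = ê₂ cos θ - ê₃ sin θ`. -/
def aHat (z : PhaseSpace) : Spacetime :=
  Real.cos z.2.2.2 • W.tet 2 z.1 - Real.sin z.2.2.2 • W.tet 3 z.1

/-- The spacetime part `g^r = -ρ â` of the guiding-center generator. -/
def gr (z : PhaseSpace) : Spacetime := -(W.rho z • W.aHat z)

/-- The generator of the guiding-center transformation: `g^r = -ρ â`, no other components. -/
def g (z : PhaseSpace) : PhaseSpace := (W.gr z, 0, 0, 0)

/-- The wave four-vector `k = ∇ψ`. -/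
def k (r : Spacetime) (α : Fin 4) : ℝ := fderiv ℝ W.ψ r (Pi.single α 1)

/-- The rapidly varying factor `exp (iψ/ε)`. -/
def eik (ε : ℝ) (r : Spacetime) : ℂ := Complex.exp (Complex.I / (ε : ℂ) * (W.ψ r : ℂ))

/-- The perturbation of the action one-form in particle coordinates:
`γ_w = (e/c) Ã · dr exp (iψ/ε) + c.c.` -/
def gammaW (ε : ℝ) : OneForm := fun z =>
  ContinuousAlternatingMap.ofSubsingleton ℝ PhaseSpace ℝ (0 : Fin 1)
    (∑ α, cc ((W.e / W.c : ℂ) * W.At z.1 α * W.eik ε z.1) •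
      ((ContinuousLinearMap.proj α : Spacetime →L[ℝ] ℝ).comp
        (ContinuousLinearMap.fst ℝ Spacetime (Spacetime × ℝ × ℝ))))

end Setting

/-! ### The wave field amplitude and contractions -/

/-- `F̃ = i (k Ã - Ã k)`, i.e. `F̃_{αβ} = i (k_α Ã_β - Ã_α k_β)`. -/
def waveTensor (k : Fin 4 → ℝ) (A : Fin 4 → ℂ) (α β : Fin 4) : ℂ :=
  Complex.I * ((k α : ℂ) * A β - A α * (k β : ℂ))

/-- `v · T · u` for a covariant tensor `T`. -/
def contract2 (v : Spacetime) (T : Fin 4 → Fin 4 → ℂ) (u : Spacetime) : ℂ :=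
  ∑ α, ∑ β, (v α : ℂ) * T α β * (u β : ℂ)

/-- The covector `v · T`, with components `v^α T_{αβ}`. -/
def contract1 (v : Spacetime) (T : Fin 4 → Fin 4 → ℂ) (β : Fin 4) : ℂ :=
  ∑ α, (v α : ℂ) * T α β

/-- `v · A` for a complex covector `A`. -/
def dotA (v : Spacetime) (A : Fin 4 → ℂ) : ℂ := ∑ α, (v α : ℂ) * A α

/-- `v · k` for a real covector `k`. -/
def dotK (v : Spacetime) (k : Fin 4 → ℝ) : ℝ := ∑ α, v α * k α

/-- `F : T = F^{αβ} T_{αβ}`. -/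
def doubleContract (F : Fin 4 → Fin 4 → ℝ) (T : Fin 4 → Fin 4 → ℂ) : ℂ :=
  ∑ α, ∑ β, ((eta α * eta β * F α β : ℝ) : ℂ) * T α β

/-! ### The functions of `g^r · k` and of `ρ â · k`

Removable singularities at `0` are filled in. -/

/-- `(exp (-ix) - 1) / x` -/
def q1 (x : ℝ) : ℂ :=
  if x = 0 then -Complex.I else (Complex.exp (-Complex.I * x) - 1) / x

/-- `((1 + ix) exp (-ix) - 1) / x²` -/
def q2 (x : ℝ) : ℂ :=
  if x = 0 then 1 / 2
  else ((1 + Complex.I * x) * Complex.exp (-Complex.I * x) - 1) / (x : ℂ) ^ 2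

/-- `(exp (iy) - 1) / (iy)` -/
def p1 (y : ℝ) : ℂ :=
  if y = 0 then 1 else (Complex.exp (Complex.I * y) - 1) / (Complex.I * y)

/-- `((1 - iy) exp (iy) - 1) / y²` -/
def p2 (y : ℝ) : ℂ :=
  if y = 0 then 1 / 2
  else ((1 - Complex.I * y) * Complex.exp (Complex.I * y) - 1) / (y : ℂ) ^ 2

/-- `f = 𝒪(ε^p)` as `ε → 0⁺`, uniformly on `K`. -/
def UnifO (K : Set PhaseSpace) (p : ℤ) (f : ℝ → PhaseSpace → ℝ) : Prop :=
  ∃ C : ℝ, ∃ ε₀ > 0, ∀ ε ∈ Ioo (0 : ℝ) ε₀, ∀ z ∈ K, |f ε z| ≤ C * ε ^ p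

namespace Setting

variable (W : Setting)

/-- The wave tensor `F̃` at spacetime position `r`. -/
def Ft (r : Spacetime) : Fin 4 → Fin 4 → ℂ := waveTensor (W.k r) (W.At r)

/-- `g^r · k`, `∂g^r/∂μ` and `∂g^r/∂θ`. -/
def gk (z : PhaseSpace) : ℝ := dotK (W.gr z) (W.k z.1)
def dgrMu (z : PhaseSpace) : Spacetime := fderiv ℝ W.gr z vMu
def dgrTheta (z : PhaseSpace) : Spacetime := fderiv ℝ W.gr z vTheta

/-! #### The series -/

/-- The `j`-th term `((-ε)^j / j!) ℒ_g^j γ_w` of the Lie series. -/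
def lieTerm (ε : ℝ) (j : ℕ) : OneForm := fun z =>
  ((-ε) ^ j / (j.factorial : ℝ)) • (lieDeriv W.g)^[j] (W.gammaW ε) z

/-- `((-ε)^j / j!) (i_g d)^j γ_w` -/
def invTerm (ε : ℝ) (j : ℕ) : OneForm := fun z =>
  ((-ε) ^ j / (j.factorial : ℝ)) • (intD W.g)^[j] (W.gammaW ε) z

/-- The zero-form `i_g (d i_g)^j γ_w`. -/
def potIter (ε : ℝ) (j : ℕ) : ZeroForm := intProd W.g ((dInt W.g)^[j] (W.gammaW ε))

/-- `((-ε)^j / j!) i_g (d i_g)^(j-1) γ_w` (used for `j ≥ 1`). -/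
def potTerm (ε : ℝ) (j : ℕ) : ZeroForm := fun z =>
  ((-ε) ^ j / (j.factorial : ℝ)) • W.potIter ε (j - 1) z

/-- `Γ_w = exp (-ε ℒ_g) γ_w = ∑_{j ≥ 0} ((-ε)^j / j!) ℒ_g^j γ_w` -/
def GammaW (ε : ℝ) : OneForm := fun z => ∑' j : ℕ, W.lieTerm ε j z

/-- `∑_{j ≥ 1} ((-ε)^j / j!) (i_g d)^j γ_w` -/
def invSeries (ε : ℝ) : OneForm := fun z => ∑' j : ℕ, W.invTerm ε (j + 1) z

/-- `∑_{j ≥ 1} ((-ε)^j / j!) i_g (d i_g)^(j-1) γ_w` -/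
def potSeries (ε : ℝ) : ZeroForm := fun z => ∑' j : ℕ, W.potTerm ε (j + 1) z

/-! #### Leading terms. The wave potential enters the first group only through `F̃`. -/

/-- Leading `R^β`-component of `(i_g d)^j γ_w` (without c.c.), for `j ≥ 1`. -/
def leadR (F : Fin 4 → Fin 4 → ℂ) (ε : ℝ) (j : ℕ) (z : PhaseSpace) (β : Fin 4) : ℂ :=
  -(Complex.I * W.e / W.c) * (Complex.I / ε) ^ j * (W.gk z : ℂ) ^ (j - 1) *
    contract1 (W.gr z) F β * W.eik ε z.1

/-- Leading `μ`- or `θ`-component of `(i_g d)^j γ_w` (without c.c.), for `j ≥ 1`; here `v` is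
`∂g^r/∂μ` or `∂g^r/∂θ`. (For `j = 1` the factor `j - 1` vanishes.) -/
def leadAng (F : Fin 4 → Fin 4 → ℂ) (v : Spacetime) (ε : ℝ) (j : ℕ) (z : PhaseSpace) : ℂ :=
  -(W.e / (ε * W.c) : ℂ) * ((j : ℂ) - 1) * (Complex.I * W.gk z / ε) ^ (j - 2) *
    contract2 v F (W.gr z) * W.eik ε z.1

/-- Sum over `j ≥ 1` of the leading `R^β`-components, with the factors `(-ε)^j / j!`. -/
def sumR (F : Fin 4 → Fin 4 → ℂ) (ε : ℝ) (z : PhaseSpace) (β : Fin 4) : ℂ :=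
  (W.e / W.c : ℂ) * (-Complex.I * contract1 (W.gr z) F β * q1 (W.gk z) * W.eik ε z.1)

/-- Sum over `j ≥ 1` of the leading `μ`- or `θ`-components, with the factors `(-ε)^j / j!`. -/
def sumAng (F : Fin 4 → Fin 4 → ℂ) (v : Spacetime) (ε : ℝ) (z : PhaseSpace) : ℂ :=
  (W.e / W.c : ℂ) * (-(ε : ℂ) * contract2 v F (W.gr z) * q2 (W.gk z) * W.eik ε z.1)

/-- Leading part of `i_g (d i_g)^j γ_w` (without c.c.). -/
def leadPot (ε : ℝ) (j : ℕ) (z : PhaseSpace) : ℂ :=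
  (W.e / W.c : ℂ) * (Complex.I / ε) ^ j * (W.gk z : ℂ) ^ j *
    dotA (W.gr z) (W.At z.1) * W.eik ε z.1

/-- The generating function of the gauge transformation, without c.c.:
`(iεe/c) g^r·Ã ((exp (-i g^r·k) - 1) / (g^r·k)) exp (iψ/ε)`. -/
def STc (ε : ℝ) (z : PhaseSpace) : ℂ :=
  Complex.I * ε * W.e / W.c * dotA (W.gr z) (W.At z.1) * q1 (W.gk z) * W.eik ε z.1

/-- The generating function `S_T` of the Lagrangian gauge transformation. -/
def ST (ε : ℝ) (z : PhaseSpace) : ℝ := cc (W.STc ε z)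

/-- `Γ'_w = Γ_w + dS_T` for a given `Γ_w`. -/
def gaugeTransform (Γ : ℝ → OneForm) (ε : ℝ) : OneForm := fun z =>
  Γ ε z + extDeriv (zeroForm (W.ST ε)) z

/-- `ρ â · k` -/
def rak (z : PhaseSpace) : ℝ := W.rho z * dotK (W.aHat z) (W.k z.1)

/-- The leading `R^β`-component of `Γ'_w - γ_w` (without c.c.), a function of `F̃`:
`(e/c) ρ â·F̃ ((exp (iρâ·k) - 1) / (iρâ·k)) exp (iψ/ε)`. -/
def primeR (F : Fin 4 → Fin 4 → ℂ) (ε : ℝ) (z : PhaseSpace) (β : Fin 4) : ℂ :=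
  (W.e / W.c : ℂ) * (W.rho z * contract1 (W.aHat z) F β * p1 (W.rak z)) * W.eik ε z.1

/-- The leading `θ`-component of `Γ'_w` (without c.c.), a function of `F̃`:
`-(εeρ²/(2cλ_B)) F₀:F̃ (((1 - iρâ·k) exp (iρâ·k) - 1) / (ρâ·k)²) exp (iψ/ε)`. -/
def primeTheta (F : Fin 4 → Fin 4 → ℂ) (ε : ℝ) (z : PhaseSpace) : ℂ :=
  -(ε * W.e * (W.rho z) ^ 2 / (2 * W.c * lambdaB (W.F0 z.1)) *
    doubleContract (W.F0 z.1) F * p2 (W.rak z)) * W.eik ε z.1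

/-- The manifestly gauge-invariant expansion of `Γ'_w`, uniformly on `K`:
the `R`-component is `(e/c) [Ã + ρ â·F̃ (…) + 𝒪(ε)] exp (iψ/ε) + c.c.`, the `θ`-component is
`-[(εeρ²/(2cλ_B)) F₀:F̃ (…) + 𝒪(ε²)] exp (iψ/ε) + c.c.`, and the `μ`- and `U`-components
are `𝒪(ε²)`. -/
def HasInvariantExpansion (Γ' : ℝ → OneForm) (K : Set PhaseSpace) : Prop :=
  (∀ β, UnifO K 1 fun ε z => Γ' ε z ![vR β] -
    cc ((W.e / W.c : ℂ) * W.At z.1 β * W.eik ε z.1 + W.primeR (W.Ft z.1) ε z β)) ∧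
  (UnifO K 2 fun ε z => Γ' ε z ![vTheta] - cc (W.primeTheta (W.Ft z.1) ε z)) ∧
  (UnifO K 2 fun ε z => Γ' ε z ![vMu]) ∧
  (∀ β, UnifO K 2 fun ε z => Γ' ε z ![vU β])

end Setting

end GCWave

end

open GCWave

noncomputable section

namespace GCWave

section

open ContinuousAlternatingMap

/-! ### Cartan's formula, and powers of the Lie derivative. -/

section Cartan

variable {E : Type*} [NormedAddCommGroup E] [NormedSpace ℝ E] {n : ℕ} {S : Set E} {V : E → E}

/-! Algebra. In positive degree `ℒ_V = i_V d + d i_V`, and the two summands annihilate each other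
because `dd = 0` and `i_V i_V = 0`; hence powers have no cross terms (`lieDeriv_iterate_eqOn`) and
the Lie series splits. The same identities give `(i_V d)^(j+1) η = ℒ_V^j (i_V d η)` and `i_V (d
i_V)^j = (i_V d)^j i_V`. Writing real forms as `σ + c.c.` with a complex amplitude `σ`, everything
reduces to iterates of one first-order operator `lop g M = g·∇ + M`, with `M = formMul` on covectors
and `M = 0` on functions.

Leading terms. The amplitude of `i_g dγ_w` is `exp(iψ/ε) (β₀/ε + β₁)`, where `β₀ = (e/c) g^r·F̃` is
gauge invariant. Conjugation by the phase turns `ε lop` into `i g^r·k + ε lop`, so iterates are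
polynomials in `ε` with smooth coefficients (`expCoef`), whose lowest coefficients are explicit. In
the directions of `U`, `μ`, `θ` the amplitudes vanish and the next coefficient counts. The weighted
sums are values of `phi k`, the entire function `∫₀¹ τ^(k-1) exp(τu) dτ`.

Gauge transformation. With `x = g^r·k`, the transported amplitude is `(1 + η) exp(iψ/ε) exp(-ix) (α
- ε ℒ_g α)` up to `𝒪(ε²)`, where `η = 𝒪(ε)` (`NearTransport`). From this alone
`hasInvariantExpansion` follows: `dS_T` supplies precisely what completes the terms in `α` to terms
in `β₀`, by two identities between `exp(-ix)`, `q1` and `q2`. For `μ` the result vanishes since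
`∂g^r/∂μ` is parallel to `g^r`; for `θ` the tetrad turns `∂g^r/∂θ·F̃·g^r` into `F₀:F̃`.

The two senses. For a smooth flow, `NearTransport` comes from Taylor expansion of the phase and of
the amplitude separately, never of `exp(iψ/ε)`. For analytic data, majorants give `j! Bʲ` bounds for
iterates on `ψ` and on the amplitudes. Then `lop^n (exp(iψ/ε) f)` are the Taylor coefficients of
`exp(iP(s)/ε) Φ(s)`, where `P` and `Φ` are the generating functions of the iterates on `ψ` and `f`.
This is holomorphic on a disc whose radius does not depend on `ε` (`hasSum_lop_iterate_exp_smul`),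
so the series converge at `s = -ε` for small `ε`. The invariant and potential sums are integrals of
such functions from `0` to `-ε`, estimated by comparison with an explicit oscillatory integral
(`exists_expInt_estimate`). -/

theorem intProd_apply (V : E → E) (η : E → E [⋀^Fin (n + 1)]→L[ℝ] ℝ) (x : E) (v : Fin n → E) :
    intProd V η x v = η x (Matrix.vecCons (V x) v) := rfl

/-- Currying of the first slot as a continuous linear map. -/
def curryLeftCLM (E : Type*) [NormedAddCommGroup E] [NormedSpace ℝ E] (n : ℕ) :
    (E [⋀^Fin (n + 1)]→L[ℝ] ℝ) →L[ℝ] (E →L[ℝ] E [⋀^Fin n]→L[ℝ] ℝ) :=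
  (curryLeftLI (𝕜 := ℝ) (E := E) (F := ℝ) (n := n)).toContinuousLinearMap

/-- Alternatization as a continuous linear map. -/
def altCLM (E : Type*) [NormedAddCommGroup E] [NormedSpace ℝ E] (n : ℕ) :
    (E →L[ℝ] E [⋀^Fin n]→L[ℝ] ℝ) →L[ℝ] (E [⋀^Fin (n + 1)]→L[ℝ] ℝ) :=
  alternatizeUncurryFinCLM ℝ E ℝ

theorem extDeriv_eq_altCLM (η : E → E [⋀^Fin n]→L[ℝ] ℝ) (x : E) :
    extDeriv η x = altCLM E n (fderiv ℝ η x) := rfl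

theorem hasFDerivAt_intProd {η : E → E [⋀^Fin (n + 1)]→L[ℝ] ℝ} {x : E}
    (hη : DifferentiableAt ℝ η x) (hV : DifferentiableAt ℝ V x) :
    HasFDerivAt (intProd V η)
      ((η x).curryLeft.comp (fderiv ℝ V x) +
        ((curryLeftCLM E n).comp (fderiv ℝ η x)).flip (V x)) x :=
  have h : HasFDerivAt (fun ξ => curryLeftCLM E n ξ) (curryLeftCLM E n) (η x) :=
    ContinuousLinearMap.hasFDerivAt (F := E →L[ℝ] E [⋀^Fin n]→L[ℝ] ℝ) _
  HasFDerivAt.clm_apply (c := fun y => curryLeftCLM E n (η y)) (h.comp x hη.hasFDerivAt)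
    hV.hasFDerivAt

theorem fderiv_intProd_apply {η : E → E [⋀^Fin (n + 1)]→L[ℝ] ℝ} {x : E}
    (hη : DifferentiableAt ℝ η x) (hV : DifferentiableAt ℝ V x) (u : E) (v : Fin n → E) :
    fderiv ℝ (intProd V η) x u v =
      η x (Matrix.vecCons (fderiv ℝ V x u) v) + fderiv ℝ η x u (Matrix.vecCons (V x) v) := by
  rw [(hasFDerivAt_intProd hη hV).fderiv]; rfl

theorem contDiffOn_intProd {m : WithTop ℕ∞} {η : E → E [⋀^Fin (n + 1)]→L[ℝ] ℝ}
    (hη : ContDiffOn ℝ m η S) (hV : ContDiffOn ℝ m V S) : ContDiffOn ℝ m (intProd V η) S :=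
  have h : ContDiff ℝ m (fun ξ => curryLeftCLM E n ξ) :=
    ContinuousLinearMap.contDiff (F := E →L[ℝ] E [⋀^Fin n]→L[ℝ] ℝ) _
  ContDiffOn.clm_apply (f := fun y => curryLeftCLM E n (η y)) (h.comp_contDiffOn hη) hV

theorem contDiffOn_extDeriv {m k : WithTop ℕ∞} {η : E → E [⋀^Fin n]→L[ℝ] ℝ} (hS : IsOpen S)
    (hη : ContDiffOn ℝ m η S) (h : k + 1 ≤ m) : ContDiffOn ℝ k (extDeriv η) S :=
  have h' : ContDiff ℝ k (fun ξ => altCLM E n ξ) :=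
    ContinuousLinearMap.contDiff (E := E →L[ℝ] E [⋀^Fin n]→L[ℝ] ℝ) _
  h'.comp_contDiffOn (hη.fderiv_of_isOpen hS h)

theorem extDeriv_zero : extDeriv (0 : E → E [⋀^Fin n]→L[ℝ] ℝ) = 0 := by
  funext x
  rw [extDeriv_eq_altCLM, fderiv_zero, Pi.zero_apply, _root_.map_zero, Pi.zero_apply]

theorem contDiffOn_intD {η : E → E [⋀^Fin n]→L[ℝ] ℝ} (hS : IsOpen S)
    (hV : ContDiffOn ℝ ∞ V S) (hη : ContDiffOn ℝ ∞ η S) : ContDiffOn ℝ ∞ (intD V η) S :=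
  contDiffOn_intProd (contDiffOn_extDeriv hS hη (by simp)) hV

theorem contDiffOn_dInt {η : E → E [⋀^Fin (n + 1)]→L[ℝ] ℝ} (hS : IsOpen S)
    (hV : ContDiffOn ℝ ∞ V S) (hη : ContDiffOn ℝ ∞ η S) : ContDiffOn ℝ ∞ (dInt V η) S :=
  contDiffOn_extDeriv hS (contDiffOn_intProd hη hV) (by simp)

theorem _root_.Set.EqOn.extDeriv {η₁ η₂ : E → E [⋀^Fin n]→L[ℝ] ℝ} (hS : IsOpen S)
    (h : EqOn η₁ η₂ S) : EqOn (extDeriv η₁) (extDeriv η₂) S := fun _ hx =>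
  (h.eventuallyEq_of_mem (hS.mem_nhds hx)).extDeriv_eq

theorem _root_.Set.EqOn.intProd {η₁ η₂ : E → E [⋀^Fin (n + 1)]→L[ℝ] ℝ}
    (h : EqOn η₁ η₂ S) : EqOn (intProd V η₁) (intProd V η₂) S := fun x hx => by
  simp only [GCWave.intProd, h hx]

theorem _root_.Set.EqOn.intD {η₁ η₂ : E → E [⋀^Fin n]→L[ℝ] ℝ} (hS : IsOpen S)
    (h : EqOn η₁ η₂ S) : EqOn (intD V η₁) (intD V η₂) S := (h.extDeriv hS).intProd

theorem _root_.Set.EqOn.lieDeriv {η₁ η₂ : E → E [⋀^Fin n]→L[ℝ] ℝ} (hS : IsOpen S)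
    (h : EqOn η₁ η₂ S) : EqOn (lieDeriv V η₁) (lieDeriv V η₂) S := fun x hx => by
  simp only [GCWave.lieDeriv, (h.eventuallyEq_of_mem (hS.mem_nhds hx)).fderiv_eq, h hx]

/-- Differential operators need agreement on a whole open set, not at a point; this is the form in
which agreement survives iteration. -/
theorem _root_.Set.EqOn.iterate_of_local {X A : Type*} {S : Set X} {T : (X → A) → (X → A)}
    (hT : ∀ f₁ f₂, EqOn f₁ f₂ S → EqOn (T f₁) (T f₂) S) {f₁ f₂ : X → A} (h : EqOn f₁ f₂ S)
    (j : ℕ) : EqOn (T^[j] f₁) (T^[j] f₂) S := by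
  induction j with
  | zero => exact h
  | succ j ih => rw [Function.iterate_succ_apply', Function.iterate_succ_apply']; exact hT _ _ ih

/-- Cartan's formula `ℒ_V = i_V d + d i_V` on forms of positive degree. -/
theorem lieDeriv_eq_intD_add_dInt {η : E → E [⋀^Fin (n + 1)]→L[ℝ] ℝ} {x : E}
    (hη : DifferentiableAt ℝ η x) (hV : DifferentiableAt ℝ V x) :
    lieDeriv V η x = intD V η x + dInt V η x := by
  ext v
  -- Moving an entry from the first slot to slot `i` takes `i` transpositions, whose sign cancels
  -- the sign of the alternating sum.
  have key : ∀ i : Fin (n + 1), (-1 : ℤ) ^ (i : ℕ) • η x (Matrix.vecCons (fderiv ℝ V x (v i))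
      (i.removeNth v)) = η x (Function.update v i (fderiv ℝ V x (v i))) := fun i => by
    rw [← neg_one_pow_smul_map_insertNth, Fin.insertNth_removeNth, smul_smul, ← pow_add,
      Even.neg_one_pow ⟨_, rfl⟩, one_smul]
  rw [ContinuousAlternatingMap.add_apply, lieDeriv_apply, intD, dInt, intProd_apply]
  simp only [_root_.extDeriv, alternatizeUncurryFin_apply]
  rw [Fin.sum_univ_succ (n := n + 1)]
  simp only [fderiv_intProd_apply hη hV, smul_add, Finset.sum_add_distrib, key]
  -- Deleting slot `i + 1` of `(V, v)` keeps `V` in front. These terms of `i_V dη` therefore match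
  -- those of `d i_V η` in which `η` is differentiated, with opposite sign because the index is
  -- shifted by one.
  have h2 : ∀ i : Fin (n + 1), (i.succ.removeNth (Matrix.vecCons (V x) v) : Fin (n + 1) → E) =
      Matrix.vecCons (V x) (i.removeNth v) := fun i => by
    ext j; refine Fin.cases ?_ (fun j => ?_) j <;> simp [Fin.removeNth]
  have h3 : ((0 : Fin (n + 2)).removeNth (Matrix.vecCons (V x) v) : Fin (n + 1) → E) = v := by
    ext j; simp [Fin.removeNth]
  simp only [h2, h3, Fin.val_zero, pow_zero, one_smul, Fin.val_succ, pow_succ, mul_neg_one,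
    Matrix.cons_val_zero, Matrix.cons_val_succ, neg_smul, Finset.sum_neg_distrib]
  ring

theorem contDiffOn_iterate {A : Type*} [NormedAddCommGroup A] [NormedSpace ℝ A]
    {T : (E → A) → (E → A)} (hT : ∀ f, ContDiffOn ℝ ∞ f S → ContDiffOn ℝ ∞ (T f) S) {f : E → A}
    (hf : ContDiffOn ℝ ∞ f S) (j : ℕ) : ContDiffOn ℝ ∞ (T^[j] f) S := by
  induction j with
  | zero => exact hf
  | succ j ih => rw [Function.iterate_succ_apply']; exact hT _ ih

theorem intProd_intProd (V : E → E) (η : E → E [⋀^Fin (n + 2)]→L[ℝ] ℝ) :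
    intProd V (intProd V η) = 0 := by
  funext x; exact curryLeft_same _ _

theorem extDeriv_extDeriv_eqOn {η : E → E [⋀^Fin n]→L[ℝ] ℝ} (hS : IsOpen S)
    (hη : ContDiffOn ℝ ∞ η S) : EqOn (extDeriv (extDeriv η)) 0 S := fun x hx =>
  extDeriv_extDeriv_apply (hη.contDiffAt (hS.mem_nhds hx))
    (by rw [minSmoothness_of_isRCLikeNormedField]; exact WithTop.coe_le_coe.2 (le_top (a := (2 : ℕ∞))))

/-- Contracting twice with the same vector gives zero. -/
theorem dInt_intD (V : E → E) (η : E → E [⋀^Fin (n + 1)]→L[ℝ] ℝ) : dInt V (intD V η) = 0 := by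
  rw [dInt, intD, intProd_intProd, extDeriv_zero]

/-- On forms of positive degree, `i_V d` and `d i_V` annihilate each other, so that
`ℒ_V^j = (i_V d)^j + (d i_V)^j`. -/
theorem lieDeriv_iterate_eqOn {η : E → E [⋀^Fin (n + 1)]→L[ℝ] ℝ} (hS : IsOpen S)
    (hV : ContDiffOn ℝ ∞ V S) (hη : ContDiffOn ℝ ∞ η S) (j : ℕ) :
    EqOn ((lieDeriv V)^[j + 1] η) ((intD V)^[j + 1] η + (dInt V)^[j + 1] η) S := by
  have dV : ∀ x ∈ S, DifferentiableAt ℝ V x := fun x hx =>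
    (hV.contDiffAt (hS.mem_nhds hx)).differentiableAt (by simp)
  induction j with
  | zero =>
    exact fun x hx => lieDeriv_eq_intD_add_dInt
        ((hη.contDiffAt (hS.mem_nhds hx)).differentiableAt (by simp)) (dV x hx)
  | succ j ih =>
    intro x hx
    rw [Function.iterate_succ_apply', ih.lieDeriv hS hx]
    have h1 := contDiffOn_iterate (fun _ => contDiffOn_intD hS hV) hη (j + 1)
    have h2 := contDiffOn_iterate (fun _ => contDiffOn_dInt hS hV) hη (j + 1)
    have h1' := (h1.contDiffAt (hS.mem_nhds hx)).differentiableAt (by simp)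
    have h2' := (h2.contDiffAt (hS.mem_nhds hx)).differentiableAt (by simp)
    rw [lieDeriv_eq_intD_add_dInt (h1'.add h2') (dV x hx)]
    -- The second summand is exact, so `d` removes it.
    have e1 : intD V ((intD V)^[j + 1] η + (dInt V)^[j + 1] η) x = (intD V)^[j + 2] η x := by
      rw [intD, intProd, extDeriv_add h1' h2', Function.iterate_succ_apply' (dInt V)]
      rw [dInt, extDeriv_extDeriv_eqOn hS (contDiffOn_intProd (contDiffOn_iterate
        (fun _ => contDiffOn_dInt hS hV) hη j) hV) hx, Pi.zero_apply, add_zero,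
        Function.iterate_succ_apply' (intD V) (j + 1)]
      rfl
    -- The first summand is a contraction with `V`, so a further contraction removes it.
    have e2 : dInt V ((intD V)^[j + 1] η + (dInt V)^[j + 1] η) x = (dInt V)^[j + 2] η x := by
      have : intProd V ((intD V)^[j + 1] η + (dInt V)^[j + 1] η) =
          intProd V ((dInt V)^[j + 1] η) := by
        rw [Function.iterate_succ_apply' (intD V), intD]
        funext y
        simp only [intProd, Pi.add_apply, curryLeft_add, _root_.add_apply,
          curryLeft_same, zero_add]
      rw [dInt, this, Function.iterate_succ_apply' (dInt V) (j + 1)]; rfl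
    rw [e1, e2]; rfl

/-- The form `i_V d η` lies in the kernel of `d i_V`, where powers of `i_V d` and of `ℒ_V` coincide.
This replaces exterior derivatives by the simpler operator `ℒ_V`. -/
theorem intD_iterate_eqOn {η : E → E [⋀^Fin (n + 1)]→L[ℝ] ℝ} (hS : IsOpen S)
    (hV : ContDiffOn ℝ ∞ V S) (hη : ContDiffOn ℝ ∞ η S) (j : ℕ) :
    EqOn ((intD V)^[j + 1] η) ((lieDeriv V)^[j] (intD V η)) S := by
  have h0 := contDiffOn_intD hS hV hη
  cases j with
  | zero => exact fun _ _ => rfl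
  | succ j =>
    intro x hx
    rw [lieDeriv_iterate_eqOn hS hV h0 j hx, Pi.add_apply, Function.iterate_succ_apply (dInt V),
      dInt_intD]
    have : (dInt V)^[j] (0 : E → E [⋀^Fin (n + 1)]→L[ℝ] ℝ) = 0 :=
      Function.iterate_fixed (by rw [dInt]; exact extDeriv_zero) _
    rw [this, Pi.zero_apply, add_zero]; rfl

/-- Only a regrouping of factors. For one-forms the right side is an iterated directional derivative
of the function `i_V η`. -/
theorem intProd_dInt_iterate (V : E → E) (η : E → E [⋀^Fin (n + 1)]→L[ℝ] ℝ) (j : ℕ) :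
    intProd V ((dInt V)^[j] η) = (intD V)^[j] (intProd V η) := by
  induction j with
  | zero => rfl
  | succ j ih =>
    rw [Function.iterate_succ_apply', Function.iterate_succ_apply', ← ih]; rfl

theorem intD_iterate_congr {η₁ η₂ : E → E [⋀^Fin n]→L[ℝ] ℝ} (hS : IsOpen S)
    (h : EqOn (extDeriv η₁) (extDeriv η₂) S) (j : ℕ) :
    EqOn ((intD V)^[j + 1] η₁) ((intD V)^[j + 1] η₂) S := by
  rw [Function.iterate_succ_apply, Function.iterate_succ_apply]
  exact Set.EqOn.iterate_of_local (fun _ _ => Set.EqOn.intD hS) h.intProd j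

end Cartan

end

section

/-! ### Calculus of first-order operators `g·∇ + M`. -/

section Operator

variable {E : Type*} [NormedAddCommGroup E] [NormedSpace ℝ E]
  {F : Type*} [NormedAddCommGroup F] [NormedSpace ℝ F] {S : Set E} {g : E → E}

/-- The first-order operator `f ↦ g · ∇f + M f` on vector-valued functions. -/
def lop (g : E → E) (M : E → F →L[ℝ] F) (f : E → F) : E → F :=
  fun z => fderiv ℝ f z (g z) + M z (f z)

theorem lop_zero_apply (g : E → E) (f : E → F) (z : E) : lop g 0 f z = fderiv ℝ f z (g z) := by
  simp [lop]

theorem contDiffOn_zeroMul {m : WithTop ℕ∞} : ContDiffOn ℝ m (0 : E → F →L[ℝ] F) S :=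
  contDiffOn_const

theorem contDiffOn_lop {M : E → F →L[ℝ] F} (hS : IsOpen S) (hg : ContDiffOn ℝ ∞ g S)
    (hM : ContDiffOn ℝ ∞ M S) {f : E → F} (hf : ContDiffOn ℝ ∞ f S) :
    ContDiffOn ℝ ∞ (lop g M f) S :=
  ((hf.fderiv_of_isOpen hS (by simp)).clm_apply hg).add (hM.clm_apply hf)

theorem contDiffOn_lop_iterate {M : E → F →L[ℝ] F} (hS : IsOpen S) (hg : ContDiffOn ℝ ∞ g S)
    (hM : ContDiffOn ℝ ∞ M S) {f : E → F} (hf : ContDiffOn ℝ ∞ f S) (n : ℕ) :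
    ContDiffOn ℝ ∞ ((lop g M)^[n] f) S :=
  contDiffOn_iterate (fun _ => contDiffOn_lop hS hg hM) hf n

theorem _root_.ContDiffOn.differentiableAt_of_isOpen {f : E → F} (hf : ContDiffOn ℝ ∞ f S)
    (hS : IsOpen S) {z : E} (hz : z ∈ S) : DifferentiableAt ℝ f z :=
  (hf.contDiffAt (hS.mem_nhds hz)).differentiableAt (by simp)

theorem _root_.Set.EqOn.lop {M : E → F →L[ℝ] F} (hS : IsOpen S) {f₁ f₂ : E → F}
    (h : EqOn f₁ f₂ S) : EqOn (lop g M f₁) (lop g M f₂) S := fun z hz => by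
  simp only [GCWave.lop, (h.eventuallyEq_of_mem (hS.mem_nhds hz)).fderiv_eq, h hz]

theorem _root_.Set.EqOn.lop_iterate {M : E → F →L[ℝ] F} (hS : IsOpen S) {f₁ f₂ : E → F}
    (h : EqOn f₁ f₂ S) (n : ℕ) : EqOn ((GCWave.lop g M)^[n] f₁) ((GCWave.lop g M)^[n] f₂) S :=
  Set.EqOn.iterate_of_local (fun _ _ => Set.EqOn.lop hS) h n

theorem lop_add {M : E → F →L[ℝ] F} {f₁ f₂ : E → F} {z : E} (h₁ : DifferentiableAt ℝ f₁ z)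
    (h₂ : DifferentiableAt ℝ f₂ z) : lop g M (f₁ + f₂) z = lop g M f₁ z + lop g M f₂ z := by
  simp only [lop, fderiv_add h₁ h₂, _root_.add_apply, Pi.add_apply, map_add]
  abel

theorem lop_const_smul {M : E → F →L[ℝ] F} (c : ℝ) (f : E → F) (z : E) :
    lop g M (c • f) z = c • lop g M f z := by
  simp only [lop, fderiv_const_smul_field, Pi.smul_apply, map_smul, smul_add,
    _root_.smul_apply]

theorem lop_sum_smul {M : E → F →L[ℝ] F} {ι : Type*} (s : Finset ι) (c : ι → ℝ) (f : ι → E → F)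
    {z : E} (hf : ∀ i, DifferentiableAt ℝ (f i) z) :
    lop g M (fun y => ∑ i ∈ s, c i • f i y) z = ∑ i ∈ s, c i • lop g M (f i) z := by
  have h : HasFDerivAt (fun y => ∑ i ∈ s, c i • f i y) (∑ i ∈ s, c i • fderiv ℝ (f i) z) z :=
    HasFDerivAt.fun_sum fun i _ => (hf i).hasFDerivAt.const_smul (c i)
  simp only [lop, h.fderiv, sum_apply, map_sum, ← Finset.sum_add_distrib, map_smul, smul_add,
    _root_.smul_apply]

theorem lop_iterate_add {M : E → F →L[ℝ] F} (hS : IsOpen S) (hg : ContDiffOn ℝ ∞ g S)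
    (hM : ContDiffOn ℝ ∞ M S) {f₁ f₂ : E → F} (h₁ : ContDiffOn ℝ ∞ f₁ S)
    (h₂ : ContDiffOn ℝ ∞ f₂ S) (n : ℕ) :
    EqOn ((lop g M)^[n] (f₁ + f₂)) ((lop g M)^[n] f₁ + (lop g M)^[n] f₂) S := by
  induction n with
  | zero => exact fun _ _ => rfl
  | succ n ih =>
    intro z hz
    simp only [Function.iterate_succ_apply', Pi.add_apply]
    rw [Set.EqOn.lop hS ih hz]
    exact lop_add
      ((contDiffOn_lop_iterate hS hg hM h₁ n).differentiableAt_of_isOpen hS hz)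
      ((contDiffOn_lop_iterate hS hg hM h₂ n).differentiableAt_of_isOpen hS hz)

theorem lop_iterate_const_smul {M : E → F →L[ℝ] F} (c : ℝ) (f : E → F) (n : ℕ) :
    (lop g M)^[n] (c • f) = c • (lop g M)^[n] f := by
  induction n with
  | zero => rfl
  | succ n ih =>
    rw [Function.iterate_succ_apply', Function.iterate_succ_apply', ih]
    funext z; exact lop_const_smul _ _ _

variable [NormedSpace ℂ F] [IsScalarTower ℝ ℂ F]

/-- The Leibniz rule for multiplication by a complex function. -/
theorem lop_smul {M : E → F →L[ℝ] F} (hMc : ∀ z (c : ℂ) x, M z (c • x) = c • M z x)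
    {h : E → ℂ} {f : E → F} {z : E} (hh : DifferentiableAt ℝ h z) (hf : DifferentiableAt ℝ f z) :
    lop g M (fun y => h y • f y) z = lop g 0 h z • f z + h z • lop g M f z := by
  simp only [lop, hMc, fderiv_fun_smul hh hf]
  simp
  abel

/-- Binomial Leibniz rule. Complex linearity of `M` lets scalar functions pass through it, so the
scalar factor is acted on by `g·∇` alone. -/
theorem lop_iterate_smul {M : E → F →L[ℝ] F} (hS : IsOpen S) (hg : ContDiffOn ℝ ∞ g S)
    (hM : ContDiffOn ℝ ∞ M S) (hMc : ∀ z (c : ℂ) x, M z (c • x) = c • M z x)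
    {h : E → ℂ} {f : E → F} (hh : ContDiffOn ℝ ∞ h S) (hf : ContDiffOn ℝ ∞ f S) (n : ℕ) :
    EqOn ((lop g M)^[n] (fun y => h y • f y))
      (fun z => ∑ ij ∈ Finset.HasAntidiagonal.antidiagonal n,
        (n.choose ij.1 : ℝ) • ((lop g 0)^[ij.1] h z • (lop g M)^[ij.2] f z)) S := by
  induction n with
  | zero => intro z _; simp
  | succ n ih =>
    intro z hz
    have d1 : ∀ i, DifferentiableAt ℝ ((lop g 0)^[i] h) z := fun i =>
      (contDiffOn_lop_iterate hS hg contDiffOn_zeroMul hh i).differentiableAt_of_isOpen hS hz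
    have d2 : ∀ i, DifferentiableAt ℝ ((lop g M)^[i] f) z := fun i =>
      (contDiffOn_lop_iterate hS hg hM hf i).differentiableAt_of_isOpen hS hz
    rw [Function.iterate_succ_apply', Set.EqOn.lop hS ih hz]
    have d : ∀ ij : ℕ × ℕ, DifferentiableAt ℝ
        (fun z => (lop g 0)^[ij.1] h z • (lop g M)^[ij.2] f z) z :=
      fun ij => (d1 ij.1).smul (d2 ij.2)
    have e := lop_sum_smul (g := g) (M := M) (Finset.HasAntidiagonal.antidiagonal n)
      (fun ij : ℕ × ℕ => (n.choose ij.1 : ℝ)) _ d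
    rw [e]
    -- Pascal's rule, in the form that increases one of the two exponents in each term.
    have L := Finset.sum_antidiagonal_choose_succ_nsmul
      (fun i j => (lop g 0)^[i] h z • (lop g M)^[j] f z) n
    simp only [← Nat.cast_smul_eq_nsmul ℝ] at L
    refine Eq.trans ?_ L.symm
    rw [add_comm, ← Finset.sum_add_distrib]
    refine Finset.sum_congr rfl fun ij hij => ?_
    rw [lop_smul hMc (d1 _) (d2 _), ← Function.iterate_succ_apply' (lop g 0),
      ← Function.iterate_succ_apply' (lop g M), smul_add,
      Nat.choose_symm_of_eq_add (Finset.HasAntidiagonal.mem_antidiagonal.1 hij).symm]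

end Operator

/-! ### Real forms as `σ + c.c.`, and their operators on complex amplitudes. -/

section FormOperator

variable {E : Type*} [NormedAddCommGroup E] [NormedSpace ℝ E] {S : Set E} {g : E → E}

/-- `cc` as a continuous linear map. -/
def ccCLM : ℂ →L[ℝ] ℝ := (2 : ℝ) • Complex.reCLM

theorem ccCLM_apply (z : ℂ) : ccCLM z = cc z := by simp [ccCLM, cc]

/-- The real one-form `σ + c.c.` of a complex-valued covector. -/
def toForm1 (E : Type*) [NormedAddCommGroup E] [NormedSpace ℝ E] :
    (E →L[ℝ] ℂ) →L[ℝ] (E [⋀^Fin 1]→L[ℝ] ℝ) :=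
  ((ContinuousAlternatingMap.ofSubsingletonLIE (𝕜 := ℝ) (E := E) (F := ℝ)
    (0 : Fin 1)).toContinuousLinearEquiv : (E →L[ℝ] ℝ) →L[ℝ] (E [⋀^Fin 1]→L[ℝ] ℝ)).comp
    (ContinuousLinearMap.compL ℝ E ℂ ℝ ccCLM)

/-- The real zero-form `f + c.c.` of a complex number. -/
def toForm0 (E : Type*) [NormedAddCommGroup E] [NormedSpace ℝ E] :
    ℂ →L[ℝ] (E [⋀^Fin 0]→L[ℝ] ℝ) :=
  ((ContinuousAlternatingMap.constOfIsEmptyLIE ℝ E ℝ (Fin 0)).toContinuousLinearEquiv :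
    ℝ →L[ℝ] (E [⋀^Fin 0]→L[ℝ] ℝ)).comp ccCLM

theorem toForm1_apply (σ : E →L[ℝ] ℂ) (v : Fin 1 → E) : toForm1 E σ v = cc (σ (v 0)) := by
  rw [← ccCLM_apply]; rfl

theorem toForm0_apply (c : ℂ) (v : Fin 0 → E) : toForm0 E c v = cc c := by
  rw [← ccCLM_apply]; rfl

/-- The zero-order part of the Lie derivative on one-forms. -/
def formMul (G : Type*) [NormedAddCommGroup G] [NormedSpace ℝ G] (g : E → E) :
    E → (E →L[ℝ] G) →L[ℝ] (E →L[ℝ] G) :=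
  fun z => (ContinuousLinearMap.compL ℝ E E G).flip (fderiv ℝ g z)

theorem formMul_apply {G : Type*} [NormedAddCommGroup G] [NormedSpace ℝ G] (g : E → E) (z : E)
    (σ : E →L[ℝ] G) : formMul G g z σ = σ.comp (fderiv ℝ g z) := rfl

theorem contDiffOn_formMul {G : Type*} [NormedAddCommGroup G] [NormedSpace ℝ G]
    {m k : WithTop ℕ∞} (hS : IsOpen S) (hg : ContDiffOn ℝ m g S) (h : k + 1 ≤ m) :
    ContDiffOn ℝ k (formMul G g) S :=
  have h' : ContDiff ℝ k (fun ξ : E →L[ℝ] E => (ContinuousLinearMap.compL ℝ E E G).flip ξ) :=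
    ContinuousLinearMap.contDiff (F := (E →L[ℝ] G) →L[ℝ] (E →L[ℝ] G)) _
  h'.comp_contDiffOn (hg.fderiv_of_isOpen hS h)

/-- Interchange of arguments as a continuous linear map. -/
def flipCLM (E : Type*) [NormedAddCommGroup E] [NormedSpace ℝ E] :
    (E →L[ℝ] E →L[ℝ] ℂ) →L[ℝ] (E →L[ℝ] E →L[ℝ] ℂ) :=
  ((ContinuousLinearMap.flipₗᵢ ℝ E E ℂ).toContinuousLinearEquiv :
    (E →L[ℝ] E →L[ℝ] ℂ) →L[ℝ] (E →L[ℝ] E →L[ℝ] ℂ))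

/-- The contraction of `g` with the exterior derivative of the covector field `σ`. -/
def intCurl (g : E → E) (σ : E → E →L[ℝ] ℂ) : E → E →L[ℝ] ℂ :=
  fun z => fderiv ℝ σ z (g z) - (fderiv ℝ σ z).flip (g z)

theorem intCurl_apply (g : E → E) (σ : E → E →L[ℝ] ℂ) (z v : E) :
    intCurl g σ z v = fderiv ℝ σ z (g z) v - fderiv ℝ σ z v (g z) := rfl

theorem contDiffOn_intCurl {m k : WithTop ℕ∞} {σ : E → E →L[ℝ] ℂ} (hS : IsOpen S)
    (hg : ContDiffOn ℝ k g S) (hσ : ContDiffOn ℝ m σ S) (h : k + 1 ≤ m) :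
    ContDiffOn ℝ k (intCurl g σ) S := by
  have h1 : ContDiffOn ℝ k (fderiv ℝ σ) S := hσ.fderiv_of_isOpen hS h
  have h3 : ContDiff ℝ k (fun ξ => flipCLM E ξ) :=
    ContinuousLinearMap.contDiff (F := E →L[ℝ] E →L[ℝ] ℂ) _
  have h2 : ContDiffOn ℝ k (fun z => (fderiv ℝ σ z).flip) S := h3.comp_contDiffOn h1
  exact (h1.clm_apply hg).sub (h2.clm_apply hg)

theorem fderiv_toForm1 {σ : E → E →L[ℝ] ℂ} {z : E} (hσ : DifferentiableAt ℝ σ z) (u : E) :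
    fderiv ℝ (fun y => toForm1 E (σ y)) z u = toForm1 E (fderiv ℝ σ z u) := by
  have h := (toForm1 E).hasFDerivAt.comp z hσ.hasFDerivAt
  rw [show (fun y => toForm1 E (σ y)) = (toForm1 E) ∘ σ from rfl, h.fderiv]; rfl

theorem fderiv_toForm0 {f : E → ℂ} {z : E} (hf : DifferentiableAt ℝ f z) (u : E) :
    fderiv ℝ (fun y => toForm0 E (f y)) z u = toForm0 E (fderiv ℝ f z u) := by
  have h := (toForm0 E).hasFDerivAt.comp z hf.hasFDerivAt
  rw [show (fun y => toForm0 E (f y)) = (toForm0 E) ∘ f from rfl, h.fderiv]; rfl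

/-- Taking `σ + c.c.` is a fixed real-linear map, so it commutes with differentiation; the terms
with `∇g` are composition with the derivative of `g`. -/
theorem lieDeriv_toForm1 {σ : E → E →L[ℝ] ℂ} {z : E} (hσ : DifferentiableAt ℝ σ z) :
    lieDeriv g (fun y => toForm1 E (σ y)) z = toForm1 E (lop g (formMul ℂ g) σ z) := by
  ext v
  rw [lieDeriv_apply, fderiv_toForm1 hσ]
  simp [lop, toForm1_apply, formMul_apply, cc]

theorem lieDeriv_iterate_toForm1 {σ : E → E →L[ℝ] ℂ} (hS : IsOpen S) (hg : ContDiffOn ℝ ∞ g S)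
    (hσ : ContDiffOn ℝ ∞ σ S) (n : ℕ) : EqOn ((lieDeriv g)^[n] (fun y => toForm1 E (σ y)))
      (fun z => toForm1 E ((lop g (formMul ℂ g))^[n] σ z)) S := by
  induction n with
  | zero => exact fun _ _ => rfl
  | succ n ih =>
    intro z hz
    have h := (contDiffOn_lop_iterate hS hg (contDiffOn_formMul (G := ℂ) hS hg (by simp)) hσ
      n).differentiableAt_of_isOpen hS hz
    rw [Function.iterate_succ_apply', ih.lieDeriv hS hz, lieDeriv_toForm1 h]
    simp only [Function.iterate_succ_apply']

theorem extDeriv_toForm1 {σ : E → E →L[ℝ] ℂ} {z : E} (hσ : DifferentiableAt ℝ σ z) (u v : E) :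
    extDeriv (fun y => toForm1 E (σ y)) z ![u, v] =
      cc (fderiv ℝ σ z u v - fderiv ℝ σ z v u) := by
  rw [extDeriv, ContinuousAlternatingMap.alternatizeUncurryFin_apply, Fin.sum_univ_two]
  simp [fderiv_toForm1 hσ, toForm1_apply, Fin.removeNth, cc]
  ring

theorem intD_toForm1 {σ : E → E →L[ℝ] ℂ} {z : E} (hσ : DifferentiableAt ℝ σ z) :
    intD g (fun y => toForm1 E (σ y)) z = toForm1 E (intCurl g σ z) := by
  ext v
  rw [intD, intProd_apply, toForm1_apply, intCurl_apply, ← extDeriv_toForm1 hσ]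
  congr 1
  ext i; fin_cases i <;> rfl

theorem intProd_toForm1 (σ : E → E →L[ℝ] ℂ) :
    intProd g (fun y => toForm1 E (σ y)) = fun z => toForm0 E (σ z (g z)) := by
  funext z; ext v
  rw [intProd_apply, toForm1_apply, toForm0_apply]; rfl

theorem extDeriv_toForm0 {f : E → ℂ} {z : E} (hf : DifferentiableAt ℝ f z) :
    extDeriv (fun y => toForm0 E (f y)) z = toForm1 E (fderiv ℝ f z) := by
  ext v
  rw [extDeriv, ContinuousAlternatingMap.alternatizeUncurryFin_apply]
  simp [fderiv_toForm0 hf, toForm1_apply, toForm0_apply]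

/-- On functions `i_g d` is the derivative along `g`, with no zero-order part. -/
theorem intD_toForm0 {f : E → ℂ} {z : E} (hf : DifferentiableAt ℝ f z) :
    intD g (fun y => toForm0 E (f y)) z = toForm0 E (lop g 0 f z) := by
  ext v
  rw [intD, intProd_apply, extDeriv_toForm0 hf, toForm1_apply, toForm0_apply, lop_zero_apply]; rfl

theorem intD_iterate_toForm0 {f : E → ℂ} (hS : IsOpen S) (hg : ContDiffOn ℝ ∞ g S)
    (hf : ContDiffOn ℝ ∞ f S) (n : ℕ) : EqOn ((intD g)^[n] (fun y => toForm0 E (f y)))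
      (fun z => toForm0 E ((lop g 0)^[n] f z)) S := by
  induction n with
  | zero => exact fun _ _ => rfl
  | succ n ih =>
    intro z hz
    have h := (contDiffOn_lop_iterate hS hg contDiffOn_zeroMul hf n).differentiableAt_of_isOpen hS hz
    rw [Function.iterate_succ_apply', ih.intD hS hz, intD_toForm0 h]
    simp only [Function.iterate_succ_apply']

end FormOperator

end

section

/-! ### Factorial derivative bounds for analytic functions. -/

section DerivativeBounds

open scoped NNReal ENNReal

variable {E : Type*} [NormedAddCommGroup E] [NormedSpace ℝ E]
  {F : Type*} [NormedAddCommGroup F] [NormedSpace ℝ F]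

/-- All re-expanded series with centre within `r` are dominated by one summable double series, whose
total is the uniform constant `T`. -/
theorem nnnorm_changeOrigin_mul_pow_le (p : FormalMultilinearSeries ℝ E F) {r r' : ℝ≥0}
    (hr : (r + r' : ℝ≥0∞) < p.radius) :
    ∃ T : ℝ≥0, ∀ x : E, ‖x‖₊ ≤ r → ∀ k, ‖p.changeOrigin x k‖₊ * r' ^ k ≤ T := by
  have h1 := p.changeOriginSeries_summable_aux₁ hr
  refine ⟨∑' k, ∑' s : Σ l : ℕ, { s : Finset (Fin (k + l)) // s.card = l },
    ‖p (k + s.1)‖₊ * r ^ s.1 * r' ^ k, fun x hx k => ?_⟩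
  have hr2 : (r : ℝ≥0∞) < p.radius := (le_add_right le_rfl).trans_lt hr
  have hx2 : (‖x‖₊ : ℝ≥0∞) < p.radius := (ENNReal.coe_le_coe.2 hx).trans_lt hr2
  calc ‖p.changeOrigin x k‖₊ * r' ^ k
      ≤ (∑' s : Σ l : ℕ, { s : Finset (Fin (k + l)) // s.card = l },
          ‖p (k + s.1)‖₊ * r ^ s.1) * r' ^ k := by
        gcongr
        refine (p.nnnorm_changeOrigin_le k hx2).trans ?_
        refine Summable.tsum_le_tsum (fun s => ?_) (p.changeOriginSeries_summable_aux₂ hx2 k)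
          (p.changeOriginSeries_summable_aux₂ hr2 k)
        gcongr
    _ = ∑' s : Σ l : ℕ, { s : Finset (Fin (k + l)) // s.card = l },
          ‖p (k + s.1)‖₊ * r ^ s.1 * r' ^ k := by rw [NNReal.tsum_mul_right]
    _ ≤ _ := (NNReal.summable_sigma.1 h1).2.le_tsum' k

/-- `f` has derivatives of all orders on `N` bounded by `C n! aⁿ`. -/
def DerivBound (N : Set E) (f : E → F) (C a : ℝ) : Prop :=
  ∀ z ∈ N, ∀ n, ‖iteratedFDeriv ℝ n f z‖ ≤ C * n.factorial * a ^ n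

theorem DerivBound.mono {N N' : Set E} {f : E → F} {C C' a a' : ℝ} (h : DerivBound N f C a)
    (hN : N' ⊆ N) (ha : 0 ≤ a) (haa : a ≤ a') (hC : C ≤ C') (hC0 : 0 ≤ C') :
    DerivBound N' f C' a' := fun z hz n => (h z (hN hz) n).trans (by gcongr)

theorem _root_.AnalyticAt.exists_derivBound [CompleteSpace F] {f : E → F} {z₀ : E}
    (hf : AnalyticAt ℝ f z₀) :
    ∃ N, IsOpen N ∧ z₀ ∈ N ∧ ∃ C a : ℝ, 0 ≤ C ∧ 0 ≤ a ∧ DerivBound N f C a := by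
  obtain ⟨p, R, hp⟩ := hf
  obtain ⟨ρ, hρ0, hρ⟩ := ENNReal.lt_iff_exists_nnreal_btwn.1 hp.r_pos
  have hρ0' : 0 < ρ := by exact_mod_cast hρ0
  have hsum : ((ρ / 2 : ℝ≥0) + (ρ / 2 : ℝ≥0) : ℝ≥0∞) < p.radius := by
    rw [← ENNReal.coe_add, add_halves]; exact hρ.trans_le hp.r_le
  obtain ⟨T, hT⟩ := nnnorm_changeOrigin_mul_pow_le p hsum
  refine ⟨Metric.ball z₀ (ρ / 2 : ℝ≥0), Metric.isOpen_ball, Metric.mem_ball_self (by positivity),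
    T, ((ρ / 2 : ℝ≥0) : ℝ)⁻¹, T.2, by positivity, fun z hz n => ?_⟩
  have hy : ‖z - z₀‖₊ < ρ / 2 := by
    rw [Metric.mem_ball, dist_eq_norm] at hz; exact_mod_cast hz
  have hyR : (‖z - z₀‖₊ : ℝ≥0∞) < R := by
    refine lt_trans ?_ hρ
    exact ENNReal.coe_lt_coe.2 (hy.trans (NNReal.half_lt_self hρ0'.ne'))
  have hq := hp.changeOrigin hyR
  rw [add_sub_cancel] at hq
  refine ContinuousMultilinearMap.opNorm_le_bound (by positivity) fun v => ?_
  -- The derivative symmetrizes the `n`-th coefficient over all permutations, which produces the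
  -- factor `n!`.
  rw [hq.iteratedFDeriv_eq_sum_of_completeSpace]
  refine (norm_sum_le _ _).trans ?_
  have hb : ‖p.changeOrigin (z - z₀) n‖ ≤ T * ((ρ / 2 : ℝ≥0) : ℝ)⁻¹ ^ n := by
    have h := hT _ hy.le n
    have h' : ‖p.changeOrigin (z - z₀) n‖ * ((ρ / 2 : ℝ≥0) : ℝ) ^ n ≤ T := by exact_mod_cast h
    rw [inv_pow, ← div_eq_mul_inv, le_div_iff₀ (by positivity)]
    exact h'
  calc ∑ σ : Equiv.Perm (Fin n), ‖p.changeOrigin (z - z₀) n fun i => v (σ i)‖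
      ≤ ∑ σ : Equiv.Perm (Fin n), (T * ((ρ / 2 : ℝ≥0) : ℝ)⁻¹ ^ n) * ∏ i, ‖v i‖ := by
        refine Finset.sum_le_sum fun σ _ => ?_
        refine (ContinuousMultilinearMap.le_opNorm _ _).trans ?_
        rw [Equiv.prod_comp σ fun i => ‖v i‖]
        gcongr
    _ = _ := by
        rw [Finset.sum_const, Finset.card_univ, Fintype.card_perm, Fintype.card_fin, nsmul_eq_mul]
        ring

/-- Compactness: local bounds combine under finite unions by taking maxima of the constants. The
bound holds on an open neighbourhood, as later differentiation requires. -/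
theorem _root_.AnalyticOnNhd.exists_derivBound [CompleteSpace F] {f : E → F} {S K : Set E}
    (hS : IsOpen S) (hf : AnalyticOnNhd ℝ f S) (hK : IsCompact K) (hKS : K ⊆ S) :
    ∃ N, IsOpen N ∧ K ⊆ N ∧ N ⊆ S ∧ ∃ C a : ℝ, 0 ≤ C ∧ 0 ≤ a ∧ DerivBound N f C a := by
  refine hK.induction_on (p := fun K => ∃ N, IsOpen N ∧ K ⊆ N ∧ N ⊆ S ∧
    ∃ C a : ℝ, 0 ≤ C ∧ 0 ≤ a ∧ DerivBound N f C a) ?_ ?_ ?_ ?_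
  · exact ⟨∅, isOpen_empty, le_rfl, empty_subset _, 0, 0, le_rfl, le_rfl, fun _ h => h.elim⟩
  · rintro s t hst ⟨N, h1, h2, h3⟩
    exact ⟨N, h1, hst.trans h2, h3⟩
  · rintro s t ⟨N, h1, h2, h3, C, a, hC, ha, hb⟩ ⟨N', h1', h2', h3', C', a', hC', ha', hb'⟩
    refine ⟨N ∪ N', h1.union h1', union_subset_union h2 h2', union_subset h3 h3', max C C',
      max a a', hC.trans (le_max_left _ _), ha.trans (le_max_left _ _), ?_⟩
    rintro z (hz | hz)
    · exact hb.mono le_rfl ha (le_max_left _ _) (le_max_left _ _) (hC.trans (le_max_left _ _)) z hz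
    · exact hb'.mono le_rfl ha' (le_max_right _ _) (le_max_right _ _)
        (hC.trans (le_max_left _ _)) z hz
  · intro z hz
    obtain ⟨N, h1, h2, C, a, hC, ha, hb⟩ := (hf z (hKS hz)).exists_derivBound
    refine ⟨N ∩ S, mem_nhdsWithin_of_mem_nhds ((h1.inter hS).mem_nhds ⟨h2, hKS hz⟩), N ∩ S,
      h1.inter hS, le_rfl, inter_subset_right, C, a, hC, ha, fun z hz => hb z hz.1⟩

end DerivativeBounds

/-! ### Growth of iterates, by majorants that are powers of `1/(1 - ax)`. -/

section Majorant

theorem ascFactorial_mono {m k : ℕ} (h : m ≤ k) (n : ℕ) : m.ascFactorial n ≤ k.ascFactorial n := by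
  induction n with
  | zero => simp
  | succ n ih => rw [Nat.ascFactorial_succ, Nat.ascFactorial_succ]; gcongr

/-- Since `m.ascFactorial n` is the `n`-th derivative of `(1 - x)^(-m)` at `0`, this is the Leibniz
rule for `(1 - x)^(-m) (1 - x)^(-1) = (1 - x)^(-(m+1))`. -/
theorem sum_choose_mul_ascFactorial (m n : ℕ) :
    ∑ i ∈ Finset.range (n + 1), n.choose i * m.ascFactorial i * (n - i).factorial =
      (m + 1).ascFactorial n := by
  induction n with
  | zero => simp
  | succ n ih =>
    rw [Finset.sum_range_succ]
    have h : ∀ i ∈ Finset.range (n + 1), (n + 1).choose i * m.ascFactorial i *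
        (n + 1 - i).factorial = (n + 1) * (n.choose i * m.ascFactorial i * (n - i).factorial) := by
      intro i hi
      have hi' : i ≤ n := Nat.lt_succ_iff.1 (Finset.mem_range.1 hi)
      have h1 := Nat.choose_mul_succ_eq n i
      rw [show n + 1 - i = n - i + 1 by omega] at h1 ⊢
      rw [Nat.factorial_succ]
      calc _ = ((n + 1).choose i * (n - i + 1)) * (m.ascFactorial i * (n - i).factorial) := by ring
        _ = _ := by rw [← h1]; ring
    rw [Finset.sum_congr rfl h, ← Finset.mul_sum, ih]
    simp only [Nat.choose_self, Nat.sub_self, Nat.factorial_zero, Nat.ascFactorial_succ]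
    have := Nat.succ_ascFactorial m n
    simp only [Nat.succ_eq_add_one] at this
    nlinarith

variable {E : Type*} [NormedAddCommGroup E] [NormedSpace ℝ E]
  {F : Type*} [NormedAddCommGroup F] [NormedSpace ℝ F] {N : Set E} {g : E → E}
  {M : E → F →L[ℝ] F}

theorem norm_iteratedFDeriv_clm_apply_of_isOpen {G H : Type*} [NormedAddCommGroup G]
    [NormedSpace ℝ G] [NormedAddCommGroup H] [NormedSpace ℝ H] (hN : IsOpen N)
    {f : E → G →L[ℝ] H} {u : E → G} (hf : ContDiffOn ℝ ∞ f N) (hu : ContDiffOn ℝ ∞ u N) {z : E}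
    (hz : z ∈ N) (n : ℕ) :
    ‖iteratedFDeriv ℝ n (fun y => f y (u y)) z‖ ≤ ∑ i ∈ Finset.range (n + 1),
      (n.choose i : ℝ) * ‖iteratedFDeriv ℝ i f z‖ * ‖iteratedFDeriv ℝ (n - i) u z‖ := by
  have := norm_iteratedFDerivWithin_clm_apply (n := n) hf hu hN.uniqueDiffOn hz
    (by exact_mod_cast le_top)
  simpa only [iteratedFDerivWithin_of_isOpen _ hN hz] using this

/-- If `C (1 - ax)^(-m)` majorizes `f`, differentiation gives `C m a (1 - ax)^(-(m+1))` and the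
factor `g` one further power, whence `m + 2`. Multiplication by `M` gives only `m + 1`; it is
enlarged to the same form, which uses `1 ≤ m`. -/
theorem norm_iteratedFDeriv_lop_le {G H C a : ℝ} (hN : IsOpen N) (hH0 : 0 ≤ H)
    (ha : 0 ≤ a) (hC : 0 ≤ C)
    (hgs : ContDiffOn ℝ ∞ g N) (hMs : ContDiffOn ℝ ∞ M N) (hg : DerivBound N g G a)
    (hM : DerivBound N M H a) {f : E → F} (hfs : ContDiffOn ℝ ∞ f N) {m : ℕ} (hm : 1 ≤ m)
    {z : E} (hz : z ∈ N) (hf : ∀ n, ‖iteratedFDeriv ℝ n f z‖ ≤ C * m.ascFactorial n * a ^ n)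
    (n : ℕ) : ‖iteratedFDeriv ℝ n (lop g M f) z‖ ≤
      C * (m * (G * a + H)) * (m + 2).ascFactorial n * a ^ n := by
  have hdf : ContDiffOn ℝ ∞ (fderiv ℝ f) N := hfs.fderiv_of_isOpen hN (by simp)
  have e : iteratedFDeriv ℝ n (lop g M f) z = iteratedFDeriv ℝ n (fun y => fderiv ℝ f y (g y)) z +
      iteratedFDeriv ℝ n (fun y => M y (f y)) z := by
    have hn : (n : WithTop ℕ∞) ≤ ∞ := by exact_mod_cast le_top
    exact iteratedFDeriv_add_apply (((hdf.clm_apply hgs).contDiffAt (hN.mem_nhds hz)).of_le hn)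
      (((hMs.clm_apply hfs).contDiffAt (hN.mem_nhds hz)).of_le hn)
  have key := fun k : ℕ => congrArg (Nat.cast : ℕ → ℝ) (sum_choose_mul_ascFactorial k n)
  push_cast at key
  have h1 : ‖iteratedFDeriv ℝ n (fun y => fderiv ℝ f y (g y)) z‖ ≤
      C * (m * (G * a)) * (m + 2).ascFactorial n * a ^ n := by
    refine (norm_iteratedFDeriv_clm_apply_of_isOpen hN hdf hgs hz n).trans ?_
    rw [← key (m + 1), Finset.mul_sum, Finset.sum_mul]
    refine Finset.sum_le_sum fun i hi => ?_
    have hi' : i ≤ n := Nat.lt_succ_iff.1 (Finset.mem_range.1 hi)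
    rw [norm_iteratedFDeriv_fderiv]
    have ea : (m.ascFactorial (i + 1) : ℝ) = m * (m + 1).ascFactorial i := by
      have := Nat.succ_ascFactorial m i
      rw [Nat.ascFactorial_succ, ← this]; push_cast; rfl
    calc (n.choose i : ℝ) * ‖iteratedFDeriv ℝ (i + 1) f z‖ * ‖iteratedFDeriv ℝ (n - i) g z‖
        ≤ (n.choose i : ℝ) * (C * m.ascFactorial (i + 1) * a ^ (i + 1)) *
            (G * (n - i).factorial * a ^ (n - i)) := by
          gcongr
          · exact hf _
          · exact hg z hz _
      _ = _ := by
          rw [ea, ← pow_sub_mul_pow a hi']; ring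
  have h2 : ‖iteratedFDeriv ℝ n (fun y => M y (f y)) z‖ ≤
      C * (m * H) * (m + 2).ascFactorial n * a ^ n := by
    refine (norm_iteratedFDeriv_clm_apply_of_isOpen hN hMs hfs hz n).trans ?_
    calc _ ≤ ∑ i ∈ Finset.range (n + 1), C * H * (n.choose i * m.ascFactorial i *
          (n - i).factorial) * a ^ n := by
          rw [← Finset.sum_range_reflect]
          refine Finset.sum_le_sum fun i hi => ?_
          have hi' : i ≤ n := Nat.lt_succ_iff.1 (Finset.mem_range.1 hi)
          have e1 : n + 1 - 1 - i = n - i := by omega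
          have e2 : n - (n - i) = i := by omega
          rw [e1, e2, Nat.choose_symm hi']
          calc _ ≤ (n.choose i : ℝ) * (H * (n - i).factorial * a ^ (n - i)) *
                (C * m.ascFactorial i * a ^ i) := by
                gcongr
                · exact hM z hz _
                · exact hf _
            _ = _ := by rw [← pow_sub_mul_pow a hi']; ring
      _ = C * H * (m + 1).ascFactorial n * a ^ n := by
          rw [← Finset.sum_mul, ← Finset.mul_sum, key m]
      _ ≤ _ := by
          -- The weaker exponent is raised to `m + 2` so that both contributions add.
          have : ((m + 1).ascFactorial n : ℝ) ≤ (m + 2).ascFactorial n := by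
            exact_mod_cast ascFactorial_mono (by omega) n
          have hm' : (1 : ℝ) ≤ m := by exact_mod_cast hm
          gcongr
          nlinarith
  rw [e]
  refine (norm_add_le _ _).trans ((add_le_add h1 h2).trans (le_of_eq ?_))
  ring

/-- Iterates of a first-order operator with analytic coefficients grow at most like
`j! Bʲ`, with `B` depending only on the coefficients and on the domain of analyticity. -/
theorem norm_lop_iterate_le {G H C a : ℝ} (hN : IsOpen N) (hG0 : 0 ≤ G) (hH0 : 0 ≤ H)
    (ha : 0 ≤ a) (hC : 0 ≤ C)
    (hgs : ContDiffOn ℝ ∞ g N) (hMs : ContDiffOn ℝ ∞ M N) (hg : DerivBound N g G a)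
    (hM : DerivBound N M H a) {f : E → F} (hfs : ContDiffOn ℝ ∞ f N) (hf : DerivBound N f C a)
    {z : E} (hz : z ∈ N) (j : ℕ) :
    ‖(lop g M)^[j] f z‖ ≤ C * j.factorial * (2 * (G * a + H)) ^ j := by
  -- All derivatives are controlled at once. The exponent starts at `1`, as `n! = 1.ascFactorial n`,
  -- and grows by two per application.
  have main : ∀ j, ∀ n, ‖iteratedFDeriv ℝ n ((lop g M)^[j] f) z‖ ≤
      (C * j.factorial * (2 * (G * a + H)) ^ j) * (2 * j + 1).ascFactorial n * a ^ n := by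
    intro j
    induction j with
    | zero => intro n; simpa [Nat.one_ascFactorial] using hf z hz n
    | succ j ih =>
      intro n
      rw [Function.iterate_succ_apply']
      refine (norm_iteratedFDeriv_lop_le hN hH0 ha (by positivity) hgs hMs hg hM
        (contDiffOn_lop_iterate hN hgs hMs hfs j) (by omega) hz ih n).trans ?_
      rw [show 2 * j + 1 + 2 = 2 * (j + 1) + 1 by ring]
      gcongr ?_ * _ * _
      rw [Nat.factorial_succ, pow_succ]
      push_cast
      -- The factor `2j + 1` of step `j` is at most `2(j + 1)`; the product of these is `2ʲ j!`.
      have : (2 * (j : ℝ) + 1) * (G * a + H) ≤ (j + 1) * (2 * (G * a + H)) := by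
        have : 0 ≤ G * a + H := by positivity
        nlinarith
      calc _ ≤ C * j.factorial * (2 * (G * a + H)) ^ j * ((j + 1) * (2 * (G * a + H))) := by
            gcongr
        _ = _ := by ring
  simpa using main j 0

end Majorant

end

section

/-! ### Exponential generating functions of sequences of growth `n! Bⁿ`. -/

section ExpSum

variable {F : Type*} [NormedAddCommGroup F] [NormedSpace ℂ F]

/-- The exponential generating function `∑ sⁿ/n! cₙ`. -/
def expSum (c : ℕ → F) (s : ℂ) : F := ∑' n : ℕ, (s ^ n / (n.factorial : ℂ)) • c n

/-- The bound `|cₙ| ≤ C n! Bⁿ`. -/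
def ExpBound (c : ℕ → F) (C B : ℝ) : Prop := ∀ n, ‖c n‖ ≤ C * n.factorial * B ^ n

variable {c : ℕ → F} {C B : ℝ}

theorem ExpBound.norm_term_le (h : ExpBound c C B) (s : ℂ) (n : ℕ) :
    ‖(s ^ n / (n.factorial : ℂ)) • c n‖ ≤ C * (B * ‖s‖) ^ n := by
  rw [norm_smul, norm_div, norm_pow, Complex.norm_natCast]
  calc _ ≤ ‖s‖ ^ n / n.factorial * (C * n.factorial * B ^ n) := by gcongr; exact h n
    _ = _ := by
      have : (n.factorial : ℝ) ≠ 0 := by positivity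
      field_simp
      ring

omit [NormedSpace ℂ F] in
theorem ExpBound.nonneg (h : ExpBound c C B) : 0 ≤ C := by
  simpa using (norm_nonneg _).trans (h 0)

omit [NormedSpace ℂ F] in
theorem ExpBound.mono {C' B' : ℝ} (h : ExpBound c C B) (hC : C ≤ C') (hB0 : 0 ≤ B)
    (hB : B ≤ B') : ExpBound c C' B' := fun n => by
  have := h.nonneg
  have := this.trans hC
  exact (h n).trans (by gcongr)

-- The additional factor `n + 1 ≤ 2ⁿ` is absorbed by doubling `B`.
omit [NormedSpace ℂ F] in
theorem ExpBound.succ (h : ExpBound c C B) (hB : 0 ≤ B) :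
    ExpBound (fun n => c (n + 1)) (C * B) (2 * B) := fun n => by
  have hC := h.nonneg
  refine (h (n + 1)).trans ?_
  have : ((n : ℝ) + 1) ≤ 2 ^ n := by exact_mod_cast Nat.lt_two_pow_self
  rw [Nat.factorial_succ, pow_succ, mul_pow]
  push_cast
  calc C * ((n + 1) * n.factorial) * (B ^ n * B) = C * B * n.factorial * ((n + 1) * B ^ n) := by
        ring
    _ ≤ _ := by gcongr

variable [CompleteSpace F]

theorem ExpBound.summable (h : ExpBound c C B) (hB : 0 ≤ B) {s : ℂ} (hs : B * ‖s‖ < 1) :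
    Summable (fun n : ℕ => (s ^ n / (n.factorial : ℂ)) • c n) :=
  .of_norm_bounded ((summable_geometric_of_lt_one (by positivity) hs).mul_left C)
    (h.norm_term_le s)

theorem ExpBound.hasSum (h : ExpBound c C B) (hB : 0 ≤ B) {s : ℂ} (hs : B * ‖s‖ < 1) :
    HasSum (fun n : ℕ => (s ^ n / (n.factorial : ℂ)) • c n) (expSum c s) :=
  (h.summable hB hs).hasSum

/-- The tail is dominated by a geometric series of ratio at most `1/2`, hence the factor `2`. -/
theorem ExpBound.norm_tail_le (h : ExpBound c C B) (hB : 0 ≤ B) {s : ℂ} (hs : B * ‖s‖ ≤ 1 / 2)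
    (k : ℕ) : ‖expSum c s - ∑ n ∈ Finset.range k, (s ^ n / (n.factorial : ℂ)) • c n‖ ≤
      2 * C * (B * ‖s‖) ^ k := by
  have hs' : B * ‖s‖ < 1 := by linarith
  have h0 : 0 ≤ B * ‖s‖ := by positivity
  have e := (h.summable hB hs').sum_add_tsum_nat_add k
  rw [expSum, ← e, add_sub_cancel_left]
  have hsum : HasSum (fun n => C * (B * ‖s‖) ^ k * (B * ‖s‖) ^ n)
      (C * (B * ‖s‖) ^ k * (1 - B * ‖s‖)⁻¹) :=
    (hasSum_geometric_of_lt_one h0 hs').mul_left _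
  refine (tsum_of_norm_bounded hsum fun n => (h.norm_term_le s _).trans (le_of_eq ?_)).trans ?_
  · ring
  · have h2 : (1 - B * ‖s‖)⁻¹ ≤ 2 := by
      rw [inv_le_comm₀ (by linarith) (by norm_num)]; linarith
    have := h.nonneg
    calc _ ≤ C * (B * ‖s‖) ^ k * 2 := by gcongr
      _ = _ := by ring

theorem ExpBound.norm_expSum_le (h : ExpBound c C B) (hB : 0 ≤ B) {s : ℂ}
    (hs : B * ‖s‖ ≤ 1 / 2) : ‖expSum c s‖ ≤ 2 * C := by
  simpa using h.norm_tail_le hB hs 0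

theorem ExpBound.norm_sub_linear_le (h : ExpBound c C B) (hB : 0 ≤ B) {s : ℂ}
    (hs : B * ‖s‖ ≤ 1 / 2) : ‖expSum c s - (c 0 + s • c 1)‖ ≤ 2 * C * (B * ‖s‖) ^ 2 := by
  simpa [Finset.sum_range_succ] using h.norm_tail_le hB hs 2

omit [CompleteSpace F] in
theorem expSum_zero (c : ℕ → F) : expSum c 0 = c 0 := by
  rw [expSum, tsum_eq_single 0]
  · simp
  · intro n hn; simp [hn]

theorem ExpBound.hasDerivAt (h : ExpBound c C B) (hB : 0 ≤ B) {s : ℂ} (hs : B * ‖s‖ < 1) :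
    HasDerivAt (expSum c) (expSum (fun n => c (n + 1)) s) s := by
  -- Termwise differentiation needs uniform bounds on a ball slightly larger than `‖s‖` but still
  -- inside the disc of convergence.
  obtain ⟨ρ, hρs, hρ⟩ : ∃ ρ, ‖s‖ < ρ ∧ B * ρ < 1 := by
    rcases hB.eq_or_lt with rfl | hB
    · exact ⟨‖s‖ + 1, by linarith, by simp⟩
    · obtain ⟨ρ, h1, h2⟩ := exists_between ((lt_inv_mul_iff₀ hB).2 hs)
      exact ⟨ρ, h1, by rwa [lt_inv_mul_iff₀ hB] at h2⟩
  have hρ0 : 0 < ρ := (norm_nonneg _).trans_lt hρs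
  have hu : Summable fun n : ℕ => C * B * ((n : ℝ) ^ 1 * (B * ρ) ^ n + (B * ρ) ^ n) :=
    ((summable_pow_mul_geometric_of_norm_lt_one 1
      (by rwa [Real.norm_of_nonneg (by positivity)])).add
      (summable_geometric_of_lt_one (by positivity) hρ)).mul_left _
  have hlt : ∀ y ∈ Metric.ball (0 : ℂ) ρ, B * ‖y‖ < 1 := fun y hy => by
    have : ‖y‖ ≤ ρ := (mem_ball_zero_iff.1 hy).le
    exact (mul_le_mul_of_nonneg_left this hB).trans_lt hρ
  have hd : ∀ (n : ℕ) (y : ℂ), HasDerivAt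
      (fun y : ℂ => (y ^ (n + 1) / ((n + 1).factorial : ℂ)) • c (n + 1))
      ((y ^ n / (n.factorial : ℂ)) • c (n + 1)) y := fun n y => by
    have h1 := ((hasDerivAt_pow (n + 1) y).div_const ((n + 1).factorial : ℂ)).smul_const (c (n + 1))
    convert h1 using 2
    rw [Nat.factorial_succ]
    have : (n.factorial : ℂ) ≠ 0 := by exact_mod_cast n.factorial_ne_zero
    have : (n : ℂ) + 1 ≠ 0 := by exact_mod_cast n.succ_ne_zero
    push_cast
    field_simp
  have hs0 : s ∈ Metric.ball (0 : ℂ) ρ := mem_ball_zero_iff.2 hρs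
  have key := hasDerivAt_tsum_of_isPreconnected (y₀ := s)
    (g := fun (n : ℕ) (y : ℂ) => (y ^ (n + 1) / ((n + 1).factorial : ℂ)) • c (n + 1)) hu
    Metric.isOpen_ball (Metric.isConnected_ball hρ0).isPreconnected
    (fun n y _ => hd n y) (fun n y hy => ?_) hs0
    ((summable_nat_add_iff 1).2 (h.summable hB hs)) hs0
  · refine (key.const_add (c 0)).congr_of_eventuallyEq ?_
    filter_upwards [Metric.isOpen_ball.mem_nhds hs0] with y hy
    rw [expSum, (h.summable hB (hlt y hy)).tsum_eq_zero_add]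
    simp
  · have hy' : ‖y‖ ≤ ρ := (mem_ball_zero_iff.1 hy).le
    have hC := h.nonneg
    rw [norm_smul, norm_div, norm_pow, Complex.norm_natCast]
    calc _ ≤ ρ ^ n / n.factorial * (C * (n + 1).factorial * B ^ (n + 1)) := by
          gcongr
          exact h _
      _ = _ := by
          have : (n.factorial : ℝ) ≠ 0 := by positivity
          rw [Nat.factorial_succ]
          push_cast
          field_simp
          ring

/-- Differentiation shifts the sequence, so the induction runs over all sequences and bounds at
once. -/
theorem ExpBound.iteratedDeriv_expSum {c : ℕ → F} {C B : ℝ} (h : ExpBound c C B) (hB : 0 ≤ B)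
    (n : ℕ) : iteratedDeriv n (expSum c) 0 = c n := by
  induction n generalizing c C B with
  | zero => simp [expSum_zero]
  | succ n ih =>
    rw [iteratedDeriv_succ']
    have h0 : ∀ᶠ s : ℂ in nhds 0, B * ‖s‖ < 1 := by
      have : ContinuousAt (fun s : ℂ => B * ‖s‖) 0 := by fun_prop
      exact this.eventually_lt continuousAt_const (by simp)
    have : deriv (expSum c) =ᶠ[nhds 0] expSum (fun n => c (n + 1)) := by
      filter_upwards [h0] with s hs using (h.hasDerivAt hB hs).deriv
    rw [this.iteratedDeriv_eq, ih (h.succ hB) (by positivity)]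

theorem ExpBound.differentiableOn (h : ExpBound c C B) (hB : 0 ≤ B) {ρ : ℝ} (hρ : B * ρ ≤ 1 / 2) :
    DifferentiableOn ℂ (expSum c) (Metric.ball 0 ρ) := fun s hs => by
  have hs' : ‖s‖ ≤ ρ := (mem_ball_zero_iff.1 hs).le
  refine (h.hasDerivAt hB ?_).differentiableAt.differentiableWithinAt
  have := mul_le_mul_of_nonneg_left hs' hB
  linarith

end ExpSum

/-! ### Iterates on amplitudes carrying the factor `exp(κψ)`. -/

section Twisted

variable {E : Type*} [NormedAddCommGroup E] [NormedSpace ℝ E]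
  {F : Type*} [NormedAddCommGroup F] [NormedSpace ℝ F] [NormedSpace ℂ F] [IsScalarTower ℝ ℂ F]
  [CompleteSpace F] {N : Set E} {g : E → E} {M : E → F →L[ℝ] F}

theorem _root_.Finset.sum_antidiagonal_eq_range {A : Type*} [AddCommMonoid A] (f : ℕ → ℕ → A)
    (n : ℕ) : ∑ ij ∈ Finset.HasAntidiagonal.antidiagonal n, f ij.1 ij.2 =
      ∑ i ∈ Finset.range (n + 1), f i (n - i) :=
  Finset.Nat.sum_antidiagonal_eq_sum_range_succ f n

omit [CompleteSpace F] [IsScalarTower ℝ ℂ F] in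
theorem lop_iterate_const_smul_complex [SMulCommClass ℝ ℂ F]
    (hMc : ∀ z (c : ℂ) x, M z (c • x) = c • M z x) (c : ℂ) (f : E → F) (n : ℕ) :
    (lop g M)^[n] (c • f) = c • (lop g M)^[n] f := by
  induction n with
  | zero => rfl
  | succ n ih =>
    rw [Function.iterate_succ_apply', Function.iterate_succ_apply', ih]
    funext z
    simp only [lop, fderiv_const_smul_field, Pi.smul_apply, hMc, smul_add, _root_.smul_apply]

theorem lop_zero_exp {ψ : E → ℂ} (κ : ℂ) {z : E} (hψ : DifferentiableAt ℝ ψ z) :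
    lop g 0 (fun y => Complex.exp (κ * ψ y)) z =
      κ * (lop g 0 ψ z * Complex.exp (κ * ψ z)) := by
  have h := (((hψ.hasFDerivAt.const_mul κ).cexp).fderiv)
  rw [lop_zero_apply, lop_zero_apply, h]
  simp
  ring

theorem contDiffOn_cexp_mul {ψ : E → ℂ} (κ : ℂ) {m : WithTop ℕ∞} (hψ : ContDiffOn ℝ m ψ N) :
    ContDiffOn ℝ m (fun y => Complex.exp (κ * ψ y)) N :=
  (contDiffOn_const.mul hψ).cexp

/-- The values `g^n e^{κψ}` are the Taylor coefficients of `exp (κ ∑ sⁿ/n! gⁿψ)`. -/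
theorem lop_iterate_exp_eq_iteratedDeriv (hN : IsOpen N) (hg : ContDiffOn ℝ ∞ g N) {ψ : E → ℂ}
    (hψ : ContDiffOn ℝ ∞ ψ N) (κ : ℂ) {z : E} (hz : z ∈ N) {C B : ℝ} (hB : 0 ≤ B)
    (hb : ExpBound (fun n => (lop g 0)^[n] ψ z) C B) (n : ℕ) :
    (lop g 0)^[n] (fun y => Complex.exp (κ * ψ y)) z =
      iteratedDeriv n (fun s => Complex.exp (κ * expSum (fun n => (lop g 0)^[n] ψ z) s)) 0 := by
  set p : ℕ → ℂ := fun n => (lop g 0)^[n] ψ z with hp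
  have hb' := hb.succ hB
  -- The shifted sequence has growth constant `2B`, so `1/4` is needed to leave `1/2` for it.
  obtain ⟨ρ, hρ0, hρ⟩ : ∃ ρ > 0, B * ρ ≤ 1 / 4 :=
    ⟨(4 * B + 1)⁻¹, by positivity, by
      rw [← div_eq_mul_inv, div_le_iff₀ (by positivity)]; linarith⟩
  have hP := hb.differentiableOn hB (ρ := ρ) (by linarith)
  have hP' := hb'.differentiableOn (by positivity) (ρ := ρ) (by linarith)
  have hQ : DifferentiableOn ℂ (fun s => Complex.exp (κ * expSum p s)) (Metric.ball 0 ρ) :=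
    (hP.const_mul κ).cexp
  have h0 : (0 : ℂ) ∈ Metric.ball (0 : ℂ) ρ := Metric.mem_ball_self hρ0
  have cdP' : ∀ k : ℕ, ContDiffAt ℂ k (expSum fun n => p (n + 1)) 0 := fun k =>
    (hP'.contDiffOn Metric.isOpen_ball).contDiffAt (Metric.isOpen_ball.mem_nhds h0)
  have cdQ : ∀ k : ℕ, ContDiffAt ℂ k (fun s => Complex.exp (κ * expSum p s)) 0 := fun k =>
    (hQ.contDiffOn Metric.isOpen_ball).contDiffAt (Metric.isOpen_ball.mem_nhds h0)
  -- The generating function satisfies `Q' = κP'Q`, the counterpart of `g·∇ exp(κψ) = κ (g·∇ψ)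
  -- exp(κψ)`. Both sides then obey the same Leibniz recursion and have the same initial value.
  have hder : deriv (fun s => Complex.exp (κ * expSum p s)) =ᶠ[nhds 0]
      κ • ((expSum fun n => p (n + 1)) * fun s => Complex.exp (κ * expSum p s)) := by
    filter_upwards [Metric.isOpen_ball.mem_nhds h0] with s hs
    have hs' : ‖s‖ ≤ ρ := (mem_ball_zero_iff.1 hs).le
    have hBs : B * ‖s‖ < 1 := by have := mul_le_mul_of_nonneg_left hs' hB; linarith
    rw [(((hb.hasDerivAt hB hBs).const_mul κ).cexp).deriv]
    simp only [Pi.smul_apply, Pi.mul_apply, smul_eq_mul]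
    ring
  have hE := contDiffOn_cexp_mul κ hψ
  have hstep : EqOn (lop g 0 fun y => Complex.exp (κ * ψ y))
      (κ • fun y => lop g 0 ψ y • Complex.exp (κ * ψ y)) N := fun y hy =>
    lop_zero_exp κ (hψ.differentiableAt_of_isOpen hN hy)
  -- The Leibniz expansion at order `n + 1` involves every lower order.
  induction n using Nat.strong_induction_on with
  | _ n ih =>
    rcases n with _ | n
    · simp [expSum_zero, hp]
    · rw [iteratedDeriv_succ', hder.iteratedDeriv_eq, iteratedDeriv_const_smul_field,
        iteratedDeriv_mul (cdP' n) (cdQ n), Function.iterate_succ_apply,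
        hstep.lop_iterate hN n hz]
      have hκ : (lop g 0)^[n] (κ • fun y => lop g 0 ψ y • Complex.exp (κ * ψ y)) z =
          κ • (lop g 0)^[n] (fun y => lop g 0 ψ y • Complex.exp (κ * ψ y)) z := by
        rw [lop_iterate_const_smul_complex (by simp)]; rfl
      rw [hκ, lop_iterate_smul hN hg contDiffOn_zeroMul (by simp)
        (contDiffOn_lop hN hg contDiffOn_zeroMul hψ) hE n hz]
      simp only
      rw [Finset.sum_antidiagonal_eq_range (fun i j => (n.choose i : ℝ) •
        ((lop g 0)^[i] (lop g 0 ψ) z • (lop g 0)^[j] (fun y => Complex.exp (κ * ψ y)) z))]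
      congr 1
      refine Finset.sum_congr rfl fun i hi => ?_
      rw [ih _ (by omega), hb'.iteratedDeriv_expSum (by positivity)]
      simp [hp, mul_assoc]

/-- The values `L^n (e^{κψ} f)` are the Taylor coefficients of
`exp (κ ∑ sⁿ/n! gⁿψ) ∑ sⁿ/n! Lⁿf`. -/
theorem lop_iterate_exp_smul_eq_iteratedDeriv (hN : IsOpen N) (hg : ContDiffOn ℝ ∞ g N)
    (hM : ContDiffOn ℝ ∞ M N) (hMc : ∀ z (c : ℂ) x, M z (c • x) = c • M z x) {ψ : E → ℂ}
    (hψ : ContDiffOn ℝ ∞ ψ N) {f : E → F} (hf : ContDiffOn ℝ ∞ f N) (κ : ℂ) {z : E} (hz : z ∈ N)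
    {C₁ C₂ B ρ : ℝ} (hB : 0 ≤ B) (hρ0 : 0 < ρ) (hρ : B * ρ ≤ 1 / 2)
    (hb₁ : ExpBound (fun n => (lop g 0)^[n] ψ z) C₁ B)
    (hb₂ : ExpBound (fun n => (lop g M)^[n] f z) C₂ B) (n : ℕ) :
    (lop g M)^[n] (fun y => Complex.exp (κ * ψ y) • f y) z =
      iteratedDeriv n (fun s => Complex.exp (κ * expSum (fun n => (lop g 0)^[n] ψ z) s) •
        expSum (fun n => (lop g M)^[n] f z) s) 0 := by
  have hP := hb₁.differentiableOn hB hρ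
  have hf' := hb₂.differentiableOn hB hρ
  have hQ : DifferentiableOn ℂ (fun s => Complex.exp (κ * expSum (fun n => (lop g 0)^[n] ψ z) s))
    (Metric.ball 0 ρ) := (hP.const_mul κ).cexp
  have h0 : (0 : ℂ) ∈ Metric.ball (0 : ℂ) ρ := Metric.mem_ball_self hρ0
  have cd1 : ContDiffAt ℂ n (fun s => Complex.exp (κ * expSum (fun n => (lop g 0)^[n] ψ z) s)) 0 :=
    (hQ.contDiffOn Metric.isOpen_ball).contDiffAt (Metric.isOpen_ball.mem_nhds h0)
  have cd2 : ContDiffAt ℂ n (expSum fun n => (lop g M)^[n] f z) 0 :=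
    (hf'.contDiffOn Metric.isOpen_ball).contDiffAt (Metric.isOpen_ball.mem_nhds h0)
  have key := iteratedDerivWithin_smul (mem_univ (0 : ℂ)) uniqueDiffOn_univ
    cd1.contDiffWithinAt cd2.contDiffWithinAt
  simp only [iteratedDerivWithin_univ] at key
  refine Eq.trans ?_ key.symm
  rw [lop_iterate_smul hN hg hM hMc (contDiffOn_cexp_mul κ hψ) hf n hz]
  simp only
  rw [Finset.sum_antidiagonal_eq_range (fun i j => (n.choose i : ℝ) •
    ((lop g 0)^[i] (fun y => Complex.exp (κ * ψ y)) z • (lop g M)^[j] f z))]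
  refine Finset.sum_congr rfl fun i _ => ?_
  rw [lop_iterate_exp_eq_iteratedDeriv hN hg hψ κ hz hB hb₁, hb₂.iteratedDeriv_expSum hB,
    Nat.cast_smul_eq_nsmul]

/-- The generating function is holomorphic on a disc determined by `B` alone, because `exp` is
entire; `κ` affects only the size of the function. With `κ = i/ε` the radius thus stays fixed as `ε
→ 0`, and `s = -ε` eventually lies inside. -/
theorem hasSum_lop_iterate_exp_smul (hN : IsOpen N) (hg : ContDiffOn ℝ ∞ g N)
    (hM : ContDiffOn ℝ ∞ M N) (hMc : ∀ z (c : ℂ) x, M z (c • x) = c • M z x) {ψ : E → ℂ}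
    (hψ : ContDiffOn ℝ ∞ ψ N) {f : E → F} (hf : ContDiffOn ℝ ∞ f N) (κ : ℂ) {z : E} (hz : z ∈ N)
    {C₁ C₂ B ρ : ℝ} (hB : 0 ≤ B) (hρ0 : 0 < ρ) (hρ : B * ρ ≤ 1 / 4)
    (hb₁ : ExpBound (fun n => (lop g 0)^[n] ψ z) C₁ B)
    (hb₂ : ExpBound (fun n => (lop g M)^[n] f z) C₂ B) :
    ExpBound (fun n => (lop g M)^[n] (fun y => Complex.exp (κ * ψ y) • f y) z)
      (Real.exp (‖κ‖ * (2 * C₁)) * (2 * C₂)) ρ⁻¹ ∧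
    ∀ s : ℂ, ‖s‖ < ρ →
      HasSum (fun n : ℕ => (s ^ n / (n.factorial : ℂ)) •
        (lop g M)^[n] (fun y => Complex.exp (κ * ψ y) • f y) z)
      (Complex.exp (κ * expSum (fun n => (lop g 0)^[n] ψ z) s) •
        expSum (fun n => (lop g M)^[n] f z) s) := by
  -- Twice the radius is used so that the circle of radius `ρ`, where Cauchy's estimate is applied,
  -- lies inside the disc of holomorphy.
  have hρ2 : B * (2 * ρ) ≤ 1 / 2 := by linarith
  have key := lop_iterate_exp_smul_eq_iteratedDeriv hN hg hM hMc hψ hf κ hz hB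
    (by positivity : 0 < 2 * ρ) hρ2 hb₁ hb₂
  have hQ : DifferentiableOn ℂ (fun s => Complex.exp (κ * expSum (fun n => (lop g 0)^[n] ψ z) s) •
      expSum (fun n => (lop g M)^[n] f z) s) (Metric.ball 0 (2 * ρ)) :=
    ((hb₁.differentiableOn hB hρ2).const_mul κ).cexp.smul (hb₂.differentiableOn hB hρ2)
  have hsub : Metric.closedBall (0 : ℂ) ρ ⊆ Metric.ball 0 (2 * ρ) :=
    Metric.closedBall_subset_ball (by linarith)
  refine ⟨fun n => ?_, fun s hs => ?_⟩
  · simp only [key]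
    refine (Complex.norm_iteratedDeriv_le_of_forall_mem_sphere_norm_le n hρ0
      (C := Real.exp (‖κ‖ * (2 * C₁)) * (2 * C₂)) ?_ fun s hs => ?_).trans (le_of_eq ?_)
    · exact (hQ.mono (by rw [closure_ball _ hρ0.ne']; exact hsub)).diffContOnCl
    · have hs' : ‖s‖ = ρ := mem_sphere_zero_iff_norm.1 hs
      have hBs : B * ‖s‖ ≤ 1 / 2 := by rw [hs']; linarith
      rw [norm_smul]
      gcongr
      · refine (Complex.norm_exp_le_exp_norm _).trans (Real.exp_le_exp.2 ?_)
        rw [norm_mul]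
        gcongr
        exact hb₁.norm_expSum_le hB hBs
      · exact hb₂.norm_expSum_le hB hBs
    · rw [inv_pow, div_eq_mul_inv]; ring
  · have h := Complex.hasSum_taylorSeries_on_ball (hQ.mono (Metric.ball_subset_closedBall.trans hsub))
      (mem_ball_zero_iff.2 hs)
    convert h using 2 with n
    rw [key n, sub_zero, smul_smul, div_eq_inv_mul]

omit [NormedSpace ℂ F] [IsScalarTower ℝ ℂ F] in
/-- Near a compact set, the iterates of an operator with analytic coefficients on an analytic
function are uniformly bounded by `C n! Bⁿ`. -/
theorem exists_expBound_lop_iterate [CompleteSpace E] {S K : Set E} (hS : IsOpen S)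
    (hg : AnalyticOnNhd ℝ g S) (hM : AnalyticOnNhd ℝ M S) {f : E → F} (hf : AnalyticOnNhd ℝ f S)
    (hK : IsCompact K) (hKS : K ⊆ S) :
    ∃ N, IsOpen N ∧ K ⊆ N ∧ N ⊆ S ∧ ∃ C B : ℝ, 0 ≤ B ∧
      ∀ z ∈ N, ExpBound (fun n => (lop g M)^[n] f z) C B := by
  obtain ⟨N₁, o₁, k₁, s₁, G, a₁, hG, ha₁, b₁⟩ := hg.exists_derivBound hS hK hKS
  obtain ⟨N₂, o₂, k₂, s₂, H, a₂, hH, ha₂, b₂⟩ := hM.exists_derivBound hS hK hKS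
  obtain ⟨N₃, o₃, k₃, s₃, C, a₃, hC, ha₃, b₃⟩ := hf.exists_derivBound hS hK hKS
  set a := max a₁ (max a₂ a₃) with ha
  have ha0 : 0 ≤ a := ha₁.trans (le_max_left _ _)
  have hN := o₁.inter (o₂.inter o₃)
  have hsub : N₁ ∩ (N₂ ∩ N₃) ⊆ S := fun z hz => s₁ hz.1
  refine ⟨N₁ ∩ (N₂ ∩ N₃), hN, subset_inter k₁ (subset_inter k₂ k₃), hsub, C, 2 * (G * a + H),
    by positivity, fun z hz n => ?_⟩
  exact norm_lop_iterate_le hN hG hH ha0 hC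
    ((hg.mono hsub).contDiffOn hN.uniqueDiffOn) ((hM.mono hsub).contDiffOn hN.uniqueDiffOn)
    (b₁.mono (fun _ h => h.1) ha₁ (le_max_left _ _) le_rfl hG)
    (b₂.mono (fun _ h => h.2.1) ha₂ ((le_max_left _ _).trans (le_max_right _ _)) le_rfl hH)
    ((hf.mono hsub).contDiffOn hN.uniqueDiffOn)
    (b₃.mono (fun _ h => h.2.2) ha₃ ((le_max_right _ _).trans (le_max_right _ _)) le_rfl hC) hz n

end Twisted

end

section

/-! ### Regularity of the data and the complex amplitudes of the wave. -/

namespace Setting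

variable (W : Setting)

/-- The data of the setting are of class `C^n`, for some `n` with `n + 1 = n`. -/
structure Reg (n : WithTop ℕ∞) : Prop where
  add_one_le : n + 1 ≤ n
  A0 : ContDiffOn ℝ n W.A0 W.X
  tet : ∀ a, ContDiffOn ℝ n (W.tet a) W.X
  At : ContDiffOn ℝ n W.At W.X
  ψ : ContDiffOn ℝ n W.ψ W.X

/-- The exponents `∞` and `ω` both survive loss of a derivative, so each regularity statement is
proved once for smooth and analytic data. -/
theorem reg_top : W.Reg ∞ := ⟨by simp, W.smooth_A0, W.smooth_tet, W.smooth_At, W.smooth_ψ⟩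

theorem IsAnalytic.reg (h : W.IsAnalytic) : W.Reg ω :=
  ⟨by simp, h.1.contDiffOn W.isOpen_X.uniqueDiffOn,
    fun a => (h.2.1 a).contDiffOn W.isOpen_X.uniqueDiffOn,
    h.2.2.1.contDiffOn W.isOpen_X.uniqueDiffOn, h.2.2.2.contDiffOn W.isOpen_X.uniqueDiffOn⟩

theorem isOpen_dom : IsOpen W.dom := by
  refine (W.isOpen_X.preimage continuous_fst).inter ?_
  exact isOpen_lt continuous_const
    (by fun_prop : Continuous fun z : PhaseSpace => W.e * z.2.2.1)

theorem mapsTo_fst : MapsTo (Prod.fst : PhaseSpace → Spacetime) W.dom W.X := fun _ h => h.1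

variable {W} {n : WithTop ℕ∞}

theorem contDiffOn_mink {G : Type*} [NormedAddCommGroup G] [NormedSpace ℝ G] {S : Set G}
    {u v : G → Spacetime} (hu : ContDiffOn ℝ n u S) (hv : ContDiffOn ℝ n v S) :
    ContDiffOn ℝ n (fun x => mink (u x) (v x)) S :=
  ContDiffOn.sum fun α _ => (contDiffOn_const.mul (contDiffOn_pi.1 hu α)).mul (contDiffOn_pi.1 hv α)

namespace Reg

theorem F0 (h : W.Reg n) (α β : Fin 4) : ContDiffOn ℝ n (fun r => W.F0 r α β) W.X := by
  have h1 : ContDiffOn ℝ n (fderiv ℝ W.A0) W.X := h.A0.fderiv_of_isOpen W.isOpen_X h.add_one_le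
  have h2 : ∀ v : Spacetime, ContDiffOn ℝ n (fun r => fderiv ℝ W.A0 r v) W.X := fun v =>
    h1.clm_apply contDiffOn_const
  exact (contDiffOn_pi.1 (h2 _) β).sub (contDiffOn_pi.1 (h2 _) α)

/-- The nested square roots defining `λ_B` hide its regularity; the eigenvector relation makes it
polynomial in the field and the tetrad. -/
theorem _root_.GCWave.Setting.lambdaB_eq {r : Spacetime} (hr : r ∈ W.X) :
    lambdaB (W.F0 r) = -mink (mixedApply (W.F0 r) (W.tet 2 r)) (W.tet 3 r) := by
  have h2 := W.F_tet2 r hr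
  have h3 := W.tet_orthonormal r hr 3 3
  simp only [if_true] at h3
  have : mink (-lambdaB (fieldTensor W.A0 r) • W.tet 3 r) (W.tet 3 r) =
      -lambdaB (fieldTensor W.A0 r) * mink (W.tet 3 r) (W.tet 3 r) := by
    simp only [mink, Finset.mul_sum, Pi.smul_apply, smul_eq_mul]
    exact Finset.sum_congr rfl fun _ _ => by ring
  rw [Setting.F0, h2, this, h3]
  simp [eta]

theorem lambdaB (h : W.Reg n) : ContDiffOn ℝ n (fun r => lambdaB (W.F0 r)) W.X := by
  refine ContDiffOn.congr ?_ fun r hr => lambdaB_eq hr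
  refine (contDiffOn_mink (contDiffOn_pi.2 fun α => ?_) (h.tet 3)).neg
  exact ContDiffOn.sum fun β _ =>
    (contDiffOn_const.mul (h.F0 α β)).mul (contDiffOn_pi.1 (h.tet 2) β)

theorem OmegaB (h : W.Reg n) : ContDiffOn ℝ n W.OmegaB W.X :=
  (contDiffOn_const.mul h.lambdaB).div_const _

/-- The magnetic moment and `Ω_B` both have the sign of the charge. Hence the square root defining
`w` is taken away from zero, and `ρ` is regular. -/
theorem _root_.GCWave.Setting.OmegaB_mul_pos {z : PhaseSpace} (hz : z ∈ W.dom) :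
    0 < W.OmegaB z.1 * z.2.2.1 := by
  have h1 := W.lambdaB_pos z.1 hz.1
  have h2 : 0 < W.e * z.2.2.1 := hz.2
  have := W.m_pos
  have := W.c_pos
  have : W.OmegaB z.1 * z.2.2.1 =
      (W.e * z.2.2.1) * (GCWave.lambdaB (fieldTensor W.A0 z.1) / (W.m * W.c)) := by
    simp only [Setting.OmegaB, Setting.F0]; ring
  rw [this]
  positivity

theorem _root_.GCWave.Setting.OmegaB_ne {z : PhaseSpace} (hz : z ∈ W.dom) : W.OmegaB z.1 ≠ 0 :=
  left_ne_zero_of_mul (OmegaB_mul_pos hz).ne'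

theorem comp_fst {G : Type*} [NormedAddCommGroup G] [NormedSpace ℝ G] {f : Spacetime → G}
    (hf : ContDiffOn ℝ n f W.X) : ContDiffOn ℝ n (fun z : PhaseSpace => f z.1) W.dom :=
  hf.comp contDiff_fst.contDiffOn W.mapsTo_fst

theorem rho (h : W.Reg n) : ContDiffOn ℝ n W.rho W.dom := by
  have h1 := comp_fst h.OmegaB
  have hμ : ContDiffOn ℝ n (fun z : PhaseSpace => z.2.2.1) W.dom := by fun_prop
  refine ContDiffOn.div (ContDiffOn.sqrt (((contDiffOn_const.mul h1).mul hμ).div_const _)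
    fun z hz => ?_) h1 fun z hz => OmegaB_ne hz
  have := OmegaB_mul_pos hz
  have := W.m_pos
  rw [mul_assoc]
  positivity

theorem aHat (h : W.Reg n) : ContDiffOn ℝ n W.aHat W.dom := by
  have hθ : ContDiffOn ℝ n (fun z : PhaseSpace => z.2.2.2) W.dom := by fun_prop
  exact (hθ.cos.smul (comp_fst (h.tet 2))).sub (hθ.sin.smul (comp_fst (h.tet 3)))

theorem gr (h : W.Reg n) : ContDiffOn ℝ n W.gr W.dom := (h.rho.smul h.aHat).neg

theorem g (h : W.Reg n) : ContDiffOn ℝ n W.g W.dom := h.gr.prodMk contDiffOn_const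

theorem k (h : W.Reg n) : ContDiffOn ℝ n W.k W.X :=
  contDiffOn_pi.2 fun _ =>
    (h.ψ.fderiv_of_isOpen W.isOpen_X h.add_one_le).clm_apply contDiffOn_const

end Reg

variable (W)

/-- The covector `dR^β`, complexified. -/
def dR (β : Fin 4) : PhaseSpace →L[ℝ] ℂ :=
  Complex.ofRealCLM.comp ((ContinuousLinearMap.proj β : Spacetime →L[ℝ] ℝ).comp
    (ContinuousLinearMap.fst ℝ Spacetime (Spacetime × ℝ × ℝ)))

theorem dR_apply (β : Fin 4) (v : PhaseSpace) : dR β v = (v.1 β : ℂ) := rfl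

/-- The complex amplitude `(e/c) Ã · dR`. -/
def alphaX (r : Spacetime) : PhaseSpace →L[ℝ] ℂ := ∑ β, ((W.e / W.c : ℂ) * W.At r β) • dR β

def alpha (z : PhaseSpace) : PhaseSpace →L[ℝ] ℂ := W.alphaX z.1

theorem alphaX_apply (r : Spacetime) (v : PhaseSpace) :
    W.alphaX r v = (W.e / W.c : ℂ) * dotA v.1 (W.At r) := by
  simp only [alphaX, sum_apply, _root_.smul_apply, dR_apply, smul_eq_mul, dotA, Finset.mul_sum]
  exact Finset.sum_congr rfl fun _ _ => by ring

theorem alpha_apply (z v : PhaseSpace) : W.alpha z v = (W.e / W.c : ℂ) * dotA v.1 (W.At z.1) :=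
  W.alphaX_apply _ _

/-- The phase as a complex function on phase space. -/
def psiC (z : PhaseSpace) : ℂ := (W.ψ z.1 : ℂ)

theorem gammaW_eq (ε : ℝ) :
    W.gammaW ε = fun z => toForm1 PhaseSpace (W.eik ε z.1 • W.alpha z) := by
  funext z
  ext v
  rw [toForm1_apply, _root_.smul_apply, alpha_apply, ← ccCLM_apply]
  simp only [gammaW, ContinuousAlternatingMap.ofSubsingleton_apply_apply, dotA, sum_apply,
    _root_.smul_apply, smul_eq_mul, Finset.mul_sum, map_sum]
  refine Finset.sum_congr rfl fun β _ => ?_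
  have : W.eik ε z.1 * ((W.e / W.c : ℂ) * (((v 0).1 β : ℂ) * W.At z.1 β)) =
      ((v 0).1 β) • ((W.e / W.c : ℂ) * W.At z.1 β * W.eik ε z.1) := by
    rw [Complex.real_smul]; ring
  rw [this, map_smul, ccCLM_apply, smul_eq_mul, mul_comm]
  rfl

/-- `(e/c) g^r · Ã` -/
def f0 (z : PhaseSpace) : ℂ := W.alpha z (W.g z)

theorem f0_eq (z : PhaseSpace) : W.f0 z = (W.e / W.c : ℂ) * dotA (W.gr z) (W.At z.1) :=
  W.alpha_apply _ _

/-- The differential of the phase. -/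
def dpsi (z : PhaseSpace) : PhaseSpace →L[ℝ] ℂ := ∑ β, (W.k z.1 β : ℂ) • dR β

theorem dpsi_apply (z v : PhaseSpace) : W.dpsi z v = (dotK v.1 (W.k z.1) : ℂ) := by
  simp only [dpsi, sum_apply, _root_.smul_apply, dR_apply, smul_eq_mul, dotK]
  push_cast
  exact Finset.sum_congr rfl fun _ _ => by ring

/-- The leading part `(e/c) g^r · F̃` of `i_g dγ_w`. -/
def beta0 (z : PhaseSpace) : PhaseSpace →L[ℝ] ℂ :=
  Complex.I • ((W.gk z : ℂ) • W.alpha z - W.f0 z • W.dpsi z)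

/-- The subleading part of `i_g dγ_w`. -/
def beta1 : PhaseSpace → PhaseSpace →L[ℝ] ℂ := intCurl W.g W.alpha

theorem contract2_eq (u v : Spacetime) (T : Fin 4 → Fin 4 → ℂ) :
    contract2 u T v = ∑ β, contract1 u T β * (v β : ℂ) := by
  simp only [contract2, contract1, Finset.sum_mul]
  exact Finset.sum_comm

theorem contract2_waveTensor (u v : Spacetime) (k : Fin 4 → ℝ) (A : Fin 4 → ℂ) :
    contract2 u (waveTensor k A) v =
      Complex.I * ((dotK u k : ℂ) * dotA v A - dotA u A * (dotK v k : ℂ)) := by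
  simp only [contract2, waveTensor, dotK, dotA, Fin.sum_univ_four]
  push_cast
  ring

/-- Gauge invariance enters here: in `β₀` the wave potential occurs only through `F̃`. -/
theorem beta0_apply (z v : PhaseSpace) :
    W.beta0 z v = (W.e / W.c : ℂ) * contract2 (W.gr z) (W.Ft z.1) v.1 := by
  simp only [beta0, _root_.smul_apply, _root_.sub_apply, smul_eq_mul, alpha_apply, dpsi_apply,
    f0_eq, Ft, contract2_waveTensor, gk]
  ring

theorem contract2_vR (u : Spacetime) (T : Fin 4 → Fin 4 → ℂ) (β : Fin 4) :
    contract2 u T (vR β).1 = contract1 u T β := by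
  rw [contract2_eq, Finset.sum_eq_single β]
  · simp [vR]
  · intro b _ hb; simp [vR, hb]
  · simp

theorem contract2_zero (u : Spacetime) (T : Fin 4 → Fin 4 → ℂ) : contract2 u T 0 = 0 := by
  simp [contract2]

variable {W}

namespace Reg

theorem alpha (h : W.Reg n) : ContDiffOn ℝ n W.alpha W.dom := by
  have : ContDiffOn ℝ n W.alphaX W.X :=
    ContDiffOn.sum fun β _ => (contDiffOn_const.mul (contDiffOn_pi.1 h.At β)).smul contDiffOn_const
  exact comp_fst this

theorem alphaX (h : W.Reg n) : ContDiffOn ℝ n W.alphaX W.X :=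
  ContDiffOn.sum fun β _ => (contDiffOn_const.mul (contDiffOn_pi.1 h.At β)).smul contDiffOn_const

theorem psiC (h : W.Reg n) : ContDiffOn ℝ n W.psiC W.dom :=
  Complex.ofRealCLM.contDiff.comp_contDiffOn (comp_fst h.ψ)

theorem f0 (h : W.Reg n) : ContDiffOn ℝ n W.f0 W.dom := h.alpha.clm_apply h.g

theorem gk (h : W.Reg n) : ContDiffOn ℝ n W.gk W.dom := by
  have : ∀ β, ContDiffOn ℝ n (fun z : PhaseSpace => W.gr z β * W.k z.1 β) W.dom := fun β =>
    (contDiffOn_pi.1 h.gr β).mul (contDiffOn_pi.1 (comp_fst h.k) β)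
  have h2 : ContDiffOn ℝ n (fun z => ∑ β, W.gr z β * W.k z.1 β) W.dom :=
    ContDiffOn.sum fun β _ => this β
  exact h2

theorem gkC (h : W.Reg n) : ContDiffOn ℝ n (fun z => (W.gk z : ℂ)) W.dom :=
  Complex.ofRealCLM.contDiff.comp_contDiffOn h.gk

theorem dpsi (h : W.Reg n) : ContDiffOn ℝ n W.dpsi W.dom :=
  ContDiffOn.sum fun β _ => (Complex.ofRealCLM.contDiff.comp_contDiffOn
    (contDiffOn_pi.1 (comp_fst h.k) β)).smul contDiffOn_const

theorem beta0 (h : W.Reg n) : ContDiffOn ℝ n W.beta0 W.dom :=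
  have h1 := (h.gkC.smul h.alpha).sub (h.f0.smul h.dpsi)
  (contDiffOn_const (c := Complex.I)).smul h1

theorem beta1 (h : W.Reg n) : ContDiffOn ℝ n W.beta1 W.dom :=
  contDiffOn_intCurl W.isOpen_dom h.g h.alpha h.add_one_le

theorem formMul (h : W.Reg n) : ContDiffOn ℝ n (formMul ℂ W.g) W.dom :=
  contDiffOn_formMul W.isOpen_dom h.g h.add_one_le

end Reg

theorem g_contDiffOn : ContDiffOn ℝ ∞ W.g W.dom := W.reg_top.g

theorem differentiableAt_of_contDiffOn {G : Type*} [NormedAddCommGroup G] [NormedSpace ℝ G]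
    {f : PhaseSpace → G} (hf : ContDiffOn ℝ ∞ f W.dom) {z : PhaseSpace} (hz : z ∈ W.dom) :
    DifferentiableAt ℝ f z := hf.differentiableAt_of_isOpen W.isOpen_dom hz

theorem fderiv_comp_fst {G : Type*} [NormedAddCommGroup G] [NormedSpace ℝ G] {f : Spacetime → G}
    (hf : ContDiffOn ℝ ∞ f W.X) {z : PhaseSpace} (hz : z ∈ W.dom) (v : PhaseSpace) :
    fderiv ℝ (fun y : PhaseSpace => f y.1) z v = fderiv ℝ f z.1 v.1 := by
  have h1 := (hf.differentiableAt_of_isOpen W.isOpen_X hz.1).hasFDerivAt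
  have h2 : HasFDerivAt (fun y : PhaseSpace => f y.1)
      ((fderiv ℝ f z.1).comp (ContinuousLinearMap.fst ℝ Spacetime (Spacetime × ℝ × ℝ))) z :=
    h1.comp z hasFDerivAt_fst
  rw [h2.fderiv]; rfl

theorem fderiv_psi_apply (r v : Spacetime) : fderiv ℝ W.ψ r v = dotK v (W.k r) := by
  conv_lhs => rw [pi_eq_sum_univ' v]
  simp only [map_sum, map_smul, smul_eq_mul, dotK, Setting.k]

theorem fderiv_psiC {z : PhaseSpace} (hz : z ∈ W.dom) : fderiv ℝ W.psiC z = W.dpsi z := by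
  refine ContinuousLinearMap.ext fun v => ?_
  have h0 : ContDiffOn ℝ ∞ (fun r => (W.ψ r : ℂ)) W.X :=
    Complex.ofRealCLM.contDiff.comp_contDiffOn W.smooth_ψ
  have h1 := fderiv_comp_fst h0 hz v
  have h2 : HasFDerivAt (fun r => (W.ψ r : ℂ)) (Complex.ofRealCLM.comp (fderiv ℝ W.ψ z.1)) z.1 :=
    Complex.ofRealCLM.hasFDerivAt.comp z.1
      (W.smooth_ψ.differentiableAt_of_isOpen W.isOpen_X hz.1).hasFDerivAt
  rw [dpsi_apply, ← fderiv_psi_apply]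
  refine h1.trans ?_
  rw [h2.fderiv]; rfl

theorem lop_psiC {z : PhaseSpace} (hz : z ∈ W.dom) : lop W.g 0 W.psiC z = (W.gk z : ℂ) := by
  rw [lop_zero_apply, fderiv_psiC hz, dpsi_apply]; rfl

theorem fderiv_g {z : PhaseSpace} (hz : z ∈ W.dom) (v : PhaseSpace) :
    fderiv ℝ W.g z v = (fderiv ℝ W.gr z v, 0, 0, 0) := by
  have h1 := (differentiableAt_of_contDiffOn W.reg_top.gr hz).hasFDerivAt.prodMk
    (hasFDerivAt_const ((0, 0, 0) : Spacetime × ℝ × ℝ) z)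
  rw [show W.g = fun y => (W.gr y, ((0, 0, 0) : Spacetime × ℝ × ℝ)) from rfl, h1.fderiv]; rfl

theorem contDiffOn_eik (ε : ℝ) : ContDiffOn ℝ ∞ (fun z : PhaseSpace => W.eik ε z.1) W.dom :=
  contDiffOn_cexp_mul _ W.reg_top.psiC

theorem fderiv_eik (ε : ℝ) {z : PhaseSpace} (hz : z ∈ W.dom) :
    fderiv ℝ (fun y : PhaseSpace => W.eik ε y.1) z =
      (Complex.I / ε * W.eik ε z.1) • W.dpsi z := by
  have h := (((differentiableAt_of_contDiffOn W.reg_top.psiC hz).hasFDerivAt.const_mul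
    (Complex.I / (ε : ℂ))).cexp).fderiv
  refine h.trans ?_
  rw [fderiv_psiC hz, smul_smul, mul_comm]; rfl

/-- A covector field is horizontal if it annihilates the directions of `U`, `μ` and `θ`. -/
def Horizontal (W : Setting) (σ : PhaseSpace → PhaseSpace →L[ℝ] ℂ) : Prop :=
  ∀ z ∈ W.dom, ∀ v : PhaseSpace, v.1 = 0 → σ z v = 0

/-- Differentiate the identity `σ(v) = 0`, valid on an open set, with `v` held fixed. -/
theorem fderiv_apply_of_horizontal {σ : PhaseSpace → PhaseSpace →L[ℝ] ℂ}
    (hσ : ContDiffOn ℝ ∞ σ W.dom) (hh : W.Horizontal σ) {z : PhaseSpace} (hz : z ∈ W.dom)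
    {v : PhaseSpace} (hv : v.1 = 0) (u : PhaseSpace) : fderiv ℝ σ z u v = 0 := by
  have h1 := (differentiableAt_of_contDiffOn hσ hz).hasFDerivAt.clm_apply (hasFDerivAt_const v z)
  have h2 : (fun y => σ y v) =ᶠ[nhds z] fun _ => 0 :=
    Filter.eventually_of_mem (W.isOpen_dom.mem_nhds hz) fun y hy => hh y hy v hv
  have h3 := h1.unique ((hasFDerivAt_const (0 : ℂ) z).congr_of_eventuallyEq h2)
  simpa using DFunLike.congr_fun h3 u

/-- In such directions only the zero-order part of the Lie derivative survives. This is why these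
components are of one order higher and contain `∂g^r/∂ν`. -/
theorem lop_apply_of_horizontal {σ : PhaseSpace → PhaseSpace →L[ℝ] ℂ}
    (hσ : ContDiffOn ℝ ∞ σ W.dom) (hh : W.Horizontal σ) {z : PhaseSpace} (hz : z ∈ W.dom)
    {v : PhaseSpace} (hv : v.1 = 0) :
    lop W.g (formMul ℂ W.g) σ z v = σ z (fderiv ℝ W.g z v) := by
  rw [lop, _root_.add_apply, fderiv_apply_of_horizontal hσ hh hz hv, zero_add]; rfl

theorem horizontal_alpha : W.Horizontal W.alpha := fun z _ v hv => by
  rw [alpha_apply, hv]; simp [dotA]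

theorem horizontal_beta0 : W.Horizontal W.beta0 := fun z _ v hv => by
  rw [beta0_apply, hv, contract2_zero, mul_zero]

/-- The amplitude `α` has no component along such directions and does not vary along them, so both
terms of the curl vanish. -/
theorem horizontal_beta1 : W.Horizontal W.beta1 := fun z hz v hv => by
  have h : fderiv ℝ W.alpha z v = 0 := by
    rw [show W.alpha = fun y => W.alphaX y.1 from rfl, fderiv_comp_fst W.reg_top.alphaX hz, hv,
      map_zero]
  rw [beta1, intCurl_apply, fderiv_apply_of_horizontal W.reg_top.alpha horizontal_alpha hz hv, h]
  simp

theorem fderiv_eik_smul_alpha (ε : ℝ) {z : PhaseSpace} (hz : z ∈ W.dom) (u v : PhaseSpace) :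
    fderiv ℝ (fun y : PhaseSpace => W.eik ε y.1 • W.alpha y) z u v =
      W.eik ε z.1 * (Complex.I / ε * (W.dpsi z u * W.alpha z v) + fderiv ℝ W.alpha z u v) := by
  rw [fderiv_fun_smul (differentiableAt_of_contDiffOn (contDiffOn_eik ε) hz)
    (differentiableAt_of_contDiffOn W.reg_top.alpha hz), fderiv_eik ε hz]
  simp
  ring

/-- The amplitude of `i_g dγ_w`. -/
def betaE (W : Setting) (ε : ℝ) : PhaseSpace → PhaseSpace →L[ℝ] ℂ :=
  (1 / ε) • W.beta0 + W.beta1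

/-- A derivative falling on the phase costs `1/ε` and yields `β₀`; one falling on the amplitude
yields `β₁`. -/
theorem intCurl_eik_smul_alpha (ε : ℝ) {z : PhaseSpace} (hz : z ∈ W.dom) :
    intCurl W.g (fun y : PhaseSpace => W.eik ε y.1 • W.alpha y) z = W.eik ε z.1 • W.betaE ε z := by
  refine ContinuousLinearMap.ext fun v => ?_
  rw [intCurl_apply, fderiv_eik_smul_alpha ε hz, fderiv_eik_smul_alpha ε hz]
  simp only [betaE, beta0, beta1, Pi.add_apply, Pi.smul_apply, _root_.add_apply,
    _root_.smul_apply, _root_.sub_apply, intCurl_apply, smul_eq_mul, f0, Complex.real_smul]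
  rw [dpsi_apply, show (W.g z).1 = W.gr z from rfl, ← gk]
  push_cast
  ring

end Setting

end

/-! ### The entire functions behind `q1`, `q2`, `p1`, `p2`, and the summed leading terms. -/

section

theorem _root_.HasSum.congr_of_eq {f g : ℕ → ℂ} {a b : ℂ} (h : HasSum f a) (hf : ∀ n, g n = f n)
    (hb : b = a) : HasSum g b := by
  rw [hb, funext hf]; exact h

/-- The entire function `∑ uⁿ / (n! (n + k))`, i.e. `∫₀¹ τ^(k-1) exp (τu) dτ`. -/
def phi (k : ℕ) (u : ℂ) : ℂ := expSum (fun n : ℕ => 1 / ((n : ℂ) + k)) u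

/-- The coefficients are at most `1`, and `B⁻ⁿ/n! ≤ exp(1/B)`; thus every `B > 0` is admissible and
`phi k` is entire. -/
theorem expBound_phi {k : ℕ} (hk : 0 < k) {B : ℝ} (hB : 0 < B) :
    ExpBound (fun n : ℕ => 1 / ((n : ℂ) + k)) (Real.exp B⁻¹) B := fun n => by
  have h1 : ‖1 / ((n : ℂ) + k)‖ ≤ 1 := by
    have : (1 : ℝ) ≤ (n : ℝ) + k := by
      have : (1 : ℝ) ≤ k := by exact_mod_cast hk
      have : (0 : ℝ) ≤ n := by positivity
      linarith
    have e : ((n : ℂ) + k) = (((n : ℝ) + k : ℝ) : ℂ) := by push_cast; rfl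
    rw [norm_div, norm_one, e, Complex.norm_real, Real.norm_of_nonneg (by positivity)]
    exact div_le_one_of_le₀ this (by positivity)
  have h2 := Real.pow_div_factorial_le_exp B⁻¹ (by positivity) n
  rw [div_le_iff₀ (by positivity), inv_pow, inv_le_iff_one_le_mul₀ (by positivity)] at h2
  exact h1.trans h2

theorem exists_expBound_phi {k : ℕ} (hk : 0 < k) (u : ℂ) : ∃ C B : ℝ, 0 ≤ B ∧ B * ‖u‖ < 1 ∧
    ExpBound (fun n : ℕ => 1 / ((n : ℂ) + k)) C B := by
  refine ⟨_, (‖u‖ + 1)⁻¹, by positivity, ?_, expBound_phi hk (by positivity)⟩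
  rw [inv_mul_lt_iff₀ (by positivity)]
  linarith

theorem hasSum_phi {k : ℕ} (hk : 0 < k) (u : ℂ) :
    HasSum (fun n : ℕ => u ^ n / (n.factorial : ℂ) * (1 / ((n : ℂ) + k))) (phi k u) := by
  obtain ⟨C, B, hB, hu, h⟩ := exists_expBound_phi hk u
  exact h.hasSum hB hu

theorem hasDerivAt_phi {k : ℕ} (hk : 0 < k) (u : ℂ) : HasDerivAt (phi k) (phi (k + 1) u) u := by
  obtain ⟨C, B, hB, hu, h⟩ := exists_expBound_phi hk u
  refine (h.hasDerivAt hB hu).congr_deriv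
    (congrArg (fun c : ℕ → ℂ => expSum c u) (funext fun n => ?_))
  push_cast
  ring

theorem hasSum_cexp (u : ℂ) : HasSum (fun n : ℕ => u ^ n / (n.factorial : ℂ)) (Complex.exp u) := by
  rw [Complex.exp_eq_exp_ℂ]
  exact NormedSpace.expSeries_div_hasSum_exp u

/-- Integration by parts in `∫₀¹ d(τ^k exp(τu))`, carried out on coefficients as `k/(n+k) + n/(n+k)
= 1`. -/
theorem mul_phi_add_mul_phi {k : ℕ} (hk : 0 < k) (u : ℂ) :
    k * phi k u + u * phi (k + 1) u = Complex.exp u := by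
  have h1 := (hasSum_phi hk u).mul_left (k : ℂ)
  have h2 := (hasSum_phi (Nat.succ_pos k) u).mul_left u
  have h3 : HasSum (fun n : ℕ => (n : ℂ) * (u ^ n / (n.factorial : ℂ) * (1 / ((n : ℂ) + k))))
      (u * phi (k + 1) u) := by
    rw [← hasSum_nat_add_iff' 1]
    simp only [Finset.sum_range_one, Nat.cast_zero, zero_mul, sub_zero]
    refine h2.congr_of_eq (fun n => ?_) rfl
    have : ((n : ℂ) + 1 + k) ≠ 0 := by exact_mod_cast (by omega : n + 1 + k ≠ 0)
    have : ((n : ℂ) + (k + 1)) ≠ 0 := by exact_mod_cast (by omega : n + (k + 1) ≠ 0)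
    have : ((n : ℂ) + 1) ≠ 0 := by exact_mod_cast n.succ_ne_zero
    have : (n.factorial : ℂ) ≠ 0 := by exact_mod_cast n.factorial_ne_zero
    rw [Nat.factorial_succ]
    push_cast
    field_simp
    ring
  refine (h1.add h3).unique ((hasSum_cexp u).congr_of_eq (fun n => ?_) rfl)
  have : ((n : ℂ) + k) ≠ 0 := by exact_mod_cast (by omega : n + k ≠ 0)
  field_simp
  ring

theorem mul_phi_one (u : ℂ) : u * phi 1 u = Complex.exp u - 1 := by
  have h1 := (hasSum_phi one_pos u).mul_left u
  have h2 := (hasSum_nat_add_iff' 1).2 (hasSum_cexp u)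
  simp only [Finset.sum_range_one, pow_zero, Nat.factorial_zero, Nat.cast_one, div_one] at h2
  refine h1.unique (h2.congr_of_eq (fun n => ?_) rfl)
  have : ((n : ℂ) + 1) ≠ 0 := by exact_mod_cast n.succ_ne_zero
  have : (n.factorial : ℂ) ≠ 0 := by exact_mod_cast n.factorial_ne_zero
  rw [Nat.factorial_succ]
  push_cast
  field_simp
  ring

theorem phi_zero {k : ℕ} : phi k 0 = 1 / k := by
  rw [phi, expSum_zero]; simp

theorem phi_one_of_ne {u : ℂ} (hu : u ≠ 0) : phi 1 u = (Complex.exp u - 1) / u := by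
  rw [← mul_phi_one, mul_div_cancel_left₀ _ hu]

theorem phi_two_of_ne {u : ℂ} (hu : u ≠ 0) :
    phi 2 u = ((u - 1) * Complex.exp u + 1) / u ^ 2 := by
  have h := mul_phi_add_mul_phi one_pos u
  rw [phi_one_of_ne hu] at h
  rw [eq_div_iff (pow_ne_zero 2 hu)]
  field_simp at h
  linear_combination h

/-- Through `phi` the removable singularity disappears, and smoothness and derivatives need no case
distinction. -/
theorem q1_eq (x : ℝ) : q1 x = -Complex.I * phi 1 (-Complex.I * x) := by
  by_cases hx : x = 0
  · simp [q1, hx, phi_zero]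
  have hx' : (x : ℂ) ≠ 0 := by exact_mod_cast hx
  rw [q1, if_neg hx, phi_one_of_ne (by simp [hx])]
  field_simp

theorem q2_eq (x : ℝ) : q2 x = phi 2 (-Complex.I * x) := by
  by_cases hx : x = 0
  · simp [q2, hx, phi_zero]
  have hx' : (x : ℂ) ≠ 0 := by exact_mod_cast hx
  rw [q2, if_neg hx, phi_two_of_ne (by simp [hx]), mul_pow, neg_sq, Complex.I_sq]
  field_simp
  ring

theorem p1_eq (y : ℝ) : p1 y = phi 1 (Complex.I * y) := by
  by_cases hx : y = 0
  · simp [p1, hx, phi_zero]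
  rw [p1, if_neg hx, phi_one_of_ne (by simp [hx])]

theorem p2_eq (y : ℝ) : p2 y = phi 2 (Complex.I * y) := by
  by_cases hx : y = 0
  · simp [p2, hx, phi_zero]
  have hx' : (y : ℂ) ≠ 0 := by exact_mod_cast hx
  rw [p2, if_neg hx, phi_two_of_ne (by simp [hx]), mul_pow, Complex.I_sq]
  field_simp
  ring

theorem p1_neg (x : ℝ) : p1 (-x) = Complex.I * q1 x := by
  rw [p1_eq, q1_eq, ← mul_assoc, mul_neg, Complex.I_mul_I]; simp

theorem p2_neg (x : ℝ) : p2 (-x) = q2 x := by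
  rw [p2_eq, q2_eq]; simp

/-- Used for the `R`-components of the gauge-transformed form. -/
theorem exp_eq_q1 (x : ℝ) : Complex.exp (-Complex.I * x) = 1 + x * q1 x := by
  have := mul_phi_one (-Complex.I * x)
  rw [q1_eq]
  linear_combination -this

/-- Used for the remaining components, where `q1` is differentiated. -/
theorem exp_eq_q1_q2 (x : ℝ) :
    Complex.exp (-Complex.I * x) = Complex.I * q1 x - Complex.I * x * q2 x := by
  have := mul_phi_add_mul_phi one_pos (-Complex.I * x)
  rw [q1_eq, q2_eq]
  push_cast at this
  linear_combination -this + phi 1 (-Complex.I * x) * Complex.I_sq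

theorem hasDerivAt_q1 (x : ℝ) : HasDerivAt q1 (-q2 x) x := by
  have h1 : HasDerivAt (fun x : ℝ => -Complex.I * (x : ℂ)) (-Complex.I) x := by
    simpa using (Complex.ofRealCLM.hasDerivAt (x := x)).const_mul (-Complex.I)
  have h2 := ((hasDerivAt_phi one_pos (-Complex.I * x)).comp x h1).const_mul (-Complex.I)
  rw [show q1 = fun x : ℝ => -Complex.I * (phi 1 ∘ fun x : ℝ => -Complex.I * (x : ℂ)) x from
    funext q1_eq]
  refine h2.congr_deriv ?_
  rw [q2_eq]
  linear_combination phi 2 (-Complex.I * x) * Complex.I_sq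

theorem contDiff_q1 {n : WithTop ℕ∞} : ContDiff ℝ n q1 := by
  have h1 : Differentiable ℂ (phi 1) := fun u => (hasDerivAt_phi one_pos u).differentiableAt
  have h2 : ContDiff ℝ n (phi 1) := (h1.contDiff (n := n)).restrict_scalars ℝ
  rw [show q1 = fun x : ℝ => -Complex.I * phi 1 (-Complex.I * (x : ℂ)) from funext q1_eq]
  exact contDiff_const.mul (h2.comp (contDiff_const.mul Complex.ofRealCLM.contDiff))

theorem hasDerivAt_mul_phi_one (u : ℂ) (τ : ℝ) :
    HasDerivAt (fun τ : ℝ => (τ : ℂ) * phi 1 (τ * u)) (Complex.exp (τ * u)) τ := by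
  have h0 := Complex.ofRealCLM.hasDerivAt (x := τ)
  have h1 : HasDerivAt (fun τ : ℝ => (τ : ℂ) * u) u τ := by simpa using h0.mul_const u
  have h2 := (hasDerivAt_phi one_pos (τ * u)).comp τ h1
  refine (h0.mul h2).congr_deriv ?_
  rw [← mul_phi_add_mul_phi one_pos]
  simp
  ring

theorem hasDerivAt_sq_mul_phi_two (u : ℂ) (τ : ℝ) :
    HasDerivAt (fun τ : ℝ => (τ : ℂ) ^ 2 * phi 2 (τ * u)) (τ * Complex.exp (τ * u)) τ := by
  have h0 := Complex.ofRealCLM.hasDerivAt (x := τ)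
  have h1 : HasDerivAt (fun τ : ℝ => (τ : ℂ) * u) u τ := by simpa using h0.mul_const u
  have h2 := (hasDerivAt_phi two_pos (τ * u)).comp τ h1
  refine ((h0.pow 2).mul h2).congr_deriv ?_
  rw [← mul_phi_add_mul_phi two_pos]
  simp
  ring

namespace Setting

variable (W : Setting)

theorem weighted_leadR (F : Fin 4 → Fin 4 → ℂ) {ε : ℝ} (hε : 0 < ε) (z : PhaseSpace) (β : Fin 4) :
    HasSum (fun j : ℕ => ((-ε : ℂ) ^ (j + 1) / ((j + 1).factorial : ℂ)) *
      W.leadR F ε (j + 1) z β) (W.sumR F ε z β) := by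
  have hε' : (ε : ℂ) ≠ 0 := by exact_mod_cast hε.ne'
  have h := (hasSum_phi one_pos (-Complex.I * W.gk z)).mul_left
    (-(W.e / W.c : ℂ) * contract1 (W.gr z) F β * W.eik ε z.1)
  refine h.congr_of_eq (fun j => ?_) ?_
  · have : ((j : ℂ) + 1) ≠ 0 := by exact_mod_cast j.succ_ne_zero
    have : (j.factorial : ℂ) ≠ 0 := by exact_mod_cast j.factorial_ne_zero
    rw [leadR, Nat.factorial_succ, Nat.add_sub_cancel, div_pow, mul_pow, neg_pow Complex.I,
      neg_pow (ε : ℂ)]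
    push_cast
    field_simp
    rw [pow_succ (-1 : ℂ), pow_succ Complex.I]
    linear_combination ((-1 : ℂ) ^ j * Complex.I ^ j * W.e * W.gk z ^ j *
      contract1 (W.gr z) F β * W.eik ε z.1 / W.c) * Complex.I_sq
  · rw [sumR, q1_eq]
    linear_combination (W.e / W.c : ℂ) * contract1 (W.gr z) F β * phi 1 (-Complex.I * W.gk z) *
      W.eik ε z.1 * Complex.I_sq

theorem weighted_leadAng (F : Fin 4 → Fin 4 → ℂ) (v : Spacetime) {ε : ℝ} (hε : 0 < ε)
    (z : PhaseSpace) :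
    HasSum (fun j : ℕ => ((-ε : ℂ) ^ (j + 1) / ((j + 1).factorial : ℂ)) *
      W.leadAng F v ε (j + 1) z) (W.sumAng F v ε z) := by
  have hε' : (ε : ℂ) ≠ 0 := by exact_mod_cast hε.ne'
  have h := (hasSum_phi two_pos (-Complex.I * W.gk z)).mul_left
    (-(W.e / W.c : ℂ) * ε * contract2 v F (W.gr z) * W.eik ε z.1)
  -- The term `j = 1` vanishes. With `j = n + 2` the weight is `(n+1)/(n+2)! = 1/(n! (n+2))`, the
  -- coefficient of `phi 2`.
  rw [← hasSum_nat_add_iff' 1]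
  refine h.congr_of_eq (fun j => ?_) ?_
  · have : ((j : ℂ) + 1) ≠ 0 := by exact_mod_cast j.succ_ne_zero
    have : ((j : ℂ) + 2) ≠ 0 := by exact_mod_cast (j + 1).succ_ne_zero
    have : ((j : ℂ) + 1 + 1) ≠ 0 := by exact_mod_cast (j + 1).succ_ne_zero
    have : (j.factorial : ℂ) ≠ 0 := by exact_mod_cast j.factorial_ne_zero
    rw [leadAng, Nat.factorial_succ, Nat.factorial_succ, show j + 1 + 1 - 2 = j by omega, div_pow,
      mul_pow, mul_pow, neg_pow Complex.I, neg_pow (ε : ℂ)]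
    push_cast
    field_simp
    ring
  · rw [sumAng, q2_eq]
    simp [leadAng]
    ring

theorem weighted_leadPot {ε : ℝ} (hε : 0 < ε) (z : PhaseSpace) :
    HasSum (fun j : ℕ => ((-ε : ℂ) ^ (j + 1) / ((j + 1).factorial : ℂ)) *
      W.leadPot ε j z) (-W.STc ε z) := by
  have hε' : (ε : ℂ) ≠ 0 := by exact_mod_cast hε.ne'
  have h := (hasSum_phi one_pos (-Complex.I * W.gk z)).mul_left
    (-(ε : ℂ) * (W.e / W.c : ℂ) * dotA (W.gr z) (W.At z.1) * W.eik ε z.1)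
  refine h.congr_of_eq (fun j => ?_) ?_
  · have : ((j : ℂ) + 1) ≠ 0 := by exact_mod_cast j.succ_ne_zero
    have : (j.factorial : ℂ) ≠ 0 := by exact_mod_cast j.factorial_ne_zero
    rw [leadPot, Nat.factorial_succ, div_pow, mul_pow, neg_pow Complex.I, neg_pow (ε : ℂ)]
    push_cast
    field_simp
    ring
  · rw [STc, q1_eq]
    linear_combination (ε : ℂ) * (W.e / W.c : ℂ) * dotA (W.gr z) (W.At z.1) *
      phi 1 (-Complex.I * W.gk z) * W.eik ε z.1 * Complex.I_sq

end Setting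

end

/-! ### Expansion of iterates in powers of `ε`. -/

section

section Expansion

variable {E : Type*} [NormedAddCommGroup E] [NormedSpace ℝ E]
  {F : Type*} [NormedAddCommGroup F] [NormedSpace ℝ F] [NormedSpace ℂ F] [IsScalarTower ℝ ℂ F]
  {S : Set E} {g : E → E} {M : E → F →L[ℝ] F} {h : E → ℂ} {b : ℕ → E → F}

/-- The coefficients, in powers of `ε`, of the iterates of `ε (g · ∇ + M) + h`. -/
def expCoef (g : E → E) (M : E → F →L[ℝ] F) (h : E → ℂ) (b : ℕ → E → F) : ℕ → ℕ → E → F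
  | 0, i => b i
  | n + 1, 0 => fun z => h z • expCoef g M h b n 0 z
  | n + 1, i + 1 => fun z => h z • expCoef g M h b n (i + 1) z + lop g M (expCoef g M h b n i) z

-- Each application raises the degree in `ε` by at most one.
omit [IsScalarTower ℝ ℂ F] in
theorem expCoef_eq_zero {m : ℕ} (hb : ∀ i, m ≤ i → b i = 0) (n i : ℕ) (hi : n + m ≤ i) :
    expCoef g M h b n i = 0 := by
  induction n generalizing i with
  | zero => exact hb i (by omega)
  | succ n ih =>
    obtain ⟨i, rfl⟩ : ∃ i', i = i' + 1 := ⟨i - 1, by omega⟩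
    funext z
    rw [expCoef, ih (i + 1) (by omega), ih i (by omega)]
    simp [lop, show (fderiv ℝ (0 : E → F) z) = 0 from fderiv_const_apply _]

omit [IsScalarTower ℝ ℂ F] in
theorem expCoef_zero (n : ℕ) (z : E) : expCoef g M h b n 0 z = h z ^ n • b 0 z := by
  induction n with
  | zero => simp [expCoef]
  | succ n ih =>
    rw [show expCoef g M h b (n + 1) 0 z = h z • expCoef g M h b n 0 z from rfl, ih, smul_smul,
      pow_succ']

theorem contDiffOn_expCoef (hS : IsOpen S) (hg : ContDiffOn ℝ ∞ g S) (hM : ContDiffOn ℝ ∞ M S)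
    (hh : ContDiffOn ℝ ∞ h S) (hb : ∀ i, ContDiffOn ℝ ∞ (b i) S) (n i : ℕ) :
    ContDiffOn ℝ ∞ (expCoef g M h b n i) S := by
  induction n generalizing i with
  | zero => exact hb i
  | succ n ih =>
    cases i with
    | zero => exact hh.smul (ih 0)
    | succ i => exact (hh.smul (ih (i + 1))).add (contDiffOn_lop hS hg hM (ih i))

/-- The condition `hεw` says that conjugation by `w` turns `ε lop` into `h + ε lop`. The expansion
is an exact polynomial identity, so no asymptotic series is involved. -/
theorem lop_iterate_smul_eq_expCoef (hS : IsOpen S) (hg : ContDiffOn ℝ ∞ g S)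
    (hM : ContDiffOn ℝ ∞ M S) (hMc : ∀ z (c : ℂ) x, M z (c • x) = c • M z x)
    (hh : ContDiffOn ℝ ∞ h S) (hb : ∀ i, ContDiffOn ℝ ∞ (b i) S) {m : ℕ}
    (hbm : ∀ i, m ≤ i → b i = 0) {w : E → ℂ} (hw : ContDiffOn ℝ ∞ w S) (ε : ℝ)
    (hεw : ∀ z ∈ S, (ε : ℂ) * lop g 0 w z = h z * w z) (n : ℕ) :
    EqOn (ε ^ n • (lop g M)^[n] (fun z => w z • ∑ i ∈ Finset.range m, ε ^ i • b i z))
      (fun z => w z • ∑ i ∈ Finset.range (n + m), ε ^ i • expCoef g M h b n i z) S := by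
  induction n with
  | zero => intro z _; simp [expCoef]
  | succ n ih =>
    intro z hz
    have hd : ∀ i, DifferentiableAt ℝ (expCoef g M h b n i) z := fun i =>
      (contDiffOn_expCoef hS hg hM hh hb n i).differentiableAt_of_isOpen hS hz
    have hs : DifferentiableAt ℝ
        (fun z => ∑ i ∈ Finset.range (n + m), ε ^ i • expCoef g M h b n i z) z :=
      DifferentiableAt.fun_sum fun i _ => (hd i).const_smul _
    have h1 := ih.lop (g := g) (M := M) hS hz
    rw [lop_const_smul, lop_smul hMc (hw.differentiableAt_of_isOpen hS hz) hs,
      lop_sum_smul _ _ _ hd] at h1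
    have h2 : (ε ^ (n + 1) • (lop g M)^[n + 1]
        (fun z => w z • ∑ i ∈ Finset.range m, ε ^ i • b i z)) z =
        ε • (ε ^ n • lop g M ((lop g M)^[n]
          (fun z => w z • ∑ i ∈ Finset.range m, ε ^ i • b i z)) z) := by
      rw [Pi.smul_apply, Function.iterate_succ_apply', smul_smul, pow_succ']
    rw [h2, h1, smul_add, ← smul_assoc, Complex.real_smul, hεw z hz, mul_comm, mul_smul,
      smul_comm ε (w z), ← smul_add]
    congr 1
    rw [show n + 1 + m = n + m + 1 by omega, Finset.sum_range_succ', expCoef]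
    simp only [expCoef, smul_add, Finset.sum_add_distrib]
    rw [add_right_comm]
    congr 1
    · have h3 := Finset.sum_range_succ' (fun i => ε ^ i • (h z • expCoef g M h b n i z)) (n + m)
      rw [← h3, Finset.sum_range_succ, expCoef_eq_zero hbm n (n + m) le_rfl, Finset.smul_sum]
      simp only [Pi.zero_apply, smul_zero, add_zero]
      exact Finset.sum_congr rfl fun i _ => smul_comm _ _ _
    · rw [Finset.smul_sum]
      exact Finset.sum_congr rfl fun i _ => by rw [smul_smul, pow_succ']

-- The discarded part is a finite sum of higher powers of `ε < 1` with coefficients that are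
-- continuous, hence bounded, on the compact set.
omit [NormedSpace ℂ F] [IsScalarTower ℝ ℂ F] in
theorem exists_norm_sum_sub_le {K : Set E} (hK : IsCompact K) (hKS : K ⊆ S) {c : ℕ → E → F}
    (hc : ∀ i, ContDiffOn ℝ ∞ (c i) S) {k N : ℕ} (hk : k ≤ N) :
    ∃ C : ℝ, ∀ ε ∈ Ioo (0 : ℝ) 1, ∀ z ∈ K,
      ‖∑ i ∈ Finset.range N, ε ^ i • c i z - ∑ i ∈ Finset.range k, ε ^ i • c i z‖ ≤ C * ε ^ k := by
  have h1 : ∀ i, ∃ C, ∀ z ∈ K, ‖c i z‖ ≤ C := fun i =>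
    hK.exists_bound_of_continuousOn ((hc i).continuousOn.mono hKS)
  choose C hC using h1
  refine ⟨∑ i ∈ Finset.Ico k N, C i, fun ε hε z hz => ?_⟩
  rw [← Finset.sum_Ico_eq_sub _ hk, Finset.sum_mul]
  refine norm_sum_le_of_le _ fun i hi => ?_
  have h2 := (norm_nonneg _).trans (hC i z hz)
  rw [norm_smul, norm_pow, Real.norm_of_nonneg hε.1.le, mul_comm]
  exact mul_le_mul (hC i z hz)
    (pow_le_pow_of_le_one hε.1.le hε.2.le (Finset.mem_Ico.1 hi).1) (by have := hε.1; positivity) h2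

end Expansion

theorem abs_cc_le (z : ℂ) : |cc z| ≤ 2 * ‖z‖ := by
  rw [cc, abs_mul, abs_two]
  exact mul_le_mul_of_nonneg_left (Complex.abs_re_le_norm z) two_pos.le

theorem cc_sub (z w : ℂ) : cc z - cc w = cc (z - w) := by simp [cc]; ring

theorem cc_add (z w : ℂ) : cc z + cc w = cc (z + w) := by simp [cc]; ring

theorem UnifO.of_cc {K : Set PhaseSpace} {p : ℤ} {a : ℝ → PhaseSpace → ℂ} {C ε₀ : ℝ} (h0 : 0 < ε₀)
    (h : ∀ ε ∈ Ioo (0 : ℝ) ε₀, ∀ z ∈ K, ‖a ε z‖ ≤ C * ε ^ p) {f : ℝ → PhaseSpace → ℝ}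
    (hf : ∀ ε ∈ Ioo (0 : ℝ) ε₀, ∀ z ∈ K, f ε z = cc (a ε z)) : UnifO K p f :=
  ⟨2 * C, ε₀, h0, fun ε hε z hz => by
    rw [hf ε hε z hz, mul_assoc]
    exact (abs_cc_le _).trans (mul_le_mul_of_nonneg_left (h ε hε z hz) two_pos.le)⟩

namespace Setting

variable {W : Setting}

theorem norm_eik (W : Setting) (ε : ℝ) (r : Spacetime) : ‖W.eik ε r‖ = 1 := by
  have : Complex.I / (ε : ℂ) * (W.ψ r : ℂ) = ((W.ψ r / ε : ℝ) : ℂ) * Complex.I := by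
    push_cast; ring
  rw [eik, this, Complex.norm_exp_ofReal_mul_I]

theorem lop_eik {ε : ℝ} (hε : ε ≠ 0) {z : PhaseSpace} (hz : z ∈ W.dom) :
    (ε : ℂ) * lop W.g 0 (fun y : PhaseSpace => W.eik ε y.1) z =
      (Complex.I * W.gk z) * W.eik ε z.1 := by
  have hε' : (ε : ℂ) ≠ 0 := by exact_mod_cast hε
  rw [lop_zero_apply, fderiv_eik ε hz, _root_.smul_apply, dpsi_apply, smul_eq_mul,
    show (W.g z).1 = W.gr z from rfl, ← gk]
  field_simp

theorem formMul_smul (z : PhaseSpace) (c : ℂ) (σ : PhaseSpace →L[ℝ] ℂ) :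
    GCWave.formMul ℂ W.g z (c • σ) = c • GCWave.formMul ℂ W.g z σ := rfl

theorem contDiffOn_eik_smul_alpha (ε : ℝ) :
    ContDiffOn ℝ ∞ (fun z : PhaseSpace => W.eik ε z.1 • W.alpha z) W.dom :=
  (contDiffOn_eik ε).smul W.reg_top.alpha

theorem contDiffOn_gammaW (W : Setting) (ε : ℝ) : ContDiffOn ℝ ∞ (W.gammaW ε) W.dom := by
  rw [gammaW_eq]
  have h : ContDiff ℝ ∞ (fun ξ => toForm1 PhaseSpace ξ) :=
    ContinuousLinearMap.contDiff (F := PhaseSpace [⋀^Fin 1]→L[ℝ] ℝ) _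
  exact h.comp_contDiffOn (contDiffOn_eik_smul_alpha ε)

theorem intD_gammaW (ε : ℝ) {z : PhaseSpace} (hz : z ∈ W.dom) :
    intD W.g (W.gammaW ε) z = toForm1 PhaseSpace (W.eik ε z.1 • W.betaE ε z) := by
  rw [gammaW_eq, intD_toForm1 (differentiableAt_of_contDiffOn (contDiffOn_eik_smul_alpha ε) hz),
    intCurl_eik_smul_alpha ε hz]

theorem contDiffOn_betaE (ε : ℝ) : ContDiffOn ℝ ∞ (W.betaE ε) W.dom :=
  (contDiffOn_const.smul W.reg_top.beta0).add W.reg_top.beta1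

theorem contDiffOn_eik_smul_betaE (ε : ℝ) :
    ContDiffOn ℝ ∞ (fun z : PhaseSpace => W.eik ε z.1 • W.betaE ε z) W.dom :=
  (contDiffOn_eik ε).smul (contDiffOn_betaE ε)

/-- The Lie derivative along `g` on complex covector fields. -/
abbrev lieG (W : Setting) : (PhaseSpace → PhaseSpace →L[ℝ] ℂ) → PhaseSpace → PhaseSpace →L[ℝ] ℂ :=
  lop W.g (GCWave.formMul ℂ W.g)

theorem intD_iterate_gammaW (ε : ℝ) (n : ℕ) {z : PhaseSpace} (hz : z ∈ W.dom) :
    (intD W.g)^[n + 1] (W.gammaW ε) z = toForm1 PhaseSpace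
      ((lieG W)^[n] (fun y : PhaseSpace => W.eik ε y.1 • W.betaE ε y) z) := by
  rw [intD_iterate_eqOn W.isOpen_dom g_contDiffOn (W.contDiffOn_gammaW ε) n hz]
  have h1 : EqOn (intD W.g (W.gammaW ε))
      (fun z => toForm1 PhaseSpace (W.eik ε z.1 • W.betaE ε z)) W.dom := fun z hz =>
    intD_gammaW ε hz
  rw [h1.iterate_of_local (fun _ _ h => h.lieDeriv W.isOpen_dom) n hz]
  exact lieDeriv_iterate_toForm1 W.isOpen_dom g_contDiffOn (contDiffOn_eik_smul_betaE ε) n hz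

theorem lieDeriv_iterate_gammaW (ε : ℝ) (n : ℕ) {z : PhaseSpace} (hz : z ∈ W.dom) :
    (lieDeriv W.g)^[n] (W.gammaW ε) z = toForm1 PhaseSpace
      ((lieG W)^[n] (fun y : PhaseSpace => W.eik ε y.1 • W.alpha y) z) := by
  rw [gammaW_eq]
  exact lieDeriv_iterate_toForm1 W.isOpen_dom g_contDiffOn (contDiffOn_eik_smul_alpha ε) n hz

theorem contDiffOn_eik_smul_f0 (ε : ℝ) :
    ContDiffOn ℝ ∞ (fun z : PhaseSpace => W.eik ε z.1 • W.f0 z) W.dom :=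
  (contDiffOn_eik ε).smul W.reg_top.f0

theorem potIter_eq (ε : ℝ) (n : ℕ) {z : PhaseSpace} (hz : z ∈ W.dom) :
    W.potIter ε n z = toForm0 PhaseSpace
      ((lop W.g 0)^[n] (fun y : PhaseSpace => W.eik ε y.1 • W.f0 y) z) := by
  rw [potIter, intProd_dInt_iterate, gammaW_eq, intProd_toForm1]
  exact intD_iterate_toForm0 W.isOpen_dom g_contDiffOn (contDiffOn_eik_smul_f0 ε) n hz

/-- Coefficients of the expansion of `(i_g d)^j γ_w` in powers of `ε`. -/
def invCoef (W : Setting) : ℕ → ℕ → PhaseSpace → PhaseSpace →L[ℝ] ℂ :=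
  expCoef W.g (GCWave.formMul ℂ W.g) (fun z => Complex.I * W.gk z)
    fun i => if i = 0 then W.beta0 else if i = 1 then W.beta1 else 0

/-- Coefficients of the expansion of `i_g (d i_g)^j γ_w` in powers of `ε`. -/
def potCoef (W : Setting) : ℕ → ℕ → PhaseSpace → ℂ :=
  expCoef W.g 0 (fun z => Complex.I * W.gk z) fun i => if i = 0 then W.f0 else 0

theorem contDiffOn_I_mul_gk : ContDiffOn ℝ ∞ (fun z => Complex.I * (W.gk z : ℂ)) W.dom :=
  contDiffOn_const.mul W.reg_top.gkC

theorem contDiffOn_invCoef (n i : ℕ) : ContDiffOn ℝ ∞ (W.invCoef n i) W.dom := by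
  refine contDiffOn_expCoef W.isOpen_dom g_contDiffOn W.reg_top.formMul contDiffOn_I_mul_gk
    (fun i => ?_) n i
  split_ifs
  exacts [W.reg_top.beta0, W.reg_top.beta1, contDiffOn_const]

theorem contDiffOn_potCoef (n i : ℕ) : ContDiffOn ℝ ∞ (W.potCoef n i) W.dom := by
  refine contDiffOn_expCoef W.isOpen_dom g_contDiffOn contDiffOn_zeroMul contDiffOn_I_mul_gk
    (fun i => ?_) n i
  split_ifs
  exacts [W.reg_top.f0, contDiffOn_const]

theorem lieG_iterate_betaE {ε : ℝ} (hε : ε ≠ 0) (n : ℕ) {z : PhaseSpace} (hz : z ∈ W.dom) :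
    ε ^ (n + 1) • (lieG W)^[n] (fun y : PhaseSpace => W.eik ε y.1 • W.betaE ε y) z =
      W.eik ε z.1 • ∑ i ∈ Finset.range (n + 2), ε ^ i • W.invCoef n i z := by
  have h := lop_iterate_smul_eq_expCoef (M := GCWave.formMul ℂ W.g) (m := 2)
    (b := fun i => if i = 0 then W.beta0 else if i = 1 then W.beta1 else 0) W.isOpen_dom
    g_contDiffOn W.reg_top.formMul formMul_smul contDiffOn_I_mul_gk
    (fun i => by split_ifs; exacts [W.reg_top.beta0, W.reg_top.beta1, contDiffOn_const])
    (fun i hi => by simp [show i ≠ 0 by omega, show i ≠ 1 by omega]) (contDiffOn_eik ε) ε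
    (fun z hz => lop_eik hε hz) n hz
  refine Eq.trans ?_ h
  -- One further factor `ε` clears the denominator in `β₀/ε + β₁`, which explains the exponent `n +
  -- 1`.
  have h2 : (fun z : PhaseSpace => W.eik ε z.1 • ∑ i ∈ Finset.range 2, ε ^ i •
      (if i = 0 then W.beta0 else if i = 1 then W.beta1 else 0) z) =
      ε • fun y : PhaseSpace => W.eik ε y.1 • W.betaE ε y := by
    funext y
    change _ = ε • (W.eik ε y.1 • ((1 / ε) • W.beta0 y + W.beta1 y))
    rw [Finset.sum_range_succ, Finset.sum_range_one, smul_comm ε (W.eik ε y.1), smul_add ε,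
      smul_smul ε, mul_one_div_cancel hε, one_smul]
    simp
  rw [h2, lop_iterate_const_smul, smul_smul, ← pow_succ]
  rfl

theorem lop_iterate_f0 {ε : ℝ} (hε : ε ≠ 0) (n : ℕ) {z : PhaseSpace} (hz : z ∈ W.dom) :
    ε ^ n • (lop W.g 0)^[n] (fun y : PhaseSpace => W.eik ε y.1 • W.f0 y) z =
      W.eik ε z.1 • ∑ i ∈ Finset.range (n + 1), ε ^ i • W.potCoef n i z := by
  have h := lop_iterate_smul_eq_expCoef (M := 0) (m := 1)
    (b := fun i => if i = 0 then W.f0 else 0) W.isOpen_dom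
    g_contDiffOn contDiffOn_zeroMul (by simp) contDiffOn_I_mul_gk
    (fun i => by split_ifs; exacts [W.reg_top.f0, contDiffOn_const])
    (fun i hi => by simp [show i ≠ 0 by omega]) (contDiffOn_eik ε) ε
    (fun z hz => lop_eik hε hz) n hz
  refine Eq.trans ?_ h
  have h2 : (fun z : PhaseSpace => W.eik ε z.1 • ∑ i ∈ Finset.range 1, ε ^ i •
      (if i = 0 then W.f0 else 0) z) = fun y : PhaseSpace => W.eik ε y.1 • W.f0 y := by
    funext y; simp
  rw [h2]
  rfl

theorem invCoef_zero (n : ℕ) (z : PhaseSpace) :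
    W.invCoef n 0 z = (Complex.I * W.gk z) ^ n • W.beta0 z := by
  rw [invCoef, expCoef_zero, if_pos rfl]

theorem potCoef_zero (n : ℕ) (z : PhaseSpace) :
    W.potCoef n 0 z = (Complex.I * W.gk z) ^ n * W.f0 z := by
  rw [potCoef, expCoef_zero, if_pos rfl, smul_eq_mul]

/-- On a vertical vector the coefficient obeys `c_{n+1} = h c_n + hⁿ β₀(∂g)` with `c₀ = 0` and `h =
i g^r·k`, which gives `n h^(n-1) β₀(∂g)`. -/
theorem invCoef_one_apply (n : ℕ) {z : PhaseSpace} (hz : z ∈ W.dom) {v : PhaseSpace}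
    (hv : v.1 = 0) :
    W.invCoef n 1 z v = n * (Complex.I * W.gk z) ^ (n - 1) * W.beta0 z (fderiv ℝ W.g z v) := by
  induction n with
  | zero => simp [invCoef, expCoef, horizontal_beta1 z hz v hv]
  | succ n ih =>
    have h1 : W.invCoef (n + 1) 1 z = (Complex.I * W.gk z) • W.invCoef n 1 z +
      lieG W (W.invCoef n 0) z := rfl
    have hh : W.Horizontal (W.invCoef n 0) := fun y hy u hu => by
      rw [invCoef_zero, _root_.smul_apply, horizontal_beta0 y hy u hu, smul_zero]
    rw [h1, _root_.add_apply, _root_.smul_apply, ih,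
      lop_apply_of_horizontal (contDiffOn_invCoef n 0) hh hz hv, invCoef_zero, _root_.smul_apply,
      smul_eq_mul, smul_eq_mul]
    cases n with
    | zero => simp
    | succ n => simp only [Nat.add_sub_cancel]; push_cast; ring

theorem contract2_Ft_comm (u v : Spacetime) (r : Spacetime) :
    contract2 u (W.Ft r) v = -contract2 v (W.Ft r) u := by
  rw [Ft, contract2_waveTensor, contract2_waveTensor]; ring

theorem beta0_fderiv_g {z : PhaseSpace} (hz : z ∈ W.dom) (v : PhaseSpace) :
    W.beta0 z (fderiv ℝ W.g z v) =
      -(W.e / W.c : ℂ) * contract2 (fderiv ℝ W.gr z v) (W.Ft z.1) (W.gr z) := by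
  rw [beta0_apply, fderiv_g hz, contract2_Ft_comm]; ring

theorem extDeriv_gammaW_bound (W : Setting) {K : Set PhaseSpace} (hK : IsCompact K)
    (hKd : K ⊆ W.dom) :
    ∃ C : ℝ, ∃ ε₀ > 0, ∀ ε ∈ Ioo (0 : ℝ) ε₀, ∀ z ∈ K, ∀ u v : PhaseSpace,
      |extDeriv (W.gammaW ε) z ![u, v] -
        cc ((W.e / (ε * W.c) : ℂ) * contract2 u.1 (W.Ft z.1) v.1 * W.eik ε z.1)| ≤
      C * ‖u‖ * ‖v‖ := by
  obtain ⟨C, hC⟩ := hK.exists_bound_of_continuousOn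
    ((W.reg_top.alpha.continuousOn_fderiv_of_isOpen W.isOpen_dom (by simp)).mono hKd)
  -- Two derivatives of `α` occur in the curl, and adding the complex conjugate doubles each.
  refine ⟨4 * C, 1, one_pos, fun ε hε z hz u v => ?_⟩
  have hε' : (ε : ℂ) ≠ 0 := by exact_mod_cast hε.1.ne'
  have hb : ∀ u v : PhaseSpace, ‖fderiv ℝ W.alpha z u v‖ ≤ C * ‖u‖ * ‖v‖ := fun u v =>
    (ContinuousLinearMap.le_opNorm₂ _ u v).trans (by gcongr; exact hC z hz)
  rw [gammaW_eq, extDeriv_toForm1 (differentiableAt_of_contDiffOn (contDiffOn_eik_smul_alpha ε)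
    (hKd hz)), fderiv_eik_smul_alpha ε (hKd hz), fderiv_eik_smul_alpha ε (hKd hz), cc_sub]
  have : W.eik ε z.1 * (Complex.I / ε * (W.dpsi z u * W.alpha z v) + fderiv ℝ W.alpha z u v) -
      W.eik ε z.1 * (Complex.I / ε * (W.dpsi z v * W.alpha z u) + fderiv ℝ W.alpha z v u) -
      (W.e / (ε * W.c) : ℂ) * contract2 u.1 (W.Ft z.1) v.1 * W.eik ε z.1 =
      W.eik ε z.1 * (fderiv ℝ W.alpha z u v - fderiv ℝ W.alpha z v u) := by
    rw [Ft, contract2_waveTensor, dpsi_apply, dpsi_apply, alpha_apply, alpha_apply, ← div_div,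
      div_right_comm]
    ring
  rw [this]
  refine (abs_cc_le _).trans ?_
  rw [norm_mul, norm_eik, one_mul]
  have h1 := norm_sub_le (fderiv ℝ W.alpha z u v) (fderiv ℝ W.alpha z v u)
  have h2 := hb u v
  have h3 := hb v u
  linarith [mul_right_comm C ‖u‖ ‖v‖]

theorem smul_eq_iff_eq_zpow {F : Type*} [NormedAddCommGroup F] [NormedSpace ℝ F] {ε : ℝ}
    (hε : 0 < ε) (n : ℕ) {x y : F} (h : ε ^ n • x = y) : x = ε ^ (-(n : ℤ)) • y := by
  rw [← h, smul_smul, zpow_neg, zpow_natCast, inv_mul_cancel₀ (by positivity), one_smul]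

/-- The first and third bounds keep one term of the `ε`-polynomial. The second keeps two, as the
first term vanishes in the vertical directions. -/
theorem leading_terms (W : Setting) {K : Set PhaseSpace} (hK : IsCompact K) (hKd : K ⊆ W.dom)
    (n : ℕ) :
    ∃ C : ℝ, ∀ ε ∈ Ioo (0 : ℝ) 1, ∀ z ∈ K,
      ‖(lieG W)^[n] (fun y : PhaseSpace => W.eik ε y.1 • W.betaE ε y) z -
        ε ^ (-((n + 1 : ℕ) : ℤ)) • W.eik ε z.1 • W.invCoef n 0 z‖ ≤ C * ε ^ (-(n : ℤ)) ∧
      ‖(lieG W)^[n] (fun y : PhaseSpace => W.eik ε y.1 • W.betaE ε y) z -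
        ε ^ (-((n + 1 : ℕ) : ℤ)) • W.eik ε z.1 • (W.invCoef n 0 z + ε • W.invCoef n 1 z)‖ ≤
          C * ε ^ (1 - (n : ℤ)) ∧
      ‖(lop W.g 0)^[n] (fun y : PhaseSpace => W.eik ε y.1 • W.f0 y) z -
        ε ^ (-(n : ℤ)) • W.eik ε z.1 • W.potCoef n 0 z‖ ≤ C * ε ^ (1 - (n : ℤ)) := by
  obtain ⟨C₁, h₁⟩ := exists_norm_sum_sub_le hK hKd (contDiffOn_invCoef n)
    (k := 1) (N := n + 2) (by omega)
  obtain ⟨C₂, h₂⟩ := exists_norm_sum_sub_le hK hKd (contDiffOn_invCoef n)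
    (k := 2) (N := n + 2) (by omega)
  obtain ⟨C₃, h₃⟩ := exists_norm_sum_sub_le hK hKd (contDiffOn_potCoef n)
    (k := 1) (N := n + 1) (by omega)
  refine ⟨max C₁ (max C₂ C₃), fun ε hε z hz => ?_⟩
  have hε0 := hε.1
  -- The factor `exp(iψ/ε)` has modulus one, so only the power of `ε` rescales the remainder.
  have key : ∀ {F : Type} [NormedAddCommGroup F] [NormedSpace ℝ F] [NormedSpace ℂ F]
      [IsScalarTower ℝ ℂ F] (m k : ℕ) (p : ℤ) (x y : F) (C : ℝ), ‖x - y‖ ≤ C * ε ^ k →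
      C ≤ max C₁ (max C₂ C₃) → p = k - m →
      ‖ε ^ (-(m : ℤ)) • W.eik ε z.1 • x - ε ^ (-(m : ℤ)) • W.eik ε z.1 • y‖ ≤
        max C₁ (max C₂ C₃) * ε ^ p := by
    intro F _ _ _ _ m k p x y C hxy hC hp
    rw [← smul_sub, ← smul_sub, norm_smul, norm_smul, norm_eik, one_mul, norm_zpow,
      Real.norm_of_nonneg hε0.le, hp, sub_eq_add_neg (k : ℤ), zpow_add₀ hε0.ne', zpow_natCast, mul_comm]
    rw [← mul_assoc]
    gcongr
    exact hxy.trans (by gcongr)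
  have e₁ := smul_eq_iff_eq_zpow (F := PhaseSpace →L[ℝ] ℂ) hε0 (n + 1) (lieG_iterate_betaE hε0.ne' n (hKd hz))
  have e₃ := smul_eq_iff_eq_zpow hε0 _ (lop_iterate_f0 hε0.ne' n (hKd hz))
  rw [e₁, e₃]
  refine ⟨?_, ?_, ?_⟩
  · refine key (n + 1) 1 _ _ _ C₁ ?_ (le_max_left _ _) (by push_cast; ring)
    simpa using h₁ ε hε z hz
  · refine key (n + 1) 2 _ _ _ C₂ ?_ ((le_max_left _ _).trans (le_max_right _ _))
      (by push_cast; ring)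
    simpa [Finset.sum_range_succ] using h₂ ε hε z hz
  · refine key n 1 _ _ _ C₃ ?_ ((le_max_right _ _).trans (le_max_right _ _)) (by push_cast; ring)
    simpa using h₃ ε hε z hz

end Setting

end

/-! ### Identification of the leading terms. -/

section

namespace Setting

variable {W : Setting}

theorem beta0_vR (z : PhaseSpace) (β : Fin 4) :
    W.beta0 z (vR β) = (W.e / W.c : ℂ) * contract1 (W.gr z) (W.Ft z.1) β := by
  rw [beta0_apply, contract2_vR]

theorem leadR_eq {ε : ℝ} (hε : 0 < ε) (n : ℕ) (z : PhaseSpace) (β : Fin 4) :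
    W.leadR (W.Ft z.1) ε (n + 1) z β =
      (ε ^ (-((n + 1 : ℕ) : ℤ)) • W.eik ε z.1 • W.invCoef n 0 z) (vR β) := by
  have hε' : (ε : ℂ) ≠ 0 := by exact_mod_cast hε.ne'
  rw [invCoef_zero, _root_.smul_apply, _root_.smul_apply, _root_.smul_apply, beta0_vR, leadR,
    Complex.real_smul, zpow_neg, zpow_natCast, Nat.add_sub_cancel, smul_eq_mul, smul_eq_mul]
  push_cast
  rw [div_pow, mul_pow, pow_succ Complex.I]
  field_simp
  linear_combination (-W.e * W.gk z ^ n * contract1 (W.gr z) (W.Ft z.1) β *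
    W.eik ε z.1 / W.c) * Complex.I_sq

theorem leadAng_eq {ε : ℝ} (hε : 0 < ε) (n : ℕ) {z : PhaseSpace} (hz : z ∈ W.dom)
    {v : PhaseSpace} (hv : v.1 = 0) :
    W.leadAng (W.Ft z.1) (fderiv ℝ W.gr z v) ε (n + 1) z =
      (ε ^ (-((n + 1 : ℕ) : ℤ)) • W.eik ε z.1 • (W.invCoef n 0 z + ε • W.invCoef n 1 z)) v := by
  have hε' : (ε : ℂ) ≠ 0 := by exact_mod_cast hε.ne'
  rw [_root_.smul_apply, _root_.smul_apply, _root_.add_apply, _root_.smul_apply,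
    invCoef_one_apply n hz hv, invCoef_zero, _root_.smul_apply, horizontal_beta0 z hz v hv,
    beta0_fderiv_g hz, leadAng, Complex.real_smul, Complex.real_smul, zpow_neg, zpow_natCast]
  -- For `n = 0` the truncated exponents `j - 2` and `n - 1` are meaningless, but both sides carry a
  -- vanishing factor.
  cases n with
  | zero => simp
  | succ n =>
    simp only [smul_eq_mul, Nat.add_sub_cancel, show n + 1 + 1 - 2 = n by omega]
    push_cast
    rw [div_pow]
    field_simp
    ring

theorem leadPot_eq {ε : ℝ} (hε : 0 < ε) (n : ℕ) (z : PhaseSpace) :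
    W.leadPot ε n z = ε ^ (-(n : ℤ)) • W.eik ε z.1 • W.potCoef n 0 z := by
  have hε' : (ε : ℂ) ≠ 0 := by exact_mod_cast hε.ne'
  rw [potCoef_zero, f0_eq, leadPot, Complex.real_smul, zpow_neg, zpow_natCast, smul_eq_mul]
  push_cast
  rw [div_pow, mul_pow]
  field_simp

theorem leading_terms_clause (W : Setting) {K : Set PhaseSpace} (hK : IsCompact K)
    (hKd : K ⊆ W.dom) (j : ℕ) (hj : 1 ≤ j) :
    (∀ β, UnifO K (1 - (j : ℤ)) fun ε z => (intD W.g)^[j] (W.gammaW ε) z ![vR β] -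
      cc (W.leadR (W.Ft z.1) ε j z β)) ∧
    (UnifO K (2 - (j : ℤ)) fun ε z => (intD W.g)^[j] (W.gammaW ε) z ![vMu] -
      cc (W.leadAng (W.Ft z.1) (W.dgrMu z) ε j z)) ∧
    (UnifO K (2 - (j : ℤ)) fun ε z => (intD W.g)^[j] (W.gammaW ε) z ![vTheta] -
      cc (W.leadAng (W.Ft z.1) (W.dgrTheta z) ε j z)) ∧
    (UnifO K (1 - (j : ℤ)) fun ε z => W.potIter ε j z ![] - cc (W.leadPot ε j z)) := by
  obtain ⟨n, rfl⟩ : ∃ n, j = n + 1 := ⟨j - 1, by omega⟩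
  obtain ⟨C, hC⟩ := W.leading_terms hK hKd n
  -- The potential of index `j` takes all `j` iterations, whereas one factor of `(i_g d)^j` is spent
  -- in forming the amplitude of `i_g dγ_w`.
  obtain ⟨C', hC'⟩ := W.leading_terms hK hKd (n + 1)
  have hp1 : (1 - ((n + 1 : ℕ) : ℤ)) = -(n : ℤ) := by push_cast; ring
  have hp2 : (2 - ((n + 1 : ℕ) : ℤ)) = 1 - (n : ℤ) := by push_cast; ring
  have ang : ∀ v : PhaseSpace, v.1 = 0 → UnifO K (2 - ((n + 1 : ℕ) : ℤ)) fun ε z =>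
      (intD W.g)^[n + 1] (W.gammaW ε) z ![v] -
      cc (W.leadAng (W.Ft z.1) (fderiv ℝ W.gr z v) ε (n + 1) z) := fun v hv => by
    refine UnifO.of_cc (C := C * ‖v‖) one_pos (a := fun ε z =>
      ((lieG W)^[n] (fun y : PhaseSpace => W.eik ε y.1 • W.betaE ε y) z -
        ε ^ (-((n + 1 : ℕ) : ℤ)) • W.eik ε z.1 • (W.invCoef n 0 z + ε • W.invCoef n 1 z)) v) ?_ ?_
    · intro ε hε z hz
      rw [hp2, mul_right_comm]
      exact ContinuousLinearMap.le_of_opNorm_le _ (hC ε hε z hz).2.1 v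
    · intro ε hε z hz
      rw [intD_iterate_gammaW ε n (hKd hz), toForm1_apply, leadAng_eq hε.1 n (hKd hz) hv, cc_sub,
        _root_.sub_apply]
      rfl
  refine ⟨fun β => ?_, ang vMu rfl, ang vTheta rfl, ?_⟩
  · refine UnifO.of_cc (C := C * ‖vR β‖) one_pos (a := fun ε z =>
      ((lieG W)^[n] (fun y : PhaseSpace => W.eik ε y.1 • W.betaE ε y) z -
        ε ^ (-((n + 1 : ℕ) : ℤ)) • W.eik ε z.1 • W.invCoef n 0 z) (vR β)) ?_ ?_
    · intro ε hε z hz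
      rw [hp1, mul_right_comm]
      exact ContinuousLinearMap.le_of_opNorm_le _ (hC ε hε z hz).1 (vR β)
    · intro ε hε z hz
      rw [intD_iterate_gammaW ε n (hKd hz), toForm1_apply, leadR_eq hε.1, cc_sub,
        _root_.sub_apply]
      rfl
  · refine UnifO.of_cc (C := C') one_pos (a := fun ε z =>
      (lop W.g 0)^[n + 1] (fun y : PhaseSpace => W.eik ε y.1 • W.f0 y) z -
        ε ^ (-((n + 1 : ℕ) : ℤ)) • W.eik ε z.1 • W.potCoef (n + 1) 0 z)
      (fun ε hε z hz => (hC' ε hε z hz).2.2) ?_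
    intro ε hε z hz
    rw [potIter_eq ε (n + 1) (hKd hz), toForm0_apply, leadPot_eq hε.1, cc_sub]

/-! ### Splitting of the Lie series -/

theorem differentiableAt_toForm0 {f : PhaseSpace → ℂ} {z : PhaseSpace}
    (hf : DifferentiableAt ℝ f z) : DifferentiableAt ℝ (fun y => toForm0 PhaseSpace (f y)) z :=
  ((toForm0 PhaseSpace).hasFDerivAt.comp z hf.hasFDerivAt).differentiableAt

/-- The complex amplitude of `i_g (d i_g)^j γ_w`. -/
abbrev potAmp (W : Setting) (ε : ℝ) (j : ℕ) : PhaseSpace → ℂ :=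
  (lop W.g 0)^[j] (fun y : PhaseSpace => W.eik ε y.1 • W.f0 y)

theorem contDiffOn_potAmp (ε : ℝ) (j : ℕ) : ContDiffOn ℝ ∞ (W.potAmp ε j) W.dom :=
  contDiffOn_lop_iterate W.isOpen_dom g_contDiffOn contDiffOn_zeroMul (contDiffOn_eik_smul_f0 ε) j

theorem potTerm_eqOn (ε : ℝ) (j : ℕ) : EqOn (W.potTerm ε j) (fun z =>
    toForm0 PhaseSpace (((-ε) ^ j / (j.factorial : ℝ)) • W.potAmp ε (j - 1) z)) W.dom :=
  fun z hz => by
    rw [potTerm, potIter_eq ε _ hz]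
    exact ((toForm0 PhaseSpace).map_smul _ _).symm

theorem differentiableAt_potIter (ε : ℝ) (j : ℕ) {z : PhaseSpace} (hz : z ∈ W.dom) :
    DifferentiableAt ℝ (W.potIter ε j) z :=
  (differentiableAt_toForm0 (differentiableAt_of_contDiffOn (contDiffOn_potAmp ε j)
    hz)).congr_of_eventuallyEq (Filter.eventually_of_mem (W.isOpen_dom.mem_nhds hz)
      fun _ hy => potIter_eq ε j hy)

theorem potTerm_eq_smul (ε : ℝ) (j : ℕ) :
    W.potTerm ε j = ((-ε) ^ j / (j.factorial : ℝ)) • W.potIter ε (j - 1) := rfl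

theorem differentiableAt_potTerm (ε : ℝ) (j : ℕ) {z : PhaseSpace} (hz : z ∈ W.dom) :
    DifferentiableAt ℝ (W.potTerm ε j) z := by
  rw [potTerm_eq_smul]
  exact (differentiableAt_potIter ε _ hz).const_smul _

theorem extDeriv_potTerm (ε : ℝ) (j : ℕ) {z : PhaseSpace} (hz : z ∈ W.dom) :
    extDeriv (W.potTerm ε (j + 1)) z =
      ((-ε) ^ (j + 1) / ((j + 1).factorial : ℝ)) • (dInt W.g)^[j + 1] (W.gammaW ε) z := by
  have h2 : fderiv ℝ (W.potTerm ε (j + 1)) z =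
      ((-ε) ^ (j + 1) / ((j + 1).factorial : ℝ)) • fderiv ℝ (W.potIter ε j) z := by
    rw [potTerm_eq_smul]
    exact fderiv_const_smul (differentiableAt_potIter ε j hz) _
  rw [Function.iterate_succ_apply', extDeriv_eq_altCLM, h2, map_smul, dInt, extDeriv_eq_altCLM]
  rfl

theorem lieTerm_eq (ε : ℝ) {j : ℕ} (hj : 1 ≤ j) {z : PhaseSpace} (hz : z ∈ W.dom) :
    W.lieTerm ε j z = W.invTerm ε j z + extDeriv (W.potTerm ε j) z := by
  obtain ⟨j, rfl⟩ : ∃ n, j = n + 1 := ⟨j - 1, by omega⟩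
  rw [extDeriv_potTerm ε j hz, lieTerm, invTerm, ← smul_add,
    lieDeriv_iterate_eqOn W.isOpen_dom g_contDiffOn (W.contDiffOn_gammaW ε) j hz]
  rfl

theorem lieTerm_zero (ε : ℝ) (z : PhaseSpace) : W.lieTerm ε 0 z = W.gammaW ε z := by
  simp [lieTerm]

theorem splitting (W : Setting) (ε : ℝ) {z : PhaseSpace} (hz : z ∈ W.dom) (N : ℕ) :
    ∑ j ∈ Finset.range (N + 1), W.lieTerm ε j z =
      (W.gammaW ε z + ∑ j ∈ Finset.Icc 1 N, W.invTerm ε j z) +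
        extDeriv (fun y => ∑ j ∈ Finset.Icc 1 N, W.potTerm ε j y) z := by
  have h : fderiv ℝ (fun y => ∑ j ∈ Finset.Icc 1 N, W.potTerm ε j y) z =
      ∑ j ∈ Finset.Icc 1 N, fderiv ℝ (W.potTerm ε j) z :=
    fderiv_fun_sum fun j _ => differentiableAt_potTerm ε j hz
  rw [extDeriv_eq_altCLM, h, map_sum, add_assoc, ← Finset.sum_add_distrib,
    Finset.sum_range_succ', lieTerm_zero, add_comm, Finset.range_eq_Ico,
    Finset.sum_Ico_add' (fun j => W.lieTerm ε j z) 0 N 1]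
  congr 1
  refine Finset.sum_congr rfl fun j hj => ?_
  rw [lieTerm_eq ε (Finset.mem_Icc.1 hj).1 hz, extDeriv_eq_altCLM]

theorem waveTensor_gauge (W : Setting) (r : Spacetime) (Λ : ℂ) :
    waveTensor (W.k r) (fun α => W.At r α + Complex.I * (W.k r α : ℂ) * Λ) = W.Ft r := by
  funext α β
  simp only [waveTensor, Ft]
  ring

end Setting

end

section

namespace Setting

variable {W : Setting}

/-! ### The tetrad and the zero-order field -/

/-- Orthonormality gives a left inverse of the tetrad matrix, and for square matrices this is also a
right inverse. -/
theorem tet_complete {r : Spacetime} (hr : r ∈ W.X) (α β : Fin 4) :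
    ∑ a, W.tet a r α * eta a * (eta β * W.tet a r β) = if α = β then 1 else 0 := by
  let T : Matrix (Fin 4) (Fin 4) ℝ := Matrix.of fun α a => W.tet a r α
  let T' : Matrix (Fin 4) (Fin 4) ℝ := Matrix.of fun a β => eta a * (eta β * W.tet a r β)
  have h : T' * T = 1 := by
    ext a b
    have h1 := W.tet_orthonormal r hr a b
    rw [Matrix.mul_apply, Matrix.one_apply]
    have h2 : ∑ j, T' a j * T j b = eta a * mink (W.tet a r) (W.tet b r) := by
      simp only [mink, Finset.mul_sum, T, T', Matrix.of_apply]
      exact Finset.sum_congr rfl fun _ _ => by ring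
    rw [h2, h1]
    split_ifs
    · simp only [eta]; split_ifs <;> norm_num
    · simp
  have h3 := congrFun (congrFun (mul_eq_one_comm.1 h : T * T' = 1) α) β
  rw [Matrix.mul_apply, Matrix.one_apply] at h3
  rw [← h3]
  exact Finset.sum_congr rfl fun _ _ => by simp only [T, T', Matrix.of_apply]; ring

/-- Insert the completeness relation after the field: `ê₀` and `ê₁` are annihilated, and the other
two legs leave a bivector in the plane of gyration. -/
theorem F0_eq_tet {r : Spacetime} (hr : r ∈ W.X) (α β : Fin 4) :
    eta α * eta β * W.F0 r α β =
      lambdaB (W.F0 r) * (W.tet 2 r α * W.tet 3 r β - W.tet 3 r α * W.tet 2 r β) := by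
  have h1 : eta α * eta β * W.F0 r α β =
      eta β * ∑ γ, eta α * W.F0 r α γ * (if γ = β then 1 else 0) := by
    simp; ring
  have h2 : ∑ γ, eta α * W.F0 r α γ * (if γ = β then 1 else 0) =
      ∑ a, mixedApply (W.F0 r) (W.tet a r) α * (eta a * (eta β * W.tet a r β)) := by
    simp only [← tet_complete hr, mixedApply, Finset.mul_sum, Finset.sum_mul]
    rw [Finset.sum_comm]
    exact Finset.sum_congr rfl fun _ _ => Finset.sum_congr rfl fun _ _ => by ring
  have hb : eta β * eta β = 1 := by simp only [eta]; split_ifs <;> norm_num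
  rw [h1, h2, Fin.sum_univ_four]
  simp only [F0, W.F_tet0 r hr, W.F_tet1 r hr, W.F_tet2 r hr, W.F_tet3 r hr, Pi.zero_apply,
    Pi.smul_apply, smul_eq_mul, zero_mul, zero_add]
  rw [show eta 2 = 1 by simp [eta], show eta 3 = 1 by simp [eta]]
  linear_combination (lambdaB (fieldTensor W.A0 r) * (W.tet 2 r α * W.tet 3 r β -
    W.tet 3 r α * W.tet 2 r β)) * hb

theorem contract2_sub_left (u u' v : Spacetime) (T : Fin 4 → Fin 4 → ℂ) :
    contract2 (u - u') T v = contract2 u T v - contract2 u' T v := by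
  simp only [contract2, Pi.sub_apply, ← Finset.sum_sub_distrib]
  push_cast
  exact Finset.sum_congr rfl fun _ _ => Finset.sum_congr rfl fun _ _ => by ring

theorem contract2_add_left (u u' v : Spacetime) (T : Fin 4 → Fin 4 → ℂ) :
    contract2 (u + u') T v = contract2 u T v + contract2 u' T v := by
  simp only [contract2, Pi.add_apply, ← Finset.sum_add_distrib]
  push_cast
  exact Finset.sum_congr rfl fun _ _ => Finset.sum_congr rfl fun _ _ => by ring

theorem contract2_smul_left (c : ℝ) (u v : Spacetime) (T : Fin 4 → Fin 4 → ℂ) :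
    contract2 (c • u) T v = c * contract2 u T v := by
  simp only [contract2, Pi.smul_apply, Finset.mul_sum, smul_eq_mul]
  push_cast
  exact Finset.sum_congr rfl fun _ _ => Finset.sum_congr rfl fun _ _ => by ring

theorem contract2_Ft_self (u : Spacetime) (r : Spacetime) : contract2 u (W.Ft r) u = 0 := by
  rw [Ft, contract2_waveTensor]; ring

theorem doubleContract_F0 {r : Spacetime} (hr : r ∈ W.X) :
    doubleContract (W.F0 r) (W.Ft r) =
      2 * lambdaB (W.F0 r) * contract2 (W.tet 2 r) (W.Ft r) (W.tet 3 r) := by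
  have h : doubleContract (W.F0 r) (W.Ft r) = lambdaB (W.F0 r) *
      (contract2 (W.tet 2 r) (W.Ft r) (W.tet 3 r) -
        contract2 (W.tet 3 r) (W.Ft r) (W.tet 2 r)) := by
    simp only [doubleContract, F0_eq_tet hr, contract2, ← Finset.sum_sub_distrib, Finset.mul_sum]
    push_cast
    exact Finset.sum_congr rfl fun _ _ => Finset.sum_congr rfl fun _ _ => by ring
  rw [h, contract2_Ft_comm (W.tet 3 r)]
  ring

/-! ### Derivatives of the generator -/

theorem fderiv_apply_eq_of_hasDerivAt_line {G : Type*} [NormedAddCommGroup G] [NormedSpace ℝ G]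
    {f : PhaseSpace → G} {z v : PhaseSpace} (hf : DifferentiableAt ℝ f z) {f' : G}
    (h : HasDerivAt (fun t : ℝ => f (z + t • v)) f' 0) : fderiv ℝ f z v = f' :=
  HasDerivAt.unique (hf.hasFDerivAt.hasLineDerivAt v) h

theorem fderiv_gr_vU {z : PhaseSpace} (hz : z ∈ W.dom) (α : Fin 4) :
    fderiv ℝ W.gr z (vU α) = 0 := by
  refine fderiv_apply_eq_of_hasDerivAt_line (differentiableAt_of_contDiffOn W.reg_top.gr hz) ?_
  refine (hasDerivAt_const (0 : ℝ) (W.gr z)).congr_of_eventuallyEq (.of_forall fun t => ?_)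
  simp [gr, rho, aHat, w, vU]

theorem fderiv_gr_vMu {z : PhaseSpace} (hz : z ∈ W.dom) :
    fderiv ℝ W.gr z vMu = -(fderiv ℝ W.rho z vMu) • W.aHat z := by
  refine fderiv_apply_eq_of_hasDerivAt_line (differentiableAt_of_contDiffOn W.reg_top.gr hz) ?_
  have h : HasDerivAt (fun t : ℝ => W.rho (z + t • vMu)) (fderiv ℝ W.rho z vMu) 0 :=
    (differentiableAt_of_contDiffOn W.reg_top.rho hz).hasFDerivAt.hasLineDerivAt vMu
  rw [neg_smul]
  refine (h.smul_const (W.aHat z)).neg.congr_of_eventuallyEq (.of_forall fun t => ?_)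
  simp [gr, aHat, vMu]

theorem fderiv_gr_vTheta {z : PhaseSpace} (hz : z ∈ W.dom) :
    fderiv ℝ W.gr z vTheta = W.rho z •
      (Real.sin z.2.2.2 • W.tet 2 z.1 + Real.cos z.2.2.2 • W.tet 3 z.1) := by
  refine fderiv_apply_eq_of_hasDerivAt_line (differentiableAt_of_contDiffOn W.reg_top.gr hz) ?_
  have h0 : HasDerivAt (fun t : ℝ => z.2.2.2 + t) 1 0 := (hasDerivAt_id 0).const_add _
  have h := (((h0.cos.smul_const (W.tet 2 z.1)).sub
    (h0.sin.smul_const (W.tet 3 z.1))).const_smul (W.rho z)).neg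
  refine (h.congr_deriv ?_).congr_of_eventuallyEq (.of_forall fun t => ?_)
  · simp only [mul_one, add_zero]
    module
  · simp [gr, aHat, rho, w, vTheta]

/-- At fixed `R` and `θ` the vector `g^r` changes with `μ` only in length, and `F̃` is
antisymmetric. -/
theorem contract2_dgrMu {z : PhaseSpace} (hz : z ∈ W.dom) :
    contract2 (fderiv ℝ W.gr z vMu) (W.Ft z.1) (W.gr z) = 0 := by
  rw [fderiv_gr_vMu hz, contract2_smul_left, contract2_Ft_comm, gr, ← neg_smul,
    contract2_smul_left, contract2_Ft_self]
  simp

/-- The vectors `∂g^r/∂θ` and `g^r` differ by a quarter turn in the plane of `ê₂`, `ê₃`, so the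
contraction is `ρ²` times the area component of `F̃`, independent of `θ`. -/
theorem contract2_dgrTheta {z : PhaseSpace} (hz : z ∈ W.dom) :
    contract2 (fderiv ℝ W.gr z vTheta) (W.Ft z.1) (W.gr z) =
      W.rho z ^ 2 * contract2 (W.tet 2 z.1) (W.Ft z.1) (W.tet 3 z.1) := by
  rw [fderiv_gr_vTheta hz, contract2_smul_left, contract2_Ft_comm, gr, ← neg_smul,
    contract2_smul_left, aHat, contract2_sub_left, contract2_smul_left, contract2_smul_left,
    contract2_Ft_comm (W.tet 2 z.1), contract2_Ft_comm (W.tet 3 z.1), contract2_add_left,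
    contract2_add_left, contract2_smul_left, contract2_smul_left, contract2_smul_left,
    contract2_smul_left, contract2_Ft_self, contract2_Ft_self,
    contract2_Ft_comm (W.tet 3 z.1) (W.tet 2 z.1)]
  push_cast
  linear_combination (W.rho z ^ 2 * contract2 (W.tet 2 z.1) (W.Ft z.1) (W.tet 3 z.1) : ℂ) *
    (Complex.sin_sq_add_cos_sq (z.2.2.2 : ℂ))

/-! ### The generating function of the gauge transformation -/

/-- The amplitude of `S_T`, divided by `ε`. -/
def potQ (W : Setting) (z : PhaseSpace) : ℂ := Complex.I * W.f0 z * q1 (W.gk z)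

theorem STc_eq (ε : ℝ) (z : PhaseSpace) : W.STc ε z = ε * (W.eik ε z.1 * W.potQ z) := by
  rw [STc, potQ, f0_eq]; ring

theorem contDiffOn_potQ : ContDiffOn ℝ ∞ W.potQ W.dom :=
  (contDiffOn_const.mul W.reg_top.f0).mul (contDiff_q1.comp_contDiffOn W.reg_top.gk)

/-- The factor `ε` in `S_T` cancels the `1/ε` from the phase, so `dS_T` starts at order one along
`dψ` and at order `ε` elsewhere. -/
theorem fderiv_STc {ε : ℝ} (hε : 0 < ε) {z : PhaseSpace} (hz : z ∈ W.dom) :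
    DifferentiableAt ℝ (W.STc ε) z ∧ ∀ v, fderiv ℝ (W.STc ε) z v =
      W.eik ε z.1 * (Complex.I * W.dpsi z v * W.potQ z + ε * fderiv ℝ W.potQ z v) := by
  have hε' : (ε : ℂ) ≠ 0 := by exact_mod_cast hε.ne'
  have h1 := (differentiableAt_of_contDiffOn (contDiffOn_eik (W := W) ε) hz).hasFDerivAt
  have h2 := (differentiableAt_of_contDiffOn (contDiffOn_potQ (W := W)) hz).hasFDerivAt
  have h3 := (h1.mul h2).const_mul (ε : ℂ)
  have h4 : W.STc ε = fun z => (ε : ℂ) * (W.eik ε z.1 * W.potQ z) := funext (STc_eq ε)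
  rw [h4]
  refine ⟨h3.differentiableAt, fun v => ?_⟩
  refine (DFunLike.congr_fun h3.fderiv v).trans ?_
  rw [fderiv_eik ε hz]
  simp only [_root_.add_apply, _root_.smul_apply, smul_eq_mul]
  field_simp
  ring

theorem extDeriv_ST {ε : ℝ} (hε : 0 < ε) {z : PhaseSpace} (hz : z ∈ W.dom) (v : PhaseSpace) :
    extDeriv (zeroForm (W.ST ε)) z ![v] = cc (W.eik ε z.1 *
      (Complex.I * W.dpsi z v * W.potQ z + ε * fderiv ℝ W.potQ z v)) := by
  have h := fderiv_STc hε hz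
  have h1 : zeroForm (W.ST ε) = fun z => toForm0 PhaseSpace (W.STc ε z) := rfl
  rw [h1, extDeriv_toForm0 h.1, toForm1_apply, ← h.2]
  rfl

theorem fderiv_gk_apply {z : PhaseSpace} (hz : z ∈ W.dom) {v : PhaseSpace} (hv : v.1 = 0) :
    fderiv ℝ (fun y => (W.gk y : ℂ)) z v = dotK (fderiv ℝ W.gr z v) (W.k z.1) := by
  have hk : ∀ β, fderiv ℝ (fun y : PhaseSpace => W.k y.1 β) z v = 0 := fun β => by
    rw [fderiv_comp_fst (contDiffOn_pi.1 W.reg_top.k β) hz, hv, map_zero]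
  have hg := (hasFDerivAt_pi'.1
    (differentiableAt_of_contDiffOn W.reg_top.gr hz).hasFDerivAt)
  have hkd : ∀ β, DifferentiableAt ℝ (fun y : PhaseSpace => W.k y.1 β) z := fun β =>
    differentiableAt_of_contDiffOn (contDiffOn_pi.1 (Reg.comp_fst W.reg_top.k) β) hz
  have h1 : HasFDerivAt W.gk _ z := HasFDerivAt.fun_sum (u := Finset.univ) fun β _ =>
    (hg β).mul (hkd β).hasFDerivAt
  have h2 : HasFDerivAt (fun y => (W.gk y : ℂ)) _ z := Complex.ofRealCLM.hasFDerivAt.comp z h1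
  rw [h2.fderiv]
  simp [sum_apply, hk, dotK, mul_comm]

theorem fderiv_f0_apply {z : PhaseSpace} (hz : z ∈ W.dom) {v : PhaseSpace} (hv : v.1 = 0) :
    fderiv ℝ W.f0 z v = W.alpha z (fderiv ℝ W.g z v) := by
  have h : fderiv ℝ W.alpha z v = 0 := by
    rw [show W.alpha = fun y => W.alphaX y.1 from rfl, fderiv_comp_fst W.reg_top.alphaX hz, hv,
      map_zero]
  have h1 := (differentiableAt_of_contDiffOn W.reg_top.alpha hz).hasFDerivAt.clm_apply
    (differentiableAt_of_contDiffOn W.reg_top.g hz).hasFDerivAt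
  rw [show W.f0 = fun y => W.alpha y (W.g y) from rfl, h1.fderiv]
  simp [h]

/-- The core cancellation. In a vertical direction the derivative splits into a term in `α`, which
removes the gauge-dependent part of the transported form, and a term in `β₀`. It follows from `q1' =
-q2` and `exp(-ix) = i q1 - i x q2`. -/
theorem fderiv_potQ_apply {z : PhaseSpace} (hz : z ∈ W.dom) {v : PhaseSpace} (hv : v.1 = 0) :
    fderiv ℝ W.potQ z v = Complex.exp (-Complex.I * W.gk z) * W.alpha z (fderiv ℝ W.g z v) +
      q2 (W.gk z) * W.beta0 z (fderiv ℝ W.g z v) := by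
  have h1 := (differentiableAt_of_contDiffOn W.reg_top.f0 hz).hasFDerivAt.const_mul Complex.I
  have h2 := (hasDerivAt_q1 (W.gk z)).hasFDerivAt.comp z
    (differentiableAt_of_contDiffOn W.reg_top.gk hz).hasFDerivAt
  have h3 : fderiv ℝ W.potQ z v = _ := DFunLike.congr_fun (h1.mul h2).fderiv v
  have h5 : (fderiv ℝ W.gk z v : ℂ) = dotK (fderiv ℝ W.gr z v) (W.k z.1) := by
    rw [← fderiv_gk_apply hz hv]
    exact (DFunLike.congr_fun (Complex.ofRealCLM.hasFDerivAt.comp z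
      (differentiableAt_of_contDiffOn W.reg_top.gk hz).hasFDerivAt).fderiv v).symm
  rw [h3, exp_eq_q1_q2]
  simp only [_root_.add_apply, _root_.smul_apply, smul_eq_mul, fderiv_f0_apply hz hv, beta0,
    _root_.sub_apply, dpsi_apply, Function.comp_apply, ContinuousLinearMap.comp_apply,
    ContinuousLinearMap.toSpanSingleton_apply, Complex.real_smul, h5, fderiv_g hz]
  ring

end Setting

end

/-! ### The invariant expansion for any transported amplitude. -/

section

namespace Setting

variable {W : Setting}

/-- `G` is the wave one-form amplitude transported by `exp (-ε g)`, to the order needed for the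
invariant expansion. -/
def NearTransport (W : Setting) (K : Set PhaseSpace)
    (G : ℝ → PhaseSpace → PhaseSpace →L[ℝ] ℂ) : Prop :=
  ∃ C : ℝ, ∃ ε₀ > 0, ∀ ε ∈ Ioo (0 : ℝ) ε₀, ∀ z ∈ K, ∃ η : ℂ, ‖η‖ ≤ C * ε ∧
    ‖G ε z - ((1 + η) * (W.eik ε z.1 * Complex.exp (-Complex.I * W.gk z))) •
      (W.alpha z - ε • lieG W W.alpha z)‖ ≤ C * ε ^ 2

theorem norm_exp_neg_I_mul (x : ℝ) : ‖Complex.exp (-Complex.I * x)‖ = 1 := by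
  rw [show -Complex.I * (x : ℂ) = ((-x : ℝ) : ℂ) * Complex.I by push_cast; ring,
    Complex.norm_exp_ofReal_mul_I]

theorem exp_phase_eq {ε : ℝ} (hε : 0 < ε) (z : PhaseSpace) (p : ℂ) :
    Complex.exp (Complex.I / ε * p) = Complex.exp (Complex.I / ε * (p - (W.ψ z.1 - ε * W.gk z))) *
      (W.eik ε z.1 * Complex.exp (-Complex.I * W.gk z)) := by
  have hε' : (ε : ℂ) ≠ 0 := by exact_mod_cast hε.ne'
  rw [eik, ← Complex.exp_add, ← Complex.exp_add]
  congr 1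
  field_simp
  ring

theorem norm_smul_sub_smul (c : ℂ) (x y : PhaseSpace →L[ℝ] ℂ) :
    ‖c • x - c • y‖ = ‖c‖ * ‖x - y‖ := by
  have h : c • x - c • y = c • (x - y) := (smul_sub c x y).symm
  rw [h, norm_smul]

/-- A phase error `𝒪(ε²)` divided by `ε` is a relative error `η = 𝒪(ε)`. Keeping it as a factor
matters: in vertical directions the amplitude is itself `𝒪(ε)`, so the absolute error there is
`𝒪(ε²)`. -/
theorem nearTransport_of_phase {K : Set PhaseSpace} {p : ℝ → PhaseSpace → ℂ}
    {a : ℝ → PhaseSpace → PhaseSpace →L[ℝ] ℂ} {C ε₀ : ℝ} (h0 : 0 < ε₀)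
    (hp : ∀ ε ∈ Ioo (0 : ℝ) ε₀, ∀ z ∈ K, ‖p ε z - (W.ψ z.1 - ε * W.gk z)‖ ≤ C * ε ^ 2)
    (ha : ∀ ε ∈ Ioo (0 : ℝ) ε₀, ∀ z ∈ K, ‖a ε z - (W.alpha z - ε • lieG W W.alpha z)‖ ≤
      C * ε ^ 2) :
    W.NearTransport K fun ε z => Complex.exp (Complex.I / ε * p ε z) • a ε z := by
  -- The second bound on `ε` gives `|C| ε ≤ 1`, so that `‖exp d - 1‖ ≤ 2‖d‖` and `‖exp d‖ ≤ 3`.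
  refine ⟨3 * |C|, min ε₀ (1 / (|C| + 1)), lt_min h0 (by positivity), fun ε hε z hz => ?_⟩
  have hε₀ : ε ∈ Ioo (0 : ℝ) ε₀ := ⟨hε.1, hε.2.trans_le (min_le_left _ _)⟩
  have hεC : |C| * ε ≤ 1 := by
    have h1 := hε.2.le.trans (min_le_right _ _)
    rw [le_div_iff₀ (by positivity)] at h1
    have := hε.1
    linarith
  have h2 := hp ε hε₀ z hz
  set d : ℂ := Complex.I / ε * (p ε z - (W.ψ z.1 - ε * W.gk z)) with hd
  have hd1 : ‖d‖ ≤ |C| * ε := by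
    rw [hd, norm_mul, norm_div, Complex.norm_I, Complex.norm_real, Real.norm_of_nonneg hε.1.le,
      one_div_mul_eq_div, div_le_iff₀ hε.1]
    refine h2.trans ?_
    have := le_abs_self C
    have := hε.1
    rw [mul_assoc, ← pow_two]
    gcongr
  have hd2 := Complex.norm_exp_sub_one_le (hd1.trans hεC)
  refine ⟨Complex.exp d - 1, by have := hε.1; have := abs_nonneg C; nlinarith, ?_⟩
  beta_reduce
  rw [exp_phase_eq (W := W) hε.1 z (p ε z), ← hd, add_sub_cancel, norm_smul_sub_smul, norm_mul, norm_mul,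
    norm_eik, norm_exp_neg_I_mul, mul_one, mul_one]
  have h3 : ‖Complex.exp d‖ ≤ 3 := by
    have := norm_add_le (Complex.exp d - 1) 1
    rw [sub_add_cancel, norm_one] at this
    linarith
  refine (mul_le_mul h3 ((ha ε hε₀ z hz).trans ?_) (norm_nonneg _) (by norm_num)).trans_eq
    (mul_assoc _ _ _).symm
  have := le_abs_self C
  gcongr

theorem primeR_eq (ε : ℝ) (z : PhaseSpace) (β : Fin 4) :
    W.primeR (W.Ft z.1) ε z β =
      -Complex.I * q1 (W.gk z) * W.beta0 z (vR β) * W.eik ε z.1 := by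
  have h1 : W.rak z = -W.gk z := by
    simp only [rak, gk, dotK, gr, Finset.mul_sum, ← Finset.sum_neg_distrib, Pi.neg_apply,
      Pi.smul_apply, smul_eq_mul]
    exact Finset.sum_congr rfl fun _ _ => by ring
  have h2 : contract1 (W.gr z) (W.Ft z.1) β = -(W.rho z * contract1 (W.aHat z) (W.Ft z.1) β) := by
    simp only [contract1, gr, Finset.mul_sum, ← Finset.sum_neg_distrib, Pi.neg_apply,
      Pi.smul_apply, smul_eq_mul]
    push_cast
    exact Finset.sum_congr rfl fun _ _ => by ring
  rw [primeR, h1, p1_neg, beta0_vR, h2]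
  ring

theorem primeTheta_eq (ε : ℝ) {z : PhaseSpace} (hz : z ∈ W.dom) :
    W.primeTheta (W.Ft z.1) ε z =
      ε * q2 (W.gk z) * W.beta0 z (fderiv ℝ W.g z vTheta) * W.eik ε z.1 := by
  have h1 : W.rak z = -W.gk z := by
    simp only [rak, gk, dotK, gr, Finset.mul_sum, ← Finset.sum_neg_distrib, Pi.neg_apply,
      Pi.smul_apply, smul_eq_mul]
    exact Finset.sum_congr rfl fun _ _ => by ring
  have hl : (lambdaB (W.F0 z.1) : ℂ) ≠ 0 := by exact_mod_cast (W.lambdaB_pos z.1 hz.1).ne'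
  have hc : (W.c : ℂ) ≠ 0 := by exact_mod_cast W.c_pos.ne'
  rw [primeTheta, h1, p2_neg, beta0_fderiv_g hz, contract2_dgrTheta hz, doubleContract_F0 hz.1]
  field_simp

/-- `Γ'_w` in terms of the complex amplitude of `Γ_w`. -/
theorem gaugeTransform_apply {Γ : ℝ → OneForm} {ε : ℝ} (hε : 0 < ε) {z : PhaseSpace}
    (hz : z ∈ W.dom) {G : PhaseSpace →L[ℝ] ℂ} (hΓ : Γ ε z = toForm1 PhaseSpace G)
    (v : PhaseSpace) : W.gaugeTransform Γ ε z ![v] = cc (G v + W.eik ε z.1 *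
      (Complex.I * W.dpsi z v * W.potQ z + ε * fderiv ℝ W.potQ z v)) := by
  rw [gaugeTransform, ContinuousAlternatingMap.add_apply, hΓ, toForm1_apply, extDeriv_ST hε hz,
    cc_add]
  rfl

/-- Nothing about the origin of `Γ` is used beyond its amplitude being nearly transported, so this
serves both the flow and the Lie series. -/
theorem hasInvariantExpansion {K : Set PhaseSpace} (hK : IsCompact K) (hKd : K ⊆ W.dom)
    {G : ℝ → PhaseSpace → PhaseSpace →L[ℝ] ℂ} (hG : W.NearTransport K G) {Γ : ℝ → OneForm}
    {ε₁ : ℝ} (h₁ : 0 < ε₁)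
    (hΓ : ∀ ε ∈ Ioo (0 : ℝ) ε₁, ∀ z ∈ K, Γ ε z = toForm1 PhaseSpace (G ε z)) :
    W.HasInvariantExpansion (W.gaugeTransform Γ) K := by
  obtain ⟨C, ε₀, h₀, hC⟩ := hG
  obtain ⟨A, hA⟩ := hK.exists_bound_of_continuousOn (W.reg_top.alpha.continuousOn.mono hKd)
  obtain ⟨L, hL⟩ := hK.exists_bound_of_continuousOn
    ((contDiffOn_lop W.isOpen_dom g_contDiffOn W.reg_top.formMul
      W.reg_top.alpha).continuousOn.mono hKd)
  obtain ⟨Q, hQ⟩ := hK.exists_bound_of_continuousOn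
    ((contDiffOn_potQ.continuousOn_fderiv_of_isOpen W.isOpen_dom (by simp)).mono hKd)
  have hε₂ : 0 < min (min ε₀ ε₁) 1 := lt_min (lt_min h₀ h₁) one_pos
  have hmem : ∀ ε ∈ Ioo (0 : ℝ) (min (min ε₀ ε₁) 1),
      ε ∈ Ioo 0 ε₀ ∧ ε ∈ Ioo 0 ε₁ ∧ ε < 1 := fun ε hε =>
    ⟨⟨hε.1, hε.2.trans_le ((min_le_left _ _).trans (min_le_left _ _))⟩,
      ⟨hε.1, hε.2.trans_le ((min_le_left _ _).trans (min_le_right _ _))⟩,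
      hε.2.trans_le (min_le_right _ _)⟩
  have hnorm : ∀ (ε : ℝ) (z : PhaseSpace) (x : ℂ),
      ‖W.eik ε z.1 * Complex.exp (-Complex.I * W.gk z) * x‖ = ‖x‖ := fun ε z x => by
    rw [norm_mul, norm_mul, norm_eik, norm_exp_neg_I_mul, one_mul, one_mul]
  have vert : ∀ v : PhaseSpace, v.1 = 0 → UnifO K 2 fun ε z =>
      W.gaugeTransform Γ ε z ![v] -
        cc (ε * q2 (W.gk z) * W.beta0 z (fderiv ℝ W.g z v) * W.eik ε z.1) := fun v hv => by
    refine UnifO.of_cc (C := (C * L + C) * ‖v‖) hε₂ (a := fun ε z => (G ε z v + W.eik ε z.1 *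
      (Complex.I * W.dpsi z v * W.potQ z + ε * fderiv ℝ W.potQ z v)) -
      ε * q2 (W.gk z) * W.beta0 z (fderiv ℝ W.g z v) * W.eik ε z.1) ?_ ?_
    · intro ε hε z hz
      obtain ⟨m₀, m₁, hε1⟩ := hmem ε hε
      obtain ⟨η, hη, hr⟩ := hC ε m₀ z hz
      have hr' := ContinuousLinearMap.le_of_opNorm_le _ hr v
      rw [_root_.sub_apply, _root_.smul_apply, _root_.sub_apply, _root_.smul_apply,
        horizontal_alpha z (hKd hz) v hv] at hr'
      have hLv := ContinuousLinearMap.le_of_opNorm_le _ (hL z hz) v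
      have hval := lop_apply_of_horizontal W.reg_top.alpha horizontal_alpha (hKd hz) hv
      rw [hval] at hr' hLv
      rw [dpsi_apply, hv, show dotK 0 (W.k z.1) = 0 by simp [dotK],
        fderiv_potQ_apply (hKd hz) hv]
      set R := G ε z v - ((1 + η) * (W.eik ε z.1 * Complex.exp (-Complex.I * W.gk z))) •
        (0 - ε • W.alpha z (fderiv ℝ W.g z v)) with hR
      -- The term `-ε exp(-ix) α(∂g)` of the transport cancels against `dS_T`; the remainder and `η`
      -- times a quantity of order `ε` are left.
      have e : G ε z v + W.eik ε z.1 * (Complex.I * ((0 : ℝ) : ℂ) * W.potQ z + ε *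
          (Complex.exp (-Complex.I * W.gk z) * W.alpha z (fderiv ℝ W.g z v) +
            q2 (W.gk z) * W.beta0 z (fderiv ℝ W.g z v))) -
          ε * q2 (W.gk z) * W.beta0 z (fderiv ℝ W.g z v) * W.eik ε z.1 =
          R - W.eik ε z.1 * Complex.exp (-Complex.I * W.gk z) *
            (η * (ε * W.alpha z (fderiv ℝ W.g z v))) := by
        rw [hR]
        simp only [smul_eq_mul, Complex.real_smul]
        push_cast
        ring
      rw [e]
      refine (norm_sub_le _ _).trans ?_
      rw [hnorm, norm_mul, norm_mul, Complex.norm_real, Real.norm_of_nonneg hε.1.le]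
      have hCε := (norm_nonneg _).trans hη
      have h3 : ‖η‖ * (ε * ‖W.alpha z (fderiv ℝ W.g z v)‖) ≤ C * ε * (ε * (L * ‖v‖)) := by
        have := hε.1.le
        gcongr
      have : ((C * L + C) * ‖v‖) * ε ^ (2 : ℤ) = C * ε ^ 2 * ‖v‖ + C * ε * (ε * (L * ‖v‖)) := by
        rw [zpow_ofNat]; ring
      rw [this]
      exact add_le_add hr' h3
    · intro ε hε z hz
      rw [gaugeTransform_apply hε.1 (hKd hz) (hΓ ε (hmem ε hε).2.1 z hz), cc_sub]
  refine ⟨fun β => ?_, ?_, ?_, fun β => ?_⟩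
  · have hv : ‖vR β‖ = ‖vR β‖ := rfl
    set v := vR β
    refine UnifO.of_cc (C := (|C| * A + (1 + |C|) * L + |C| + Q) * ‖v‖) hε₂
      (a := fun ε z => (G ε z v + W.eik ε z.1 *
      (Complex.I * W.dpsi z v * W.potQ z + ε * fderiv ℝ W.potQ z v)) -
      (W.alpha z v * W.eik ε z.1 -
        Complex.I * q1 (W.gk z) * W.beta0 z v * W.eik ε z.1)) ?_ ?_
    · intro ε hε z hz
      obtain ⟨m₀, m₁, hε1⟩ := hmem ε hε
      obtain ⟨η, hη, hr⟩ := hC ε m₀ z hz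
      have hr' := ContinuousLinearMap.le_of_opNorm_le _ hr v
      rw [_root_.sub_apply, _root_.smul_apply, _root_.sub_apply, _root_.smul_apply] at hr'
      have hLv := ContinuousLinearMap.le_of_opNorm_le _ (hL z hz) v
      have hAv := ContinuousLinearMap.le_of_opNorm_le _ (hA z hz) v
      have hQv := ContinuousLinearMap.le_of_opNorm_le _ (hQ z hz) v
      set R := G ε z v - ((1 + η) * (W.eik ε z.1 * Complex.exp (-Complex.I * W.gk z))) •
        (W.alpha z v - ε • lieG W W.alpha z v) with hR
      -- With `exp(-ix) = 1 + x q1`, the term `x q1 α` joins the `dψ` term of `dS_T` to form `-i q1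
      -- β₀`.
      have e : (G ε z v + W.eik ε z.1 *
          (Complex.I * W.dpsi z v * W.potQ z + ε * fderiv ℝ W.potQ z v)) -
          (W.alpha z v * W.eik ε z.1 - Complex.I * q1 (W.gk z) * W.beta0 z v * W.eik ε z.1) =
          R + W.eik ε z.1 * Complex.exp (-Complex.I * W.gk z) *
            (η * W.alpha z v - (1 + η) * (ε * lieG W W.alpha z v)) +
            W.eik ε z.1 * (ε * fderiv ℝ W.potQ z v) := by
        rw [hR, exp_eq_q1]
        simp only [smul_eq_mul, Complex.real_smul, beta0, potQ, _root_.smul_apply,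
          _root_.sub_apply]
        linear_combination
          (W.eik ε z.1 * q1 (W.gk z) * W.gk z * W.alpha z v) * Complex.I_sq
      rw [e]
      have hC0 : C * ε ≤ |C| * ε := by have := hε.1; have := le_abs_self C; gcongr
      have hη' := hη.trans hC0
      have hη1 : ‖1 + η‖ ≤ 1 + |C| := (norm_add_le _ _).trans (by
        rw [norm_one]
        have := mul_le_mul_of_nonneg_left hε1.le (abs_nonneg C)
        linarith)
      have n1 : ‖R‖ ≤ |C| * ε * ‖v‖ := by
        refine hr'.trans (mul_le_mul_of_nonneg_right ?_ (norm_nonneg _))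
        have h1 : ε ^ 2 ≤ ε := by nlinarith [hε.1]
        calc C * ε ^ 2 ≤ |C| * ε ^ 2 := by have := le_abs_self C; gcongr
          _ ≤ |C| * ε := by gcongr
      have n2 : ‖η * W.alpha z v - (1 + η) * (ε * lieG W W.alpha z v)‖ ≤
          |C| * ε * (A * ‖v‖) + (1 + |C|) * (ε * (L * ‖v‖)) := by
        refine (norm_sub_le _ _).trans ?_
        rw [norm_mul, norm_mul, norm_mul, Complex.norm_real, Real.norm_of_nonneg hε.1.le]
        have := hε.1.le
        gcongr
      have n3 : ‖W.eik ε z.1 * (ε * fderiv ℝ W.potQ z v)‖ ≤ ε * (Q * ‖v‖) := by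
        rw [norm_mul, norm_mul, norm_eik, one_mul, Complex.norm_real,
          Real.norm_of_nonneg hε.1.le]
        have := hε.1.le
        gcongr
      refine (norm_add₃_le).trans ?_
      rw [hnorm, zpow_one]
      nlinarith
    · intro ε hε z hz
      rw [gaugeTransform_apply hε.1 (hKd hz) (hΓ ε (hmem ε hε).2.1 z hz), cc_sub, primeR_eq,
        alpha_apply]
      congr 2
      have : dotA (vR β).1 (W.At z.1) = W.At z.1 β := by
        rw [dotA, Finset.sum_eq_single β]
        · simp [vR]
        · intro b _ hb; simp [vR, hb]
        · simp
      rw [this]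
      ring
  · have h := vert vTheta rfl
    obtain ⟨D, ε₃, h₃, hD⟩ := h
    refine ⟨D, ε₃, h₃, fun ε hε z hz => ?_⟩
    beta_reduce
    rw [primeTheta_eq ε (hKd hz)]
    exact hD ε hε z hz
  · obtain ⟨D, ε₃, h₃, hD⟩ := vert vMu rfl
    refine ⟨D, ε₃, h₃, fun ε hε z hz => ?_⟩
    have := hD ε hε z hz
    beta_reduce at this ⊢
    rw [beta0_fderiv_g (hKd hz), contract2_dgrMu (hKd hz)] at this
    simpa [cc] using this
  · obtain ⟨D, ε₃, h₃, hD⟩ := vert (vU β) rfl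
    refine ⟨D, ε₃, h₃, fun ε hε z hz => ?_⟩
    have := hD ε hε z hz
    beta_reduce at this ⊢
    -- The generator does not depend on `U`, so the invariant term vanishes.
    rw [fderiv_g (hKd hz), fderiv_gr_vU (hKd hz), horizontal_beta0 z (hKd hz) _ rfl] at this
    simpa [cc] using this

end Setting

end

/-! ### Transport along a smooth flow. -/

section

/-- First-order Taylor estimate. -/
theorem norm_sub_taylor_le {F : Type*} [NormedAddCommGroup F] [NormedSpace ℝ F]
    {f f₁ f₂ : ℝ → F} {C ε : ℝ} (hε : 0 ≤ ε)
    (h₁ : ∀ t ∈ Icc (-ε) 0, HasDerivAt f (f₁ t) t)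
    (h₂ : ∀ t ∈ Icc (-ε) 0, HasDerivAt f₁ (f₂ t) t) (hC : ∀ t ∈ Icc (-ε) 0, ‖f₂ t‖ ≤ C) :
    ‖f (-ε) - (f 0 - ε • f₁ 0)‖ ≤ C * ε ^ 2 := by
  have m0 : (0 : ℝ) ∈ Icc (-ε) 0 := ⟨by linarith, le_rfl⟩
  have mε : -ε ∈ Icc (-ε) 0 := ⟨le_rfl, by linarith⟩
  have hC0 : 0 ≤ C := (norm_nonneg _).trans (hC 0 m0)
  have e1 : ∀ t ∈ Icc (-ε) 0, ‖f₁ t - f₁ 0‖ ≤ C * ε := fun t ht => by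
    refine ((convex_Icc (-ε) 0).norm_image_sub_le_of_norm_hasDerivWithin_le
      (fun x hx => (h₂ x hx).hasDerivWithinAt) hC m0 ht).trans ?_
    gcongr
    rw [Real.norm_eq_abs, abs_le]
    constructor <;> linarith [ht.1, ht.2]
  have e2 := (convex_Icc (-ε) 0).norm_image_sub_le_of_norm_hasDerivWithin_le
    (f := fun t => f t - t • f₁ 0) (f' := fun t => f₁ t - f₁ 0) (fun x hx => by
      simpa using ((h₁ x hx).fun_sub ((hasDerivAt_id x).smul_const (f₁ 0))).hasDerivWithinAt) e1 m0 mε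
  have e3 : f (-ε) - (-ε) • f₁ 0 - (f 0 - (0 : ℝ) • f₁ 0) = f (-ε) - (f 0 - ε • f₁ 0) := by module
  rw [e3] at e2
  refine e2.trans_eq ?_
  rw [sub_zero, norm_neg, Real.norm_of_nonneg hε]
  ring

section Flow

variable {E : Type*} [NormedAddCommGroup E] [NormedSpace ℝ E] {g : E → E} {D S : Set E} {δ : ℝ}
  {φ : ℝ → E → E}

theorem IsLocalFlow.isOpen (h : IsLocalFlow g D S δ φ) : IsOpen (Ioo (-δ) δ ×ˢ S) :=
  isOpen_Ioo.prod h.2.1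

theorem IsLocalFlow.subset (h : IsLocalFlow g D S δ φ) : S ⊆ D := fun x hx => by
  have h0 : (0 : ℝ) ∈ Ioo (-δ) δ := ⟨neg_lt_zero.2 h.1, h.1⟩
  have := (h.2.2.2.2 0 h0 x hx).1
  rwa [h.2.2.2.1 x hx] at this

theorem IsLocalFlow.hasFDerivAt (h : IsLocalFlow g D S δ φ) {t : ℝ} (ht : t ∈ Ioo (-δ) δ) {x : E}
    (hx : x ∈ S) : HasFDerivAt (fun p : ℝ × E => φ p.1 p.2)
      (fderiv ℝ (fun p : ℝ × E => φ p.1 p.2) (t, x)) (t, x) :=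
  (h.2.2.1.differentiableAt_of_isOpen h.isOpen ⟨ht, hx⟩).hasFDerivAt

theorem IsLocalFlow.hasFDerivAt_right (h : IsLocalFlow g D S δ φ) {t : ℝ} (ht : t ∈ Ioo (-δ) δ)
    {x : E} (hx : x ∈ S) : HasFDerivAt (φ t)
      ((fderiv ℝ (fun p : ℝ × E => φ p.1 p.2) (t, x)).comp (ContinuousLinearMap.inr ℝ ℝ E)) x :=
  (h.hasFDerivAt ht hx).comp x (hasFDerivAt_prodMk_right t x)

theorem IsLocalFlow.fderiv_apply_one (h : IsLocalFlow g D S δ φ) {t : ℝ} (ht : t ∈ Ioo (-δ) δ)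
    {x : E} (hx : x ∈ S) :
    fderiv ℝ (fun p : ℝ × E => φ p.1 p.2) (t, x) (1, 0) = g (φ t x) := by
  have h1 := ((h.hasFDerivAt ht hx).comp t (hasFDerivAt_prodMk_left t x)).hasDerivAt
  exact h1.unique (h.2.2.2.2 t ht x hx).2

/-- The variational equation: exchange the time and space derivatives of the flow, then
differentiate `∂φ/∂t = g ∘ φ` in space. -/
theorem IsLocalFlow.hasDerivAt_fderiv (h : IsLocalFlow g D S δ φ) {t : ℝ}
    (ht : t ∈ Ioo (-δ) δ) {x : E} (hx : x ∈ S) (hg : DifferentiableAt ℝ g (φ t x)) :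
    HasDerivAt (fun s => fderiv ℝ (φ s) x) ((fderiv ℝ g (φ t x)).comp (fderiv ℝ (φ t) x)) t := by
  set Φ : ℝ × E → E := fun p => φ p.1 p.2 with hΦ
  have hΦ2 : ContDiffAt ℝ ∞ Φ (t, x) := h.2.2.1.contDiffAt (h.isOpen.mem_nhds ⟨ht, hx⟩)
  have hd : HasFDerivAt (fderiv ℝ Φ) (fderiv ℝ (fderiv ℝ Φ) (t, x)) (t, x) :=
    ((hΦ2.fderiv_right (m := ∞) (by simp)).differentiableAt (by simp)).hasFDerivAt
  -- Symmetry of the second derivative on time and space together is what permits the exchange.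
  have hsymm : IsSymmSndFDerivAt ℝ Φ (t, x) := hΦ2.isSymmSndFDerivAt (by
    rw [minSmoothness_of_isRCLikeNormedField]
    exact WithTop.coe_le_coe.2 (le_top (a := (2 : ℕ∞))))
  have h1 : HasDerivAt (fun s => fderiv ℝ Φ (s, x)) (fderiv ℝ (fderiv ℝ Φ) (t, x) (1, 0)) t :=
    HasFDerivAt.comp_hasDerivAt (l := fderiv ℝ Φ) (f := fun s : ℝ => (s, x)) t hd
      ((hasDerivAt_id t).prodMk (hasDerivAt_const t x))
  have hR : HasFDerivAt (fun ξ : ℝ × E →L[ℝ] E => ξ.comp (ContinuousLinearMap.inr ℝ ℝ E))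
      ((ContinuousLinearMap.compL ℝ E (ℝ × E) E).flip (ContinuousLinearMap.inr ℝ ℝ E))
      (fderiv ℝ Φ (t, x)) :=
    ContinuousLinearMap.hasFDerivAt (F := E →L[ℝ] E)
      ((ContinuousLinearMap.compL ℝ E (ℝ × E) E).flip (ContinuousLinearMap.inr ℝ ℝ E))
  have h2 : HasDerivAt (fun s => (fderiv ℝ Φ (s, x)).comp (ContinuousLinearMap.inr ℝ ℝ E))
      ((fderiv ℝ (fderiv ℝ Φ) (t, x) (1, 0)).comp (ContinuousLinearMap.inr ℝ ℝ E)) t :=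
    HasFDerivAt.comp_hasDerivAt (l := fun ξ : ℝ × E →L[ℝ] E =>
      ξ.comp (ContinuousLinearMap.inr ℝ ℝ E)) (f := fun s => fderiv ℝ Φ (s, x)) t hR h1
  have h3 : (fun s => fderiv ℝ (φ s) x) =ᶠ[nhds t]
      fun s => (fderiv ℝ Φ (s, x)).comp (ContinuousLinearMap.inr ℝ ℝ E) :=
    Filter.eventually_of_mem (isOpen_Ioo.mem_nhds ht) fun s hs => (h.hasFDerivAt_right hs hx).fderiv
  refine (h2.congr_of_eventuallyEq h3).congr_deriv ?_
  have h4 : HasFDerivAt (fun y => fderiv ℝ Φ (t, y) (1, 0))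
      (((fderiv ℝ (fderiv ℝ Φ) (t, x)).comp (ContinuousLinearMap.inr ℝ ℝ E)).flip (1, 0)) x := by
    have := (hd.comp x (hasFDerivAt_prodMk_right t x)).clm_apply
      (hasFDerivAt_const ((1, 0) : ℝ × E) x)
    refine this.congr_fderiv ?_
    ext v
    simp
  have h5 : (fun y => g (φ t y)) =ᶠ[nhds x] fun y => fderiv ℝ Φ (t, y) (1, 0) :=
    Filter.eventually_of_mem (h.2.1.mem_nhds hx) fun y hy => (h.fderiv_apply_one ht hy).symm
  have h6 := (h4.congr_of_eventuallyEq h5).unique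
    (hg.hasFDerivAt.comp x (h.hasFDerivAt_right ht hx))
  ext v
  have h7 := DFunLike.congr_fun h6 v
  rw [(h.hasFDerivAt_right ht hx).fderiv]
  have h8 := hsymm.eq (1, 0) (0, v)
  simp only [ContinuousLinearMap.comp_apply, ContinuousLinearMap.inr_apply,
    ContinuousLinearMap.flip_apply] at h7 ⊢
  rw [h8, h7]

/-- The pull-back of a complex covector field under the flow. -/
def pullCov (φ : ℝ → E → E) (t : ℝ) (σ : E → E →L[ℝ] ℂ) (x : E) : E →L[ℝ] ℂ :=
  (σ (φ t x)).comp (fderiv ℝ (φ t) x)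

theorem pullback_toForm1 (t : ℝ) (σ : E → E →L[ℝ] ℂ) (x : E) :
    pullback (φ t) (fun y => toForm1 E (σ y)) x = toForm1 E (pullCov φ t σ x) := by
  ext v
  rw [pullback, ContinuousAlternatingMap.compContinuousLinearMap_apply, toForm1_apply,
    toForm1_apply]
  rfl

theorem IsLocalFlow.hasDerivAt_comp {F : Type*} [NormedAddCommGroup F] [NormedSpace ℝ F]
    (h : IsLocalFlow g D S δ φ) (hD : IsOpen D) {f : E → F} (hf : ContDiffOn ℝ ∞ f D) {t : ℝ}
    (ht : t ∈ Ioo (-δ) δ) {x : E} (hx : x ∈ S) :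
    HasDerivAt (fun s => f (φ s x)) (lop g 0 f (φ t x)) t := by
  have h1 := h.2.2.2.2 t ht x hx
  rw [lop_zero_apply]
  exact (hf.differentiableAt_of_isOpen hD h1.1).hasFDerivAt.comp_hasDerivAt t h1.2

/-- The derivative of a pull-back along the flow is the pull-back of the Lie derivative, at every
time; this makes iteration possible. -/
theorem IsLocalFlow.hasDerivAt_pullCov (h : IsLocalFlow g D S δ φ) (hD : IsOpen D)
    (hg : ContDiffOn ℝ ∞ g D) {σ : E → E →L[ℝ] ℂ} (hσ : ContDiffOn ℝ ∞ σ D) {t : ℝ}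
    (ht : t ∈ Ioo (-δ) δ) {x : E} (hx : x ∈ S) :
    HasDerivAt (fun s => pullCov φ s σ x) (pullCov φ t (lop g (formMul ℂ g) σ) x) t := by
  have h1 := h.2.2.2.2 t ht x hx
  have h2 : HasDerivAt (fun s => σ (φ s x)) (fderiv ℝ σ (φ t x) (g (φ t x))) t :=
    (hσ.differentiableAt_of_isOpen hD h1.1).hasFDerivAt.comp_hasDerivAt t h1.2
  have h3 := h.hasDerivAt_fderiv ht hx (hg.differentiableAt_of_isOpen hD h1.1)
  refine (h2.clm_comp h3).congr_deriv ?_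
  ext v
  rfl

theorem IsLocalFlow.pullCov_zero (h : IsLocalFlow g D S δ φ) (σ : E → E →L[ℝ] ℂ) {x : E}
    (hx : x ∈ S) : pullCov φ 0 σ x = σ x := by
  have h1 : φ 0 =ᶠ[nhds x] id := Filter.eventually_of_mem (h.2.1.mem_nhds hx) h.2.2.2.1
  rw [pullCov, h1.fderiv_eq, h.2.2.2.1 x hx, fderiv_id]
  rfl

theorem IsLocalFlow.iteratedDeriv_pullCov (h : IsLocalFlow g D S δ φ) (hD : IsOpen D)
    (hg : ContDiffOn ℝ ∞ g D) {σ : E → E →L[ℝ] ℂ} (hσ : ContDiffOn ℝ ∞ σ D) {x : E} (hx : x ∈ S)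
    (j : ℕ) {s : ℝ} (hs : s ∈ Ioo (-δ) δ) :
    iteratedDeriv j (fun s => toForm1 E (pullCov φ (-s) σ x)) s =
      (-1 : ℝ) ^ j • toForm1 E (pullCov φ (-s) ((lop g (formMul ℂ g))^[j] σ) x) := by
  induction j generalizing s with
  | zero => simp
  | succ j ih =>
    have h1 : iteratedDeriv j (fun s => toForm1 E (pullCov φ (-s) σ x)) =ᶠ[nhds s] fun s =>
        (-1 : ℝ) ^ j • toForm1 E (pullCov φ (-s) ((lop g (formMul ℂ g))^[j] σ) x) :=
      Filter.eventually_of_mem (isOpen_Ioo.mem_nhds hs) fun s hs => ih hs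
    have hs' : -s ∈ Ioo (-δ) δ := ⟨neg_lt_neg hs.2, by linarith [hs.1]⟩
    have h2 := h.hasDerivAt_pullCov hD hg (contDiffOn_lop_iterate hD hg
      (contDiffOn_formMul (G := ℂ) hD hg (by simp)) hσ j) hs' hx
    have h3 := h2.scomp s (hasDerivAt_neg s)
    have h4 := ((toForm1 E).hasFDerivAt.comp_hasDerivAt s h3).const_smul ((-1 : ℝ) ^ j)
    rw [iteratedDeriv_succ, h1.deriv_eq]
    refine h4.deriv.trans ?_
    rw [Function.iterate_succ_apply', pow_succ, mul_smul, map_smul]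

theorem IsLocalFlow.continuousOn_flow (h : IsLocalFlow g D S δ φ) {δ' : ℝ} (hδ' : δ' < δ)
    {K : Set E} (hK : K ⊆ S) :
    ContinuousOn (fun p : ℝ × E => φ p.1 p.2) (Icc (-δ') 0 ×ˢ K) ∧
    MapsTo (fun p : ℝ × E => φ p.1 p.2) (Icc (-δ') 0 ×ˢ K) D ∧
    ContinuousOn (fun p : ℝ × E => fderiv ℝ (φ p.1) p.2) (Icc (-δ') 0 ×ˢ K) := by
  have hsub : Icc (-δ') 0 ×ˢ K ⊆ Ioo (-δ) δ ×ˢ S := fun p hp =>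
    ⟨⟨by linarith [hp.1.1], hp.1.2.trans_lt h.1⟩, hK hp.2⟩
  refine ⟨h.2.2.1.continuousOn.mono hsub, fun p hp => (h.2.2.2.2 _ (hsub hp).1 _ (hsub hp).2).1, ?_⟩
  have h1 : ContinuousOn (fderiv ℝ fun p : ℝ × E => φ p.1 p.2) (Icc (-δ') 0 ×ˢ K) :=
    (h.2.2.1.continuousOn_fderiv_of_isOpen h.isOpen (by simp)).mono hsub
  refine (h1.clm_comp (continuousOn_const (c := ContinuousLinearMap.inr ℝ ℝ E))).congr
    fun p hp => ?_
  exact (h.hasFDerivAt_right (hsub hp).1 (hsub hp).2).fderiv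

end Flow

namespace Setting

variable {W : Setting} {S : Set PhaseSpace} {δ : ℝ} {φ : ℝ → PhaseSpace → PhaseSpace}

theorem pullback_gammaW (ε t : ℝ) (z : PhaseSpace) :
    pullback (φ t) (W.gammaW ε) z = toForm1 PhaseSpace
      (pullCov φ t (fun y : PhaseSpace => W.eik ε y.1 • W.alpha y) z) := by
  rw [gammaW_eq, pullback_toForm1]

theorem iteratedDeriv_pullback_gammaW (h : IsLocalFlow W.g W.dom S δ φ) (ε : ℝ) {z : PhaseSpace}
    (hz : z ∈ S) (j : ℕ) : iteratedDeriv j (fun s => pullback (φ (-s)) (W.gammaW ε) z) 0 =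
      (-1 : ℝ) ^ j • (lieDeriv W.g)^[j] (W.gammaW ε) z := by
  simp only [pullback_gammaW]
  rw [h.iteratedDeriv_pullCov W.isOpen_dom g_contDiffOn (contDiffOn_eik_smul_alpha ε) hz j
    ⟨neg_lt_zero.2 h.1, h.1⟩, neg_zero, h.pullCov_zero _ hz,
    lieDeriv_iterate_gammaW ε j (h.subset hz)]

/-- Phase and amplitude are expanded separately to second order, since differentiating `exp(iψ/ε)`
would cost a factor `1/ε` each time. -/
theorem nearTransport_flow (h : IsLocalFlow W.g W.dom S δ φ) {K : Set PhaseSpace}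
    (hK : IsCompact K) (hKS : K ⊆ S) : W.NearTransport K fun ε z =>
      pullCov φ (-ε) (fun y : PhaseSpace => W.eik ε y.1 • W.alpha y) z := by
  have hδ := h.1
  obtain ⟨c1, c2, c3⟩ := h.continuousOn_flow (half_lt_self hδ) hKS
  -- On this compact set of times and points the second derivatives along the flow are bounded; half
  -- of `δ` keeps the times inside the interval of existence.
  have hKc : IsCompact (Icc (-(δ / 2)) 0 ×ˢ K) := isCompact_Icc.prod hK
  have s1 : ContDiffOn ℝ ∞ (lop W.g 0 W.psiC) W.dom :=
    contDiffOn_lop W.isOpen_dom g_contDiffOn contDiffOn_zeroMul W.reg_top.psiC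
  have s2 : ContDiffOn ℝ ∞ (lop W.g 0 (lop W.g 0 W.psiC)) W.dom :=
    contDiffOn_lop W.isOpen_dom g_contDiffOn contDiffOn_zeroMul s1
  have a1 : ContDiffOn ℝ ∞ (lieG W W.alpha) W.dom :=
    contDiffOn_lop W.isOpen_dom g_contDiffOn W.reg_top.formMul W.reg_top.alpha
  have a2 : ContDiffOn ℝ ∞ (lieG W (lieG W W.alpha)) W.dom :=
    contDiffOn_lop W.isOpen_dom g_contDiffOn W.reg_top.formMul a1
  obtain ⟨C₁, hC₁⟩ := hKc.exists_bound_of_continuousOn (s2.continuousOn.comp c1 c2)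
  obtain ⟨C₂, hC₂⟩ := hKc.exists_bound_of_continuousOn ((a2.continuousOn.comp c1 c2).clm_comp c3)
  have htm : ∀ ε ∈ Ioo 0 (δ / 2), ∀ t ∈ Icc (-ε) 0, t ∈ Ioo (-δ) δ ∧ t ∈ Icc (-(δ / 2)) 0 :=
    fun ε hε t ht => ⟨⟨by linarith [hε.2, ht.1], by linarith [ht.2]⟩,
      ⟨by linarith [hε.2, ht.1], ht.2⟩⟩
  have key := nearTransport_of_phase (W := W) (K := K) (C := max C₁ C₂) (half_pos hδ)
    (p := fun ε z => W.psiC (φ (-ε) z)) (a := fun ε z => pullCov φ (-ε) W.alpha z) ?_ ?_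
  · exact key
  · intro ε hε z hz
    have h1 := norm_sub_taylor_le (f := fun t => W.psiC (φ t z)) hε.1.le
      (fun t ht => h.hasDerivAt_comp W.isOpen_dom W.reg_top.psiC (htm ε hε t ht).1 (hKS hz))
      (fun t ht => h.hasDerivAt_comp W.isOpen_dom s1 (htm ε hε t ht).1 (hKS hz))
      (fun t ht => hC₁ (t, z) ⟨(htm ε hε t ht).2, hz⟩)
    rw [h.2.2.2.1 z (hKS hz), lop_psiC (h.subset (hKS hz)), Complex.real_smul] at h1
    exact h1.trans (by gcongr; exact le_max_left _ _)
  · intro ε hε z hz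
    have h1 := norm_sub_taylor_le (f := fun t => pullCov φ t W.alpha z) hε.1.le
      (fun t ht => h.hasDerivAt_pullCov W.isOpen_dom g_contDiffOn W.reg_top.alpha
        (htm ε hε t ht).1 (hKS hz))
      (fun t ht => h.hasDerivAt_pullCov W.isOpen_dom g_contDiffOn a1 (htm ε hε t ht).1 (hKS hz))
      (fun t ht => hC₂ (t, z) ⟨(htm ε hε t ht).2, hz⟩)
    rw [h.pullCov_zero _ (hKS hz), h.pullCov_zero _ (hKS hz)] at h1
    exact h1.trans (by gcongr; exact le_max_right _ _)

theorem hasInvariantExpansion_flow (h : IsLocalFlow W.g W.dom S δ φ) {K : Set PhaseSpace}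
    (hK : IsCompact K) (hKS : K ⊆ S) : W.HasInvariantExpansion
      (W.gaugeTransform fun ε => pullback (φ (-ε)) (W.gammaW ε)) K :=
  hasInvariantExpansion hK (hKS.trans h.subset) (nearTransport_flow h hK hKS) one_pos
    fun ε _ z _ => pullback_gammaW ε (-ε) z

end Setting

end

/-! ### Integrated generating functions and oscillatory estimates. -/

section

section ExpInt

variable {F : Type*} [NormedAddCommGroup F] [NormedSpace ℂ F]

/-- The integral `∑ s^(n+1)/(n+1)! cₙ` of the exponential generating function. -/
def expInt (c : ℕ → F) (s : ℂ) : F :=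
  ∑' n : ℕ, (s ^ (n + 1) / ((n + 1).factorial : ℂ)) • c n

variable {c : ℕ → F} {C B : ℝ}

theorem expInt_zero (c : ℕ → F) : expInt c 0 = 0 := by simp [expInt]

/-- The sequence `0, c₀, c₁, …`. -/
def shiftSeq (c : ℕ → F) : ℕ → F
  | 0 => 0
  | n + 1 => c n

omit [NormedSpace ℂ F] in
theorem ExpBound.shiftSeq (h : ExpBound c C B) (hB : 0 < B) :
    ExpBound (shiftSeq c) (C / B) B := by
  have hC := h.nonneg
  intro n
  cases n with
  | zero => simp [GCWave.shiftSeq]; positivity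
  | succ n =>
    refine (h n).trans ?_
    have h1 : (n.factorial : ℝ) ≤ (n + 1).factorial := by
      exact_mod_cast Nat.factorial_le n.le_succ
    calc C * n.factorial * B ^ n ≤ C * (n + 1).factorial * B ^ n := by gcongr
      _ = C / B * (n + 1).factorial * B ^ (n + 1) := by rw [pow_succ]; field_simp

variable [CompleteSpace F]

theorem ExpBound.hasSum_expInt (h : ExpBound c C B) (hB : 0 < B) {s : ℂ} (hs : B * ‖s‖ < 1) :
    HasSum (fun n : ℕ => (s ^ (n + 1) / ((n + 1).factorial : ℂ)) • c n) (expInt c s) := by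
  have h1 := (summable_nat_add_iff 1).2 ((h.shiftSeq hB).summable hB.le hs)
  exact h1.hasSum

/-- The integral is the generating function of the shifted sequence, which inherits its convergence
and differentiability. -/
theorem ExpBound.expInt_eq (h : ExpBound c C B) (hB : 0 < B) {s : ℂ} (hs : B * ‖s‖ < 1) :
    expInt c s = expSum (GCWave.shiftSeq c) s := by
  rw [expSum, ((h.shiftSeq hB).summable hB.le hs).tsum_eq_zero_add]
  simp [GCWave.shiftSeq, expInt]

theorem ExpBound.hasDerivAt_expInt (h : ExpBound c C B) (hB : 0 < B) {s : ℂ}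
    (hs : B * ‖s‖ < 1) : HasDerivAt (expInt c) (expSum c s) s := by
  refine ((h.shiftSeq hB).hasDerivAt hB.le hs).congr_of_eventuallyEq ?_
  have : {s : ℂ | B * ‖s‖ < 1} ∈ nhds s :=
    (isOpen_lt (continuous_const.mul continuous_norm) continuous_const).mem_nhds hs
  exact Filter.eventually_of_mem this fun t ht => h.expInt_eq hB ht

end ExpInt

section Oscillatory

variable {F : Type*} [NormedAddCommGroup F] [NormedSpace ℝ F] [NormedSpace ℂ F]
  [IsScalarTower ℝ ℂ F]

/-- Add to `Φ` the explicit antiderivative of the model integrand, built from `phi 1` and `phi 2`,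
and apply the mean value inequality on `[0, 1]`. -/
theorem norm_add_oscillatory_le {Φ Φ' : ℝ → F} {x ε D : ℝ} {w : ℂ} {y₀ y₁ : F} (h0 : Φ 0 = 0)
    (h : ∀ τ ∈ Icc (0 : ℝ) 1, HasDerivAt Φ (Φ' τ) τ)
    (hD : ∀ τ ∈ Icc (0 : ℝ) 1, ‖Φ' τ + (ε * w * Complex.exp (-Complex.I * (τ * x))) •
      (y₀ - ((ε : ℂ) * τ) • y₁)‖ ≤ D) :
    ‖Φ 1 + (ε * w) • ((Complex.I * q1 x) • y₀ - (ε * q2 x) • y₁)‖ ≤ D := by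
  have hu : ∀ τ : ℝ, (τ : ℂ) * (-Complex.I * x) = -Complex.I * (τ * x) := fun τ => by ring
  have hΨ : ∀ τ ∈ Icc (0 : ℝ) 1, HasDerivAt (fun τ : ℝ => Φ τ + ((ε * w : ℂ) •
      (((τ : ℂ) * phi 1 (τ * (-Complex.I * x))) • y₀ -
        ((ε : ℂ) * ((τ : ℂ) ^ 2 * phi 2 (τ * (-Complex.I * x)))) • y₁)))
      (Φ' τ + (ε * w * Complex.exp (-Complex.I * (τ * x))) • (y₀ - ((ε : ℂ) * τ) • y₁)) τ := by
    intro τ hτ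
    have h1 := (hasDerivAt_mul_phi_one (-Complex.I * x) τ).smul_const y₀
    have h2 := ((hasDerivAt_sq_mul_phi_two (-Complex.I * x) τ).const_mul (ε : ℂ)).smul_const y₁
    refine ((h τ hτ).fun_add ((h1.fun_sub h2).const_smul (ε * w : ℂ))).congr_deriv ?_
    rw [hu]
    module
  have h1 := (convex_Icc (0 : ℝ) 1).norm_image_sub_le_of_norm_hasDerivWithin_le
    (fun τ hτ => (hΨ τ hτ).hasDerivWithinAt) hD (left_mem_Icc.2 zero_le_one)
    (right_mem_Icc.2 zero_le_one)
  have h2 : Complex.I * q1 x = phi 1 (-Complex.I * x) := by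
    rw [q1_eq]; linear_combination (-phi 1 (-Complex.I * x)) * Complex.I_sq
  rw [h2, q2_eq]
  simpa [h0] using h1

variable [CompleteSpace F]

omit [NormedSpace ℝ F] [IsScalarTower ℝ ℂ F] in
/-- Expansion of `exp (i p(-ετ)/ε) c(-ετ)` for `0 ≤ τ ≤ 1`, where `p` and `c` are exponential
generating functions. -/
theorem exists_transport_estimate (C B : ℝ) (hC : 0 ≤ C) (hB : 0 ≤ B) :
    ∃ C' ε₀ : ℝ, 0 ≤ C' ∧ 0 < ε₀ ∧ ε₀ ≤ 1 ∧ C' * ε₀ ≤ 1 ∧ ∀ (p : ℕ → ℂ) (r x : ℝ),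
      ExpBound p C B → p 0 = r → p 1 = x → ∀ c : ℕ → F, ExpBound c C B →
      ∀ ε ∈ Ioo 0 ε₀, ∀ τ ∈ Icc (0 : ℝ) 1, ∃ η : ℂ, ‖η‖ ≤ C' * ε ∧
        Complex.exp (Complex.I / ε * expSum p (-(ε * τ))) =
          (1 + η) * (Complex.exp (Complex.I / ε * r) * Complex.exp (-Complex.I * (τ * x))) ∧
        ‖expSum c (-(ε * τ)) - (c 0 - ((ε : ℂ) * τ) • c 1)‖ ≤ C' * ε ^ 2 := by
  set A := 2 * C * B ^ 2 with hA
  have hA0 : 0 ≤ A := by positivity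
  -- The two nontrivial bounds on `ε` ensure `Bε ≤ 1/2`, for the tail estimate, and `2Aε ≤ 1`, for
  -- the exponential.
  refine ⟨2 * A, min 1 (min (1 / (2 * (B + 1))) (1 / (2 * A + 1))), by positivity, by positivity,
    min_le_left _ _, ?_, ?_⟩
  · calc 2 * A * _ ≤ 2 * A * (1 / (2 * A + 1)) := by
          gcongr; exact (min_le_right _ _).trans (min_le_right _ _)
      _ ≤ 1 := by rw [mul_one_div, div_le_one (by positivity)]; linarith
  intro p r x hp hp0 hp1 c hc ε hε τ hτ
  have hε0 := hε.1
  have hε1 : ε < 1 := hε.2.trans_le (min_le_left _ _)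
  have hεB : B * ε ≤ 1 / 2 := by
    have h1 := hε.2.le.trans ((min_le_right _ _).trans (min_le_left _ _))
    rw [le_div_iff₀ (by positivity)] at h1
    linarith
  have hεA : A * ε ≤ 1 := by
    have h1 := hε.2.le.trans ((min_le_right _ _).trans (min_le_right _ _))
    rw [le_div_iff₀ (by positivity)] at h1
    nlinarith
  have hs : ‖(-(ε * τ) : ℂ)‖ ≤ ε := by
    rw [norm_neg, norm_mul, Complex.norm_real, Complex.norm_real, Real.norm_of_nonneg hε0.le,
      Real.norm_of_nonneg hτ.1]
    exact mul_le_of_le_one_right hε0.le hτ.2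
  have hsB : B * ‖(-(ε * τ) : ℂ)‖ ≤ 1 / 2 := (by gcongr : _ ≤ B * ε).trans hεB
  have hq : 2 * C * (B * ‖(-(ε * τ) : ℂ)‖) ^ 2 ≤ A * ε ^ 2 := by
    rw [hA, mul_assoc (2 * C), ← mul_pow]
    gcongr
  have h1 := (hp.norm_sub_linear_le hB hsB).trans hq
  have h2 := (hc.norm_sub_linear_le hB hsB).trans hq
  set d : ℂ := Complex.I / ε * (expSum p (-(ε * τ)) - (p 0 + (-(ε * τ) : ℂ) • p 1)) with hd
  have hε' : (ε : ℂ) ≠ 0 := by exact_mod_cast hε0.ne'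
  have hd1 : ‖d‖ ≤ A * ε := by
    rw [hd, norm_mul, norm_div, Complex.norm_I, Complex.norm_real, Real.norm_of_nonneg hε0.le,
      one_div_mul_eq_div, div_le_iff₀ hε0]
    refine h1.trans_eq (by ring)
  refine ⟨Complex.exp d - 1, ?_, ?_, ?_⟩
  · refine (Complex.norm_exp_sub_one_le (hd1.trans hεA)).trans ?_
    linarith
  · rw [add_sub_cancel, ← Complex.exp_add, ← Complex.exp_add, hd, hp0, hp1, smul_eq_mul]
    congr 1
    field_simp
    ring
  · rw [neg_smul, ← sub_eq_add_neg] at h2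
    refine h2.trans ?_
    nlinarith [sq_nonneg ε]

/-- Expansion of the integral of `exp (i p(s)/ε) c(s)` from `0` to `-ε`. -/
theorem exists_expInt_estimate (C B ρ : ℝ) (hC : 0 ≤ C) (hB : 0 ≤ B) (hρ : 0 < ρ) :
    ∃ C' ε₀ : ℝ, 0 ≤ C' ∧ 0 < ε₀ ∧ ε₀ ≤ 1 ∧ ε₀ ≤ ρ ∧ ∀ (p : ℕ → ℂ) (r x : ℝ),
      ExpBound p C B → p 0 = r → p 1 = x → ∀ c : ℕ → F, ExpBound c C B →
      ∀ ε ∈ Ioo 0 ε₀, ∀ (e : ℕ → F) (C₁ : ℝ), ExpBound e C₁ ρ⁻¹ →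
      (∀ s : ℂ, ‖s‖ < ρ → expSum e s = Complex.exp (Complex.I / ε * expSum p s) • expSum c s) →
      ‖expInt e (-ε) + (ε * Complex.exp (Complex.I / ε * r)) • (Complex.I * q1 x) • c 0‖ ≤
        C' * ε ^ 2 ∧
      ∀ ev : F →L[ℝ] ℂ, (∀ (a : ℂ) y, ev (a • y) = a * ev y) → ev (c 0) = 0 →
        ‖ev (expInt e (-ε)) - ε ^ 2 * Complex.exp (Complex.I / ε * r) * q2 x * ev (c 1)‖ ≤
          C' * ε ^ 3 * ‖ev‖ := by
  obtain ⟨A, ε₀, hA, h0, h1, hA1, hest⟩ := exists_transport_estimate (F := F) C B hC hB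
  refine ⟨A * (C + C * B + A) + (A + C * B) + (2 * A + A * (C * B)), min ε₀ ρ, by positivity,
    lt_min h0 hρ, (min_le_left _ _).trans h1, min_le_right _ _, ?_⟩
  intro p r x hp hp0 hp1 c hc ε hε e C₁ he hsum
  have hε0 := hε.1
  have hε₀ : ε ∈ Ioo 0 ε₀ := ⟨hε0, hε.2.trans_le (min_le_left _ _)⟩
  have hε1 : ε < 1 := hε₀.2.trans_le h1
  have hερ : ε < ρ := hε.2.trans_le (min_le_right _ _)
  have hc0 : ‖c 0‖ ≤ C := by simpa using hc 0
  have hc1 : ‖c 1‖ ≤ C * B := by simpa using hc 1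
  have hs : ∀ τ ∈ Icc (0 : ℝ) 1, ‖(-(ε * τ) : ℂ)‖ < ρ := fun τ hτ => by
    rw [norm_neg, norm_mul, Complex.norm_real, Complex.norm_real, Real.norm_of_nonneg hε0.le,
      Real.norm_of_nonneg hτ.1]
    exact (mul_le_of_le_one_right hε0.le hτ.2).trans_lt hερ
  have hΦ : ∀ τ ∈ Icc (0 : ℝ) 1, HasDerivAt (fun τ : ℝ => expInt e (-(ε * τ)))
      ((-ε : ℂ) • expSum e (-(ε * τ))) τ := fun τ hτ => by
    have hsB : ρ⁻¹ * ‖(-(ε * τ) : ℂ)‖ < 1 := by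
      rw [inv_mul_lt_iff₀ hρ, mul_one]; exact hs τ hτ
    have d1 : HasDerivAt (fun τ : ℝ => (-(ε * τ) : ℂ)) (-ε : ℂ) τ := by
      simpa using ((Complex.ofRealCLM.hasDerivAt (x := τ)).const_mul (ε : ℂ)).fun_neg
    exact (he.hasDerivAt_expInt (inv_pos.2 hρ) hsB).scomp τ d1
  have hw : ∀ t : ℝ, ‖Complex.exp (Complex.I / ε * t)‖ = 1 := fun t => by
    rw [show Complex.I / ε * (t : ℂ) = ((t / ε : ℝ) : ℂ) * Complex.I by push_cast; ring,
      Complex.norm_exp_ofReal_mul_I]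
  have hv : ∀ t : ℝ, ‖Complex.exp (-Complex.I * (t * x))‖ = 1 := fun t => by
    rw [show -Complex.I * (t * x : ℂ) = ((-(t * x) : ℝ) : ℂ) * Complex.I by push_cast; ring,
      Complex.norm_exp_ofReal_mul_I]
  have h00 : (fun τ : ℝ => expInt e (-(ε * τ))) 0 = 0 := by simp [expInt_zero]
  have hAε : A * ε ≤ 1 := (by gcongr; exact hε₀.2.le : A * ε ≤ A * ε₀).trans hA1
  constructor
  -- Only the constant amplitude `c 0` is retained here, so the linear term belongs to the error.
  · have key := norm_add_oscillatory_le (x := x) (ε := ε) (D := (A * (C + C * B + A) +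
      (A + C * B)) * ε ^ 2) (w := Complex.exp (Complex.I / ε * r)) (y₀ := c 0) (y₁ := (0 : F))
      h00 hΦ fun τ hτ => ?_
    · simp only [smul_zero, sub_zero, Complex.ofReal_one, mul_one] at key
      refine key.trans ?_
      have : 0 ≤ (2 * A + A * (C * B)) * ε ^ 2 := by positivity
      linarith
    · obtain ⟨η, hη, h2, h3⟩ := hest p r x hp hp0 hp1 c hc ε hε₀ τ hτ
      rw [hsum _ (hs τ hτ), h2]
      set P := expSum c (-(ε * τ))
      have e1 : (-ε : ℂ) • ((1 + η) * (Complex.exp (Complex.I / ε * r) *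
          Complex.exp (-Complex.I * (τ * x)))) • P + (ε * Complex.exp (Complex.I / ε * r) *
          Complex.exp (-Complex.I * (τ * x))) • (c 0 - ((ε : ℂ) * τ) • (0 : F)) =
          (-(ε * Complex.exp (Complex.I / ε * r) * Complex.exp (-Complex.I * (τ * x)))) •
            (η • P + (P - c 0)) := by module
      have n1 : ‖P - c 0‖ ≤ (A + C * B) * ε := by
        have e2 : P - c 0 = (P - (c 0 - ((ε : ℂ) * τ) • c 1)) - ((ε : ℂ) * τ) • c 1 := by module
        rw [e2]
        refine (norm_sub_le _ _).trans ?_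
        rw [norm_smul, norm_mul, Complex.norm_real, Complex.norm_real,
          Real.norm_of_nonneg hε0.le, Real.norm_of_nonneg hτ.1]
        have h4 : ε * τ * ‖c 1‖ ≤ ε * 1 * (C * B) := by
          have := hτ.2; have := hτ.1; gcongr
        have h5 : A * ε ^ 2 ≤ A * ε := by gcongr; nlinarith
        linarith
      have n2 : ‖P‖ ≤ C + C * B + A := by
        have := norm_add_le (P - c 0) (c 0)
        rw [sub_add_cancel] at this
        have h6 : (A + C * B) * ε ≤ A + C * B := mul_le_of_le_one_right (by positivity) hε1.le
        linarith
      rw [e1, norm_smul, norm_neg, norm_mul, norm_mul, hw, hv, Complex.norm_real,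
        Real.norm_of_nonneg hε0.le, mul_one, mul_one]
      have n3 : ‖η • P + (P - c 0)‖ ≤ A * ε * (C + C * B + A) + (A + C * B) * ε := by
        refine (norm_add_le _ _).trans ?_
        rw [norm_smul]
        gcongr
      calc ε * _ ≤ ε * (A * ε * (C + C * B + A) + (A + C * B) * ε) := by gcongr
        _ = _ := by ring
  · intro ev hev hev0
    -- When the evaluation kills `c 0`, the linear term `c 1` leads and the accuracy improves by one
    -- order.
    have key := norm_add_oscillatory_le (x := x) (ε := ε) (D := (2 * A + A * (C * B)) * ε ^ 3 *
      ‖ev‖) (w := Complex.exp (Complex.I / ε * r)) (y₀ := (0 : ℂ)) (y₁ := ev (c 1))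
      (Φ := fun τ => ev (expInt e (-(ε * τ)))) (by simp [expInt_zero])
      (fun τ hτ => ev.hasFDerivAt.comp_hasDerivAt τ (hΦ τ hτ)) fun τ hτ => ?_
    · have e0 : ev (expInt e (-ε)) - ε ^ 2 * Complex.exp (Complex.I / ε * r) * q2 x * ev (c 1) =
          ev (expInt e (-(ε * (1 : ℝ)))) + (ε * Complex.exp (Complex.I / ε * r)) •
            ((Complex.I * q1 x) • (0 : ℂ) - (ε * q2 x) • ev (c 1)) := by
        simp only [Complex.ofReal_one, mul_one, smul_eq_mul]; ring
      rw [e0]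
      refine key.trans ?_
      have : 0 ≤ A * (C + C * B + A) + (A + C * B) := by positivity
      rw [mul_assoc, mul_assoc]
      exact mul_le_mul_of_nonneg_right (by linarith) (by positivity)
    · obtain ⟨η, hη, h2, h3⟩ := hest p r x hp hp0 hp1 c hc ε hε₀ τ hτ
      rw [hsum _ (hs τ hτ), h2, hev, hev]
      set P := expSum c (-(ε * τ))
      have hP : ev P = ev (P - (c 0 - ((ε : ℂ) * τ) • c 1)) - (ε * τ) * ev (c 1) := by
        rw [map_sub, map_sub, hev0, hev]; ring
      set R := ev (P - (c 0 - ((ε : ℂ) * τ) • c 1)) with hR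
      have hRn : ‖R‖ ≤ ‖ev‖ * (A * ε ^ 2) := (ev.le_opNorm _).trans (by gcongr)
      have e1 : (-ε : ℂ) * (((1 + η) * (Complex.exp (Complex.I / ε * r) *
          Complex.exp (-Complex.I * (τ * x)))) * ev P) + (ε * Complex.exp (Complex.I / ε * r) *
          Complex.exp (-Complex.I * (τ * x))) • (0 - ((ε : ℂ) * τ) • ev (c 1)) =
          (-(ε * Complex.exp (Complex.I / ε * r) * Complex.exp (-Complex.I * (τ * x)))) *
            ((1 + η) * R - η * ((ε * τ) * ev (c 1))) := by
        rw [hP]; simp only [smul_eq_mul]; ring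
      rw [e1, norm_mul, norm_neg, norm_mul, norm_mul, hw, hv, Complex.norm_real,
        Real.norm_of_nonneg hε0.le, mul_one, mul_one]
      have hη1 : ‖1 + η‖ ≤ 2 := (norm_add_le _ _).trans (by rw [norm_one]; linarith)
      have hev1 : ‖ev (c 1)‖ ≤ ‖ev‖ * (C * B) := (ev.le_opNorm _).trans (by gcongr)
      have n3 : ‖(1 + η) * R - η * ((ε * τ) * ev (c 1))‖ ≤
          2 * (‖ev‖ * (A * ε ^ 2)) + A * ε * (ε * 1 * (‖ev‖ * (C * B))) := by
        refine (norm_sub_le _ _).trans ?_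
        rw [norm_mul, norm_mul, norm_mul, norm_mul, Complex.norm_real, Complex.norm_real,
          Real.norm_of_nonneg hε0.le, Real.norm_of_nonneg hτ.1]
        have := hτ.2
        have := hτ.1
        gcongr
      calc ε * _ ≤ ε * (2 * (‖ev‖ * (A * ε ^ 2)) + A * ε * (ε * 1 * (‖ev‖ * (C * B)))) := by gcongr
        _ = _ := by ring

end Oscillatory

end

/-! ### Convergence of the series for analytic data. -/

section

namespace Setting

variable {W : Setting}

theorem Reg.analyticOnNhd {F : Type*} [NormedAddCommGroup F] [NormedSpace ℝ F] [CompleteSpace F]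
    {f : PhaseSpace → F} (hf : ContDiffOn ℝ ω f W.dom) : AnalyticOnNhd ℝ f W.dom :=
  W.isOpen_dom.analyticOn_iff_analyticOnNhd.1 hf.analyticOn

/-- The iterates of `g · ∇ + M` on `f`, at the point `z`. -/
abbrev lopSeq (W : Setting) {F : Type*} [NormedAddCommGroup F] [NormedSpace ℝ F]
    (M : PhaseSpace → F →L[ℝ] F) (f : PhaseSpace → F) (z : PhaseSpace) : ℕ → F :=
  fun n => (lop W.g M)^[n] f z

/-- Factorial bounds for the iterated Lie derivatives of the phase and the amplitudes. -/
structure LieBound (W : Setting) (N : Set PhaseSpace) (C B : ℝ) : Prop where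
  isOpen : IsOpen N
  subset : N ⊆ W.dom
  C_nonneg : 0 ≤ C
  B_nonneg : 0 ≤ B
  psi : ∀ z ∈ N, ExpBound (W.lopSeq 0 W.psiC z) C B
  alpha : ∀ z ∈ N, ExpBound (W.lopSeq (GCWave.formMul ℂ W.g) W.alpha z) C B
  f0 : ∀ z ∈ N, ExpBound (W.lopSeq 0 W.f0 z) C B
  beta0 : ∀ z ∈ N, ExpBound (W.lopSeq (GCWave.formMul ℂ W.g) W.beta0 z) C B
  beta1 : ∀ z ∈ N, ExpBound (W.lopSeq (GCWave.formMul ℂ W.g) W.beta1 z) C B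

theorem exists_lieBound (hW : W.IsAnalytic) {K : Set PhaseSpace} (hK : IsCompact K)
    (hKd : K ⊆ W.dom) : ∃ N C B, K ⊆ N ∧ W.LieBound N C B := by
  have h := IsAnalytic.reg W hW
  have hg := Reg.analyticOnNhd h.g
  have hM := Reg.analyticOnNhd h.formMul
  have h0 : ∀ {F : Type} [NormedAddCommGroup F] [NormedSpace ℝ F],
      AnalyticOnNhd ℝ (0 : PhaseSpace → F →L[ℝ] F) W.dom := fun {F} _ _ _ _ => analyticAt_const
  obtain ⟨N₁, o₁, k₁, s₁, C₁, B₁, b₁, e₁⟩ := exists_expBound_lop_iterate W.isOpen_dom hg h0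
    (Reg.analyticOnNhd h.psiC) hK hKd
  obtain ⟨N₂, o₂, k₂, s₂, C₂, B₂, b₂, e₂⟩ := exists_expBound_lop_iterate W.isOpen_dom hg hM
    (Reg.analyticOnNhd h.alpha) hK hKd
  obtain ⟨N₃, o₃, k₃, s₃, C₃, B₃, b₃, e₃⟩ := exists_expBound_lop_iterate W.isOpen_dom hg h0
    (Reg.analyticOnNhd h.f0) hK hKd
  obtain ⟨N₄, o₄, k₄, s₄, C₄, B₄, b₄, e₄⟩ := exists_expBound_lop_iterate W.isOpen_dom hg hM
    (Reg.analyticOnNhd h.beta0) hK hKd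
  obtain ⟨N₅, o₅, k₅, s₅, C₅, B₅, b₅, e₅⟩ := exists_expBound_lop_iterate W.isOpen_dom hg hM
    (Reg.analyticOnNhd h.beta1) hK hKd
  -- The entry `0` in the list makes the common constant nonnegative.
  have c : ∀ i, ![0, C₁, C₂, C₃, C₄, C₅] i ≤ Finset.univ.sup' Finset.univ_nonempty
    ![0, C₁, C₂, C₃, C₄, C₅] := fun i => Finset.le_sup' _ (Finset.mem_univ i)
  have b : ∀ i, ![B₁, B₂, B₃, B₄, B₅] i ≤ Finset.univ.sup' Finset.univ_nonempty
    ![B₁, B₂, B₃, B₄, B₅] := fun i => Finset.le_sup' _ (Finset.mem_univ i)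
  exact ⟨N₁ ∩ (N₂ ∩ (N₃ ∩ (N₄ ∩ N₅))), _, _,
    subset_inter k₁ (subset_inter k₂ (subset_inter k₃ (subset_inter k₄ k₅))),
    ⟨o₁.inter (o₂.inter (o₃.inter (o₄.inter o₅))), fun z hz => s₁ hz.1, c 0, b₁.trans (b 0),
      fun z hz => (e₁ z hz.1).mono (c 1) b₁ (b 0), fun z hz => (e₂ z hz.2.1).mono (c 2) b₂ (b 1),
      fun z hz => (e₃ z hz.2.2.1).mono (c 3) b₃ (b 2),
      fun z hz => (e₄ z hz.2.2.2.1).mono (c 4) b₄ (b 3),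
      fun z hz => (e₅ z hz.2.2.2.2).mono (c 5) b₅ (b 4)⟩⟩

/-- A radius of convergence of the Lie series. -/
def lieRadius (B : ℝ) : ℝ := 1 / (4 * (B + 1))

/-- A bound for the coefficients of the Lie series. -/
def lieConst (C ε : ℝ) : ℝ := Real.exp (‖Complex.I / (ε : ℂ)‖ * (2 * C)) * (2 * C)

namespace LieBound

variable {N : Set PhaseSpace} {C B : ℝ}

theorem radius_pos (h : W.LieBound N C B) : 0 < lieRadius B := by
  have := h.B_nonneg
  rw [lieRadius]; positivity

section Twist

variable {F : Type*} [NormedAddCommGroup F] [NormedSpace ℝ F] [NormedSpace ℂ F]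
  [IsScalarTower ℝ ℂ F] [CompleteSpace F] {M : PhaseSpace → F →L[ℝ] F} {f : PhaseSpace → F}

/-- The radius depends neither on `ε` nor on the point; `ε` affects only the constant, which
suffices for convergence at each fixed `ε`. -/
theorem twist (h : W.LieBound N C B) (hM : ContDiffOn ℝ ∞ M W.dom)
    (hMc : ∀ z (c : ℂ) x, M z (c • x) = c • M z x) (hf : ContDiffOn ℝ ∞ f W.dom)
    (hb : ∀ z ∈ N, ExpBound (W.lopSeq M f z) C B) (ε : ℝ) {z : PhaseSpace} (hz : z ∈ N) :
    ExpBound (W.lopSeq M (fun y => W.eik ε y.1 • f y) z) (lieConst C ε) (lieRadius B)⁻¹ ∧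
    ∀ s : ℂ, ‖s‖ < lieRadius B → expSum (W.lopSeq M (fun y => W.eik ε y.1 • f y) z) s =
      Complex.exp (Complex.I / ε * expSum (W.lopSeq 0 W.psiC z) s) • expSum (W.lopSeq M f z) s := by
  have hB := h.B_nonneg
  have hρ : B * lieRadius B ≤ 1 / 4 := by
    rw [lieRadius, mul_one_div, div_le_div_iff₀ (by positivity) (by positivity)]
    linarith
  have h1 := hasSum_lop_iterate_exp_smul h.isOpen (g_contDiffOn.mono h.subset) (hM.mono h.subset)
    hMc (W.reg_top.psiC.mono h.subset) (hf.mono h.subset) (Complex.I / ε) hz hB h.radius_pos hρ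
    (h.psi z hz) (hb z hz)
  exact ⟨h1.1, fun s hs => (h1.2 s hs).tsum_eq⟩

theorem inv_radius_mul_lt (h : W.LieBound N C B) {ε : ℝ} (hε : ε ∈ Ioo 0 (lieRadius B)) :
    (lieRadius B)⁻¹ * ‖(-ε : ℂ)‖ < 1 := by
  rw [inv_mul_lt_iff₀ h.radius_pos, norm_neg, Complex.norm_real, Real.norm_of_nonneg hε.1.le,
    mul_one]
  exact hε.2

end Twist

theorem smul_eq_real_smul {F : Type*} [NormedAddCommGroup F] [NormedSpace ℝ F] [NormedSpace ℂ F]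
    [IsScalarTower ℝ ℂ F] (ε : ℝ) (n : ℕ) (x : F) :
    (((-ε : ℂ) ^ n / (n.factorial : ℂ)) • x) = ((-ε) ^ n / (n.factorial : ℝ)) • x := by
  have : ((-ε : ℂ) ^ n / (n.factorial : ℂ)) = ((-ε) ^ n / (n.factorial : ℝ)) • (1 : ℂ) := by
    rw [Complex.real_smul]; push_cast; ring
  rw [this, smul_assoc, one_smul]

theorem smul_add_eq_real_smul {F : Type*} [NormedAddCommGroup F] [NormedSpace ℝ F]
    [NormedSpace ℂ F] [IsScalarTower ℝ ℂ F] (ε : ℝ) (n : ℕ) (x y : F) :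
    (1 / ε) • (((-ε : ℂ) ^ n / (n.factorial : ℂ)) • x) +
      (((-ε : ℂ) ^ n / (n.factorial : ℂ)) • y) =
      ((-ε) ^ n / (n.factorial : ℝ)) • ((1 / ε) • x + y) := by
  rw [smul_eq_real_smul, smul_eq_real_smul, smul_comm (1 / ε), ← smul_add]

theorem norm_neg_coe {ε : ℝ} (hε : 0 < ε) : ‖(-ε : ℂ)‖ = ε := by
  rw [norm_neg, Complex.norm_real, Real.norm_of_nonneg hε.le]

theorem twist_alpha (h : W.LieBound N C B) (ε : ℝ) {z : PhaseSpace} (hz : z ∈ N) :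
    ExpBound (W.lopSeq (GCWave.formMul ℂ W.g) (fun y => W.eik ε y.1 • W.alpha y) z) (lieConst C ε)
      (lieRadius B)⁻¹ ∧
    ∀ s : ℂ, ‖s‖ < lieRadius B →
      expSum (W.lopSeq (GCWave.formMul ℂ W.g) (fun y => W.eik ε y.1 • W.alpha y) z) s =
        Complex.exp (Complex.I / ε * expSum (W.lopSeq 0 W.psiC z) s) •
          expSum (W.lopSeq (GCWave.formMul ℂ W.g) W.alpha z) s :=
  h.twist W.reg_top.formMul formMul_smul W.reg_top.alpha h.alpha ε hz

theorem twist_beta0 (h : W.LieBound N C B) (ε : ℝ) {z : PhaseSpace} (hz : z ∈ N) :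
    ExpBound (W.lopSeq (GCWave.formMul ℂ W.g) (fun y => W.eik ε y.1 • W.beta0 y) z) (lieConst C ε)
      (lieRadius B)⁻¹ ∧
    ∀ s : ℂ, ‖s‖ < lieRadius B →
      expSum (W.lopSeq (GCWave.formMul ℂ W.g) (fun y => W.eik ε y.1 • W.beta0 y) z) s =
        Complex.exp (Complex.I / ε * expSum (W.lopSeq 0 W.psiC z) s) •
          expSum (W.lopSeq (GCWave.formMul ℂ W.g) W.beta0 z) s :=
  h.twist W.reg_top.formMul formMul_smul W.reg_top.beta0 h.beta0 ε hz

theorem twist_beta1 (h : W.LieBound N C B) (ε : ℝ) {z : PhaseSpace} (hz : z ∈ N) :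
    ExpBound (W.lopSeq (GCWave.formMul ℂ W.g) (fun y => W.eik ε y.1 • W.beta1 y) z) (lieConst C ε)
      (lieRadius B)⁻¹ ∧
    ∀ s : ℂ, ‖s‖ < lieRadius B →
      expSum (W.lopSeq (GCWave.formMul ℂ W.g) (fun y => W.eik ε y.1 • W.beta1 y) z) s =
        Complex.exp (Complex.I / ε * expSum (W.lopSeq 0 W.psiC z) s) •
          expSum (W.lopSeq (GCWave.formMul ℂ W.g) W.beta1 z) s :=
  h.twist W.reg_top.formMul formMul_smul W.reg_top.beta1 h.beta1 ε hz

theorem twist_f0 (h : W.LieBound N C B) (ε : ℝ) {z : PhaseSpace} (hz : z ∈ N) :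
    ExpBound (W.lopSeq 0 (fun y => W.eik ε y.1 • W.f0 y) z) (lieConst C ε)
      (lieRadius B)⁻¹ ∧
    ∀ s : ℂ, ‖s‖ < lieRadius B →
      expSum (W.lopSeq 0 (fun y => W.eik ε y.1 • W.f0 y) z) s =
        Complex.exp (Complex.I / ε * expSum (W.lopSeq 0 W.psiC z) s) •
          expSum (W.lopSeq 0 W.f0 z) s :=
  h.twist contDiffOn_zeroMul (by simp) W.reg_top.f0 h.f0 ε hz

theorem lieTerm_eq_toForm1 (ε : ℝ) (j : ℕ) {z : PhaseSpace} (hz : z ∈ W.dom) :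
    W.lieTerm ε j z = toForm1 PhaseSpace (((-ε : ℂ) ^ j / (j.factorial : ℂ)) •
      W.lopSeq (GCWave.formMul ℂ W.g) (fun y => W.eik ε y.1 • W.alpha y) z j) := by
  refine Eq.trans ?_ (congrArg (toForm1 PhaseSpace) (smul_eq_real_smul ε j _)).symm
  rw [lieTerm, lieDeriv_iterate_gammaW ε j hz]
  exact ((toForm1 PhaseSpace).map_smul _ _).symm

theorem lopSeq_betaE (ε : ℝ) (n : ℕ) {z : PhaseSpace} (hz : z ∈ W.dom) :
    W.lopSeq (GCWave.formMul ℂ W.g) (fun y => W.eik ε y.1 • W.betaE ε y) z n =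
      (1 / ε) • W.lopSeq (GCWave.formMul ℂ W.g) (fun y => W.eik ε y.1 • W.beta0 y) z n +
        W.lopSeq (GCWave.formMul ℂ W.g) (fun y => W.eik ε y.1 • W.beta1 y) z n := by
  have c0 : ContDiffOn ℝ ∞ (fun y : PhaseSpace => W.eik ε y.1 • W.beta0 y) W.dom :=
    (contDiffOn_eik ε).smul W.reg_top.beta0
  have c1 : ContDiffOn ℝ ∞ (fun y : PhaseSpace => W.eik ε y.1 • W.beta1 y) W.dom :=
    (contDiffOn_eik ε).smul W.reg_top.beta1
  have e : (fun y : PhaseSpace => W.eik ε y.1 • W.betaE ε y) =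
      (1 / ε) • (fun y : PhaseSpace => W.eik ε y.1 • W.beta0 y) +
        fun y : PhaseSpace => W.eik ε y.1 • W.beta1 y := by
    funext y
    change W.eik ε y.1 • ((1 / ε) • W.beta0 y + W.beta1 y) =
      (1 / ε) • (W.eik ε y.1 • W.beta0 y) + W.eik ε y.1 • W.beta1 y
    rw [smul_add, smul_comm]
  have c0' : ContDiffOn ℝ ∞ ((1 / ε) • fun y : PhaseSpace => W.eik ε y.1 • W.beta0 y) W.dom :=
    c0.const_smul (1 / ε)
  have h := lop_iterate_add W.isOpen_dom g_contDiffOn W.reg_top.formMul c0' c1 n hz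
  rw [lop_iterate_const_smul] at h
  rw [lopSeq, e]
  exact h

/-- The weight has index `j + 1` but only `j` iterations remain, so the sum over `j` is an integral
of a generating function. -/
theorem invTerm_eq_toForm1 (ε : ℝ) (j : ℕ) {z : PhaseSpace} (hz : z ∈ W.dom) :
    W.invTerm ε (j + 1) z = toForm1 PhaseSpace
      ((1 / ε) • (((-ε : ℂ) ^ (j + 1) / ((j + 1).factorial : ℂ)) •
        W.lopSeq (GCWave.formMul ℂ W.g) (fun y => W.eik ε y.1 • W.beta0 y) z j) +
      ((-ε : ℂ) ^ (j + 1) / ((j + 1).factorial : ℂ)) •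
        W.lopSeq (GCWave.formMul ℂ W.g) (fun y => W.eik ε y.1 • W.beta1 y) z j) := by
  refine Eq.trans ?_ (congrArg (toForm1 PhaseSpace) (smul_add_eq_real_smul ε (j + 1) _ _)).symm
  rw [← lopSeq_betaE ε j hz, invTerm, intD_iterate_gammaW ε j hz]
  exact ((toForm1 PhaseSpace).map_smul _ _).symm

theorem potTerm_eq_toForm0 (ε : ℝ) (j : ℕ) {z : PhaseSpace} (hz : z ∈ W.dom) :
    W.potTerm ε (j + 1) z = toForm0 PhaseSpace (((-ε : ℂ) ^ (j + 1) / ((j + 1).factorial : ℂ)) •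
      W.lopSeq 0 (fun y => W.eik ε y.1 • W.f0 y) z j) := by
  rw [smul_eq_real_smul, potTerm_eqOn ε (j + 1) hz]
  rfl

theorem hasSum_lieTerm (h : W.LieBound N C B) {ε : ℝ} (hε : ε ∈ Ioo 0 (lieRadius B))
    {z : PhaseSpace} (hz : z ∈ N) : HasSum (fun j => W.lieTerm ε j z) (toForm1 PhaseSpace
      (Complex.exp (Complex.I / ε * expSum (W.lopSeq 0 W.psiC z) (-ε)) •
        expSum (W.lopSeq (GCWave.formMul ℂ W.g) W.alpha z) (-ε))) := by
  have h1 := h.twist_alpha ε hz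
  have h2 := h1.1.hasSum (inv_nonneg.2 h.radius_pos.le) (h.inv_radius_mul_lt hε)
  rw [h1.2 _ (by rw [norm_neg_coe hε.1]; exact hε.2)] at h2
  simp only [lieTerm_eq_toForm1 ε _ (h.subset hz)]
  exact (toForm1 PhaseSpace).hasSum h2

/-- The integral from `0` to `-ε` of the transported amplitude `f exp (iψ/ε)`. -/
def ampInt (W : Setting) {F : Type*} [NormedAddCommGroup F] [NormedSpace ℝ F] [NormedSpace ℂ F]
    (M : PhaseSpace → F →L[ℝ] F) (f : PhaseSpace → F) (ε : ℝ) (z : PhaseSpace) : F :=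
  expInt (W.lopSeq M (fun y => W.eik ε y.1 • f y) z) (-ε)

theorem hasSum_invTerm (h : W.LieBound N C B) {ε : ℝ} (hε : ε ∈ Ioo 0 (lieRadius B))
    {z : PhaseSpace} (hz : z ∈ N) : HasSum (fun j => W.invTerm ε (j + 1) z) (toForm1 PhaseSpace
      ((1 / ε) • ampInt W (GCWave.formMul ℂ W.g) W.beta0 ε z +
        ampInt W (GCWave.formMul ℂ W.g) W.beta1 ε z)) := by
  have hs := h.inv_radius_mul_lt hε
  have hρ := inv_pos.2 h.radius_pos
  have h0 := (h.twist_beta0 ε hz).1.hasSum_expInt hρ hs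
  have h1 := (h.twist_beta1 ε hz).1.hasSum_expInt hρ hs
  simp only [invTerm_eq_toForm1 ε _ (h.subset hz)]
  exact (toForm1 PhaseSpace).hasSum ((h0.const_smul (1 / ε)).add h1)

theorem hasSum_potTerm (h : W.LieBound N C B) {ε : ℝ} (hε : ε ∈ Ioo 0 (lieRadius B))
    {z : PhaseSpace} (hz : z ∈ N) : HasSum (fun j => W.potTerm ε (j + 1) z)
      (toForm0 PhaseSpace (ampInt W 0 W.f0 ε z)) := by
  have h0 := (h.twist_f0 ε hz).1.hasSum_expInt (inv_pos.2 h.radius_pos) (h.inv_radius_mul_lt hε)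
  simp only [potTerm_eq_toForm0 ε _ (h.subset hz)]
  exact (toForm0 PhaseSpace).hasSum h0

theorem norm_lieTerm_le (h : W.LieBound N C B) {ε : ℝ} (hε : 0 < ε) {z : PhaseSpace} (hz : z ∈ N)
    (j : ℕ) : ‖W.lieTerm ε j z‖ ≤
      ‖toForm1 PhaseSpace‖ * (lieConst C ε * ((lieRadius B)⁻¹ * ε) ^ j) := by
  rw [lieTerm_eq_toForm1 ε j (h.subset hz)]
  refine ContinuousLinearMap.le_opNorm_of_le _ ?_
  have := (h.twist_alpha ε hz).1.norm_term_le (-ε) j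
  rwa [norm_neg_coe hε] at this

theorem norm_invTerm_le (h : W.LieBound N C B) {ε : ℝ} (hε : 0 < ε) {z : PhaseSpace} (hz : z ∈ N)
    (j : ℕ) : ‖W.invTerm ε (j + 1) z‖ ≤ ‖toForm1 PhaseSpace‖ *
      ((1 / ε + 1) * (lieConst C ε / (lieRadius B)⁻¹ * ((lieRadius B)⁻¹ * ε) ^ (j + 1))) := by
  rw [invTerm_eq_toForm1 ε j (h.subset hz)]
  have hρ := inv_pos.2 h.radius_pos
  have h0 := ((h.twist_beta0 ε hz).1.shiftSeq hρ).norm_term_le (-ε) (j + 1)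
  have h1 := ((h.twist_beta1 ε hz).1.shiftSeq hρ).norm_term_le (-ε) (j + 1)
  rw [norm_neg_coe hε] at h0 h1
  refine ContinuousLinearMap.le_opNorm_of_le _ ?_
  refine (norm_add_le _ _).trans ?_
  rw [norm_smul, Real.norm_of_nonneg (by positivity), add_mul, one_mul]
  exact add_le_add (mul_le_mul_of_nonneg_left h0 (by positivity)) h1

theorem fderiv_zeroForm_eq (η : ZeroForm) (z : PhaseSpace) :
    fderiv ℝ η z = curryLeftCLM PhaseSpace 0 (extDeriv η z) := by
  refine ContinuousLinearMap.ext fun u => ?_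
  ext v
  change _ = extDeriv η z (Matrix.vecCons u v)
  rw [extDeriv, ContinuousAlternatingMap.alternatizeUncurryFin_apply, Fin.sum_univ_one]
  simp

theorem norm_curryLeftCLM_apply (ξ : PhaseSpace [⋀^Fin 1]→L[ℝ] ℝ) :
    ‖curryLeftCLM PhaseSpace 0 ξ‖ = ‖ξ‖ :=
  ContinuousAlternatingMap.curryLeftLI.norm_map ξ

/-- For a function, `fderiv` and `extDeriv` carry the same information, and the splitting expresses
the latter by Lie and invariant terms already bounded. No separate estimate in `z` is required. -/
theorem norm_fderiv_potTerm_le (h : W.LieBound N C B) {ε : ℝ} (hε : 0 < ε) {z : PhaseSpace}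
    (hz : z ∈ N) (j : ℕ) : ‖fderiv ℝ (W.potTerm ε (j + 1)) z‖ ≤
      ‖toForm1 PhaseSpace‖ * (lieConst C ε * ((lieRadius B)⁻¹ * ε) ^ (j + 1)) +
        ‖toForm1 PhaseSpace‖ * ((1 / ε + 1) *
          (lieConst C ε / (lieRadius B)⁻¹ * ((lieRadius B)⁻¹ * ε) ^ (j + 1))) := by
  have e : extDeriv (W.potTerm ε (j + 1)) z = W.lieTerm ε (j + 1) z - W.invTerm ε (j + 1) z := by
    rw [lieTerm_eq ε (by omega) (h.subset hz), add_sub_cancel_left]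
  rw [fderiv_zeroForm_eq, norm_curryLeftCLM_apply, e]
  exact (norm_sub_le _ _).trans (add_le_add (h.norm_lieTerm_le hε hz _) (h.norm_invTerm_le hε hz _))

theorem summable_potTerm_bound (h : W.LieBound N C B) {ε : ℝ} (hε : ε ∈ Ioo 0 (lieRadius B))
    (a b c : ℝ) : Summable fun j : ℕ => a * (b * ((lieRadius B)⁻¹ * ε) ^ (j + 1)) +
      a * (c * (b / (lieRadius B)⁻¹ * ((lieRadius B)⁻¹ * ε) ^ (j + 1))) := by
  have hq0 : 0 ≤ (lieRadius B)⁻¹ * ε := mul_nonneg (inv_nonneg.2 h.radius_pos.le) hε.1.le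
  have hq1 : (lieRadius B)⁻¹ * ε < 1 := by
    have := h.inv_radius_mul_lt hε
    rwa [norm_neg_coe hε.1] at this
  have hs : Summable fun j : ℕ => ((lieRadius B)⁻¹ * ε) ^ (j + 1) :=
    (summable_nat_add_iff 1).2 (summable_geometric_of_lt_one hq0 hq1)
  exact ((hs.mul_left _).mul_left _).add (((hs.mul_left _).mul_left _).mul_left _)

theorem _root_.GCWave.hasFDerivAt_tsum_of_norm_fderiv_le {E F : Type*} [NormedAddCommGroup E]
    [NormedSpace ℝ E] [NormedAddCommGroup F] [NormedSpace ℝ F] [CompleteSpace F] {f : ℕ → E → F}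
    {S : Set E} {u : ℕ → ℝ} {x : E} (hS : IsOpen S) (hx : x ∈ S) (hu : Summable u)
    (hf : ∀ n, ∀ y ∈ S, DifferentiableAt ℝ (f n) y) (hb : ∀ n, ∀ y ∈ S, ‖fderiv ℝ (f n) y‖ ≤ u n)
    (hs : Summable fun n => f n x) :
    HasFDerivAt (fun y => ∑' n, f n y) (∑' n, fderiv ℝ (f n) x) x ∧
      Summable fun n => fderiv ℝ (f n) x := by
  obtain ⟨r, hr, hrS⟩ := Metric.isOpen_iff.1 hS x hx
  exact ⟨hasFDerivAt_tsum_of_isPreconnected hu Metric.isOpen_ball (convex_ball x r).isPreconnected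
    (fun n y hy => (hf n y (hrS hy)).hasFDerivAt) (fun n y hy => hb n y (hrS hy))
    (Metric.mem_ball_self hr) hs (Metric.mem_ball_self hr),
    Summable.of_norm_bounded hu fun n => hb n x hx⟩

theorem hasFDerivAt_potSeries (h : W.LieBound N C B) {ε : ℝ} (hε : ε ∈ Ioo 0 (lieRadius B))
    {z : PhaseSpace} (hz : z ∈ N) :
    HasFDerivAt (W.potSeries ε) (∑' j, fderiv ℝ (W.potTerm ε (j + 1)) z) z ∧
      Summable fun j => fderiv ℝ (W.potTerm ε (j + 1)) z :=
  hasFDerivAt_tsum_of_norm_fderiv_le (f := fun j => W.potTerm ε (j + 1)) h.isOpen hz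
    (h.summable_potTerm_bound hε _ _ _)
    (fun j _ hy => differentiableAt_potTerm ε (j + 1) (h.subset hy))
    (fun j _ hy => h.norm_fderiv_potTerm_le hε.1 hy j) (h.hasSum_potTerm hε hz).summable

/-- The termwise splitting is summed; uniform bounds on the derivatives of the potential terms allow
`d` to pass through the infinite sum. -/
theorem GammaW_eq (h : W.LieBound N C B) {ε : ℝ} (hε : ε ∈ Ioo 0 (lieRadius B))
    {z : PhaseSpace} (hz : z ∈ N) :
    W.GammaW ε z = (W.gammaW ε z + W.invSeries ε z) + extDeriv (W.potSeries ε) z := by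
  have h1 := h.hasFDerivAt_potSeries hε hz
  have h2 : extDeriv (W.potSeries ε) z = ∑' j, extDeriv (W.potTerm ε (j + 1)) z := by
    rw [extDeriv_eq_altCLM, h1.1.fderiv, ContinuousLinearMap.map_tsum _ h1.2]
    rfl
  have h3 : Summable fun j => extDeriv (W.potTerm ε (j + 1)) z :=
    (altCLM PhaseSpace 0).summable h1.2
  have h4 : W.GammaW ε z = W.lieTerm ε 0 z + ∑' j, W.lieTerm ε (j + 1) z :=
    (h.hasSum_lieTerm hε hz).summable.tsum_eq_zero_add
  rw [h4, lieTerm_zero, h2, add_assoc, invSeries, ← (h.hasSum_invTerm hε hz).summable.tsum_add h3]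
  congr 1
  exact tsum_congr fun j => lieTerm_eq ε (by omega) (h.subset hz)

end LieBound
end Setting

end

/-! ### Asymptotics of the summed series for analytic data. -/

section

namespace Setting

variable {W : Setting}

theorem _root_.GCWave.continuous_q2 : Continuous q2 := by
  have h : Differentiable ℂ (phi 2) := fun u => (hasDerivAt_phi two_pos u).differentiableAt
  rw [show q2 = fun x : ℝ => phi 2 (-Complex.I * (x : ℂ)) from funext q2_eq]
  exact h.continuous.comp (continuous_const.mul Complex.continuous_ofReal)

/-- Here `a` and `b` are the integrals with amplitudes `β₀` and `β₁`. After division by `ε` only `a`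
contributes at order one. -/
theorem _root_.GCWave.norm_inv_smul_add_le {F : Type*} [NormedAddCommGroup F] [NormedSpace ℝ F]
    [NormedSpace ℂ F] [IsScalarTower ℝ ℂ F] {ε A₀ A₁ Q : ℝ} {E : ℂ} {a b x y : F} (hε : 0 < ε)
    (hε1 : ε ≤ 1) (hE : ‖E‖ = 1) (hA₁ : 0 ≤ A₁) (ha : ‖a + (ε * E) • x‖ ≤ A₀ * ε ^ 2)
    (hb : ‖b + (ε * E) • y‖ ≤ A₁ * ε ^ 2) (hy : ‖y‖ ≤ Q) :
    ‖(1 / ε) • a + b + E • x‖ ≤ (A₀ + A₁ + Q) * ε := by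
  have h1 : (1 / ε) • ((ε * E) • x) = E • x := by
    rw [← smul_assoc, Complex.real_smul, ← mul_assoc, ← Complex.ofReal_mul,
      one_div_mul_cancel hε.ne', Complex.ofReal_one, one_mul]
  have h2 : (1 / ε) • a + b + E • x =
      (1 / ε) • (a + (ε * E) • x) + (b + (ε * E) • y) - (ε * E) • y := by
    rw [smul_add, h1]; abel
  have h3 : ‖(ε * E) • y‖ ≤ ε * Q := by
    rw [norm_smul, norm_mul, hE, mul_one, Complex.norm_real, Real.norm_of_nonneg hε.le]
    exact mul_le_mul_of_nonneg_left hy hε.le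
  have h4 : ‖(1 / ε) • (a + (ε * E) • x)‖ ≤ A₀ * ε := by
    rw [norm_smul, Real.norm_of_nonneg (by positivity), one_div_mul_eq_div, div_le_iff₀ hε]
    exact ha.trans (le_of_eq (by ring))
  have h5 : A₁ * ε ^ 2 ≤ A₁ * ε :=
    mul_le_mul_of_nonneg_left (pow_le_of_le_one hε.le hε1 two_ne_zero) hA₁
  rw [h2]
  refine (norm_sub_le _ _).trans ((add_le_add (norm_add_le _ _) le_rfl).trans ?_)
  linarith

theorem _root_.GCWave.norm_inv_smul_sub_le {ε A₀ A₁ Q V n : ℝ} {E a b q l m : ℂ} (hε : 0 < ε)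
    (hε1 : ε ≤ 1) (hE : ‖E‖ = 1) (hA₀ : 0 ≤ A₀) (hA₁ : 0 ≤ A₁) (hn0 : 0 ≤ n) (hn : n ≤ V)
    (ha : ‖a - ε ^ 2 * E * q * l‖ ≤ A₀ * ε ^ 3 * n)
    (hb : ‖b - ε ^ 2 * E * q * m‖ ≤ A₁ * ε ^ 3 * n) (hy : ‖q * m‖ ≤ Q * V) :
    ‖((1 / ε) • a + b) - ε * E * q * l‖ ≤ (A₀ + A₁ + Q) * V * ε ^ 2 := by
  have hεc : (ε : ℂ) ≠ 0 := by exact_mod_cast hε.ne'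
  have h2 : (1 / ε) • a + b - ε * E * q * l =
      (1 / ε) • (a - ε ^ 2 * E * q * l) + (b - ε ^ 2 * E * q * m) + ε ^ 2 * E * (q * m) := by
    simp only [Complex.real_smul]
    push_cast
    field_simp
    ring
  have h3 : ‖ε ^ 2 * E * (q * m)‖ ≤ ε ^ 2 * (Q * V) := by
    rw [norm_mul, norm_mul, hE, mul_one, norm_pow, Complex.norm_real, Real.norm_of_nonneg hε.le]
    exact mul_le_mul_of_nonneg_left hy (by positivity)
  have h4 : ‖(1 / ε) • (a - ε ^ 2 * E * q * l)‖ ≤ A₀ * V * ε ^ 2 := by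
    rw [norm_smul, Real.norm_of_nonneg (by positivity), one_div_mul_eq_div, div_le_iff₀ hε]
    refine ha.trans ((mul_le_mul_of_nonneg_left hn (by positivity)).trans (le_of_eq (by ring)))
  have h5 : A₁ * ε ^ 3 * n ≤ A₁ * V * ε ^ 2 := by
    refine (mul_le_mul (mul_le_mul_of_nonneg_left
      (pow_le_pow_of_le_one hε.le hε1 (show 2 ≤ 3 by norm_num)) hA₁) hn hn0
      (by positivity)).trans (le_of_eq (by ring))
  rw [h2]
  refine (norm_add_le _ _).trans ((add_le_add (norm_add_le _ _) le_rfl).trans ?_)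
  linarith

/-- Evaluation of covectors at a vector. -/
def evalAt (v : PhaseSpace) : (PhaseSpace →L[ℝ] ℂ) →L[ℝ] ℂ := ContinuousLinearMap.apply ℝ ℂ v

theorem norm_evalAt_le (v : PhaseSpace) : ‖evalAt v‖ ≤ ‖v‖ :=
  ContinuousLinearMap.opNorm_le_bound _ (norm_nonneg v) fun σ =>
    (σ.le_opNorm v).trans (mul_comm _ _).le

namespace LieBound

variable {N K : Set PhaseSpace} {C B : ℝ}

theorem psi_zero_one (h : W.LieBound N C B) {z : PhaseSpace} (hz : z ∈ N) :
    W.lopSeq 0 W.psiC z 0 = (W.ψ z.1 : ℂ) ∧ W.lopSeq 0 W.psiC z 1 = (W.gk z : ℂ) :=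
  ⟨rfl, lop_psiC (h.subset hz)⟩

theorem exists_ampInt_estimate {F : Type*} [NormedAddCommGroup F] [NormedSpace ℝ F]
    [NormedSpace ℂ F] [IsScalarTower ℝ ℂ F] [CompleteSpace F] {M : PhaseSpace → F →L[ℝ] F}
    {f : PhaseSpace → F} (h : W.LieBound N C B) (hb : ∀ z ∈ N, ExpBound (W.lopSeq M f z) C B)
    (ht : ∀ ε : ℝ, ∀ z ∈ N,
      ExpBound (W.lopSeq M (fun y => W.eik ε y.1 • f y) z) (lieConst C ε) (lieRadius B)⁻¹ ∧
      ∀ s : ℂ, ‖s‖ < lieRadius B → expSum (W.lopSeq M (fun y => W.eik ε y.1 • f y) z) s =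
        Complex.exp (Complex.I / ε * expSum (W.lopSeq 0 W.psiC z) s) •
          expSum (W.lopSeq M f z) s) :
    ∃ C' ε₀ : ℝ, 0 ≤ C' ∧ 0 < ε₀ ∧ ε₀ ≤ 1 ∧ ε₀ ≤ lieRadius B ∧ ∀ ε ∈ Ioo 0 ε₀, ∀ z ∈ N,
      ‖ampInt W M f ε z + (ε * W.eik ε z.1) • (Complex.I * q1 (W.gk z)) • f z‖ ≤ C' * ε ^ 2 ∧
      ∀ ev : F →L[ℝ] ℂ, (∀ (a : ℂ) y, ev (a • y) = a * ev y) → ev (f z) = 0 →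
        ‖ev (ampInt W M f ε z) - ε ^ 2 * W.eik ε z.1 * q2 (W.gk z) * ev (lop W.g M f z)‖ ≤
          C' * ε ^ 3 * ‖ev‖ := by
  obtain ⟨C', ε₀, hC', h0, h1, hρ, hest⟩ :=
    exists_expInt_estimate (F := F) C B (lieRadius B) h.C_nonneg h.B_nonneg h.radius_pos
  exact ⟨C', ε₀, hC', h0, h1, hρ, fun ε hε z hz =>
    hest _ (W.ψ z.1) (W.gk z) (h.psi z hz) (h.psi_zero_one hz).1 (h.psi_zero_one hz).2 _
      (hb z hz) ε hε _ _ (ht ε z hz).1 (ht ε z hz).2⟩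

/-- The end point `τ = 1` of the transport estimate, which is the Lie series itself. -/
theorem nearTransport (h : W.LieBound N C B) (hKN : K ⊆ N) : W.NearTransport K fun ε z =>
    Complex.exp (Complex.I / ε * expSum (W.lopSeq 0 W.psiC z) (-ε)) •
      expSum (W.lopSeq (GCWave.formMul ℂ W.g) W.alpha z) (-ε) := by
  obtain ⟨A, ε₀, hA, h0, h1, hA1, hest⟩ := exists_transport_estimate
    (F := PhaseSpace →L[ℝ] ℂ) C B h.C_nonneg h.B_nonneg
  refine ⟨2 * A, ε₀, h0, fun ε hε z hz => ?_⟩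
  obtain ⟨η, hη, he, hc⟩ := hest _ (W.ψ z.1) (W.gk z) (h.psi z (hKN hz))
    (h.psi_zero_one (hKN hz)).1 (h.psi_zero_one (hKN hz)).2 _ (h.alpha z (hKN hz)) ε hε 1
    ⟨zero_le_one, le_rfl⟩
  have hη1 : ‖η‖ ≤ 1 := hη.trans
    ((mul_le_mul_of_nonneg_left hε.2.le hA).trans hA1)
  rw [Complex.ofReal_one, one_mul, mul_one] at he
  rw [Complex.ofReal_one, mul_one] at hc
  refine ⟨η, hη.trans (mul_le_mul_of_nonneg_right (by linarith) hε.1.le), ?_⟩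
  beta_reduce
  rw [he]
  have hn : ‖(1 + η) * (Complex.exp (Complex.I / ε * (W.ψ z.1 : ℂ)) *
      Complex.exp (-Complex.I * W.gk z))‖ ≤ 2 := by
    have h2 : ‖Complex.exp (Complex.I / ε * (W.ψ z.1 : ℂ))‖ = 1 := norm_eik W ε z.1
    rw [norm_mul, norm_mul, norm_exp_neg_I_mul, h2, mul_one, mul_one]
    exact (norm_add_le _ _).trans (by rw [norm_one]; linarith)
  refine (le_of_eq ?_).trans ((norm_smul_le _ _).trans
    ((mul_le_mul hn hc (norm_nonneg _) zero_le_two).trans (mul_assoc _ _ _).ge))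
  congr 1
  exact (smul_sub _ _ _).symm

theorem GammaW_eq_toForm1 (h : W.LieBound N C B) {ε : ℝ} (hε : ε ∈ Ioo 0 (lieRadius B))
    {z : PhaseSpace} (hz : z ∈ N) : W.GammaW ε z = toForm1 PhaseSpace
      (Complex.exp (Complex.I / ε * expSum (W.lopSeq 0 W.psiC z) (-ε)) •
        expSum (W.lopSeq (GCWave.formMul ℂ W.g) W.alpha z) (-ε)) :=
  (h.hasSum_lieTerm hε hz).tsum_eq

theorem hasInvariantExpansion_GammaW (h : W.LieBound N C B) (hK : IsCompact K) (hKN : K ⊆ N) :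
    W.HasInvariantExpansion (W.gaugeTransform W.GammaW) K :=
  hasInvariantExpansion hK (hKN.trans h.subset) (h.nearTransport hKN) h.radius_pos
    fun _ hε _ hz => h.GammaW_eq_toForm1 hε (hKN hz)

/-- The complex amplitude of the invariant series. -/
def _root_.GCWave.Setting.invAmp (W : Setting) (ε : ℝ) (z : PhaseSpace) : PhaseSpace →L[ℝ] ℂ :=
  (1 / ε) • ampInt W (GCWave.formMul ℂ W.g) W.beta0 ε z +
    ampInt W (GCWave.formMul ℂ W.g) W.beta1 ε z

theorem invSeries_apply (h : W.LieBound N C B) {ε : ℝ} (hε : ε ∈ Ioo 0 (lieRadius B))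
    {z : PhaseSpace} (hz : z ∈ N) (v : PhaseSpace) :
    W.invSeries ε z ![v] = cc (W.invAmp ε z v) := by
  have h1 : W.invSeries ε z = toForm1 PhaseSpace (W.invAmp ε z) := (h.hasSum_invTerm hε hz).tsum_eq
  rw [h1, toForm1_apply]
  rfl

theorem potSeries_apply (h : W.LieBound N C B) {ε : ℝ} (hε : ε ∈ Ioo 0 (lieRadius B))
    {z : PhaseSpace} (hz : z ∈ N) :
    W.potSeries ε z ![] = cc (ampInt W 0 W.f0 ε z) := by
  have h1 : W.potSeries ε z = toForm0 PhaseSpace (ampInt W 0 W.f0 ε z) :=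
    (h.hasSum_potTerm hε hz).tsum_eq
  rw [h1, toForm0_apply]

theorem potSeries_add_ST (h : W.LieBound N C B) (hKN : K ⊆ N) :
    UnifO K 2 fun ε z => W.potSeries ε z ![] + W.ST ε z := by
  obtain ⟨A, ε₀, -, h0, -, hρ, hest⟩ := h.exists_ampInt_estimate (M := 0) h.f0
    fun ε z hz => h.twist_f0 ε hz
  refine UnifO.of_cc (a := fun ε z => ampInt W 0 W.f0 ε z + W.STc ε z) (C := A) h0
    (fun ε hε z hz => ?_) (fun ε hε z hz => ?_)
  · have := (hest ε hε z (hKN hz)).1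
    rw [STc_eq, potQ]
    refine (le_of_eq ?_).trans (this.trans (le_of_eq (by norm_cast)))
    congr 2
    simp only [smul_eq_mul]
    ring
  · rw [h.potSeries_apply ⟨hε.1, hε.2.trans_le hρ⟩ (hKN hz), ST, cc_add]

/-- Both amplitudes are horizontal, so the refined estimate applies to vertical directions; `β₁`
lacks the factor `1/ε` and goes into the error in every direction. -/
theorem exists_invAmp_estimate (h : W.LieBound N C B) (hK : IsCompact K) (hKN : K ⊆ N) :
    ∃ A ε₀ : ℝ, 0 < ε₀ ∧ ε₀ ≤ lieRadius B ∧ ∀ ε ∈ Ioo 0 ε₀, ∀ z ∈ K,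
      ‖W.invAmp ε z + W.eik ε z.1 • (Complex.I * q1 (W.gk z)) • W.beta0 z‖ ≤ A * ε ∧
      ∀ v : PhaseSpace, v.1 = 0 →
        ‖W.invAmp ε z v - ε * W.eik ε z.1 * q2 (W.gk z) * W.beta0 z (fderiv ℝ W.g z v)‖ ≤
          A * ‖v‖ * ε ^ 2 := by
  obtain ⟨A₀, ε₀, hA₀, h0, h01, hρ0, he0⟩ := h.exists_ampInt_estimate h.beta0
    fun ε z hz => h.twist_beta0 ε hz
  obtain ⟨A₁, ε₁, hA₁, h1, h11, hρ1, he1⟩ := h.exists_ampInt_estimate h.beta1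
    fun ε z hz => h.twist_beta1 ε hz
  have hKd := hKN.trans h.subset
  have cq1 : ContinuousOn (fun z => Complex.I * q1 (W.gk z)) K :=
    continuousOn_const.mul ((contDiff_q1 (n := 0)).continuous.comp_continuousOn
      (W.reg_top.gk.continuousOn.mono hKd))
  have cq2 : ContinuousOn (fun z => q2 (W.gk z)) K :=
    continuous_q2.comp_continuousOn (W.reg_top.gk.continuousOn.mono hKd)
  obtain ⟨Q₁, hQ₁⟩ := hK.exists_bound_of_continuousOn
    (cq1.smul (W.reg_top.beta1.continuousOn.mono hKd))
  obtain ⟨Q₂, hQ₂⟩ := hK.exists_bound_of_continuousOn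
    (cq2.smul ((contDiffOn_lop W.isOpen_dom g_contDiffOn W.reg_top.formMul
      W.reg_top.beta1).continuousOn.mono hKd))
  refine ⟨A₀ + A₁ + max Q₁ Q₂, min ε₀ ε₁, lt_min h0 h1, (min_le_left _ _).trans hρ0,
    fun ε hε z hz => ?_⟩
  have hε0 := hε.1
  have m0 : ε ∈ Ioo 0 ε₀ := ⟨hε0, hε.2.trans_le (min_le_left _ _)⟩
  have m1 : ε ∈ Ioo 0 ε₁ := ⟨hε0, hε.2.trans_le (min_le_right _ _)⟩
  have hε1 : ε ≤ 1 := m0.2.le.trans h01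
  obtain ⟨a0, b0⟩ := he0 ε m0 z (hKN hz)
  obtain ⟨a1, b1⟩ := he1 ε m1 z (hKN hz)
  constructor
  · exact norm_inv_smul_add_le hε0 hε1 (norm_eik W ε z.1) hA₁ a0 a1
      ((hQ₁ z hz).trans (le_max_left _ _))
  · intro v hv
    have hn := norm_evalAt_le v
    have hm : ‖q2 (W.gk z) * lop W.g (GCWave.formMul ℂ W.g) W.beta1 z v‖ ≤ max Q₁ Q₂ * ‖v‖ :=
      ContinuousLinearMap.le_of_opNorm_le _ ((hQ₂ z hz).trans (le_max_right _ _)) v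
    have h2 := b0 (evalAt v) (fun _ _ => rfl) (horizontal_beta0 z (hKd hz) v hv)
    have h3 := b1 (evalAt v) (fun _ _ => rfl) (horizontal_beta1 z (hKd hz) v hv)
    have h4 := norm_inv_smul_sub_le hε0 hε1 (norm_eik W ε z.1) hA₀ hA₁ (norm_nonneg (evalAt v)) hn
      h2 h3 hm
    have h5 := lop_apply_of_horizontal W.reg_top.beta0 horizontal_beta0 (hKd hz) hv
    rw [← h5]
    exact h4

theorem invSeries_vR (h : W.LieBound N C B) (hK : IsCompact K) (hKN : K ⊆ N) (β : Fin 4) :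
    UnifO K 1 fun ε z => W.invSeries ε z ![vR β] - cc (W.sumR (W.Ft z.1) ε z β) := by
  obtain ⟨A, ε₀, h0, hρ, hest⟩ := h.exists_invAmp_estimate hK hKN
  refine UnifO.of_cc (a := fun ε z => W.invAmp ε z (vR β) - W.sumR (W.Ft z.1) ε z β)
    (C := A * ‖vR β‖) h0 (fun ε hε z hz => ?_) (fun ε hε z hz => ?_)
  · have h1 := ContinuousLinearMap.le_of_opNorm_le _ (hest ε hε z hz).1 (vR β)
    refine (le_of_eq ?_).trans (h1.trans (le_of_eq (by rw [zpow_one]; ring)))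
    have h2 : (W.invAmp ε z + W.eik ε z.1 • (Complex.I * q1 (W.gk z)) • W.beta0 z) (vR β) =
      W.invAmp ε z (vR β) + W.eik ε z.1 * ((Complex.I * q1 (W.gk z)) * W.beta0 z (vR β)) := rfl
    rw [h2, beta0_vR, sumR]
    congr 1
    ring
  · rw [h.invSeries_apply ⟨hε.1, hε.2.trans_le hρ⟩ (hKN hz), cc_sub]

theorem invSeries_vertical (h : W.LieBound N C B) (hK : IsCompact K) (hKN : K ⊆ N)
    {v : PhaseSpace} (hv : v.1 = 0) : UnifO K 2 fun ε z =>
      W.invSeries ε z ![v] - cc (W.sumAng (W.Ft z.1) (fderiv ℝ W.gr z v) ε z) := by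
  obtain ⟨A, ε₀, h0, hρ, hest⟩ := h.exists_invAmp_estimate hK hKN
  refine UnifO.of_cc (a := fun ε z => W.invAmp ε z v -
    W.sumAng (W.Ft z.1) (fderiv ℝ W.gr z v) ε z) (C := A * ‖v‖) h0 (fun ε hε z hz => ?_)
    (fun ε hε z hz => ?_)
  · have h1 := (hest ε hε z hz).2 v hv
    refine (le_of_eq ?_).trans (h1.trans (le_of_eq (by norm_cast)))
    rw [beta0_fderiv_g (h.subset (hKN hz)), sumAng]
    congr 1
    ring
  · rw [h.invSeries_apply ⟨hε.1, hε.2.trans_le hρ⟩ (hKN hz), cc_sub]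

theorem convergence (h : W.LieBound N C B) {ε : ℝ} (hε : ε ∈ Ioo 0 (lieRadius B))
    {z : PhaseSpace} (hz : z ∈ N) :
    Summable (fun j : ℕ => W.lieTerm ε j z) ∧ Summable (fun j : ℕ => W.invTerm ε (j + 1) z) ∧
    Summable (fun j : ℕ => W.potTerm ε (j + 1) z) ∧ DifferentiableAt ℝ (W.potSeries ε) z ∧
    W.GammaW ε z = (W.gammaW ε z + W.invSeries ε z) + extDeriv (W.potSeries ε) z :=
  ⟨(h.hasSum_lieTerm hε hz).summable, (h.hasSum_invTerm hε hz).summable,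
    (h.hasSum_potTerm hε hz).summable, (h.hasFDerivAt_potSeries hε hz).1.differentiableAt,
    h.GammaW_eq hε hz⟩

end LieBound
end Setting

end

end GCWave

end

/-! ### Assembly of all clauses. -/

theorem mainTheorem4 (W : Setting) :
    -- the generalized homotopy formula, for forms of every degree `n + 1 ≥ 1`
    (∀ (n : ℕ) (S : Set PhaseSpace) (V : PhaseSpace → PhaseSpace)
        (η : PhaseSpace → PhaseSpace [⋀^Fin (n + 1)]→L[ℝ] ℝ),
        IsOpen S → ContDiffOn ℝ ∞ V S → ContDiffOn ℝ ∞ η S →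
        ∀ j : ℕ, 1 ≤ j → ∀ z ∈ S,
          (lieDeriv V)^[j] η z = (intD V)^[j] η z + (dInt V)^[j] η z) ∧
    -- the Lie series splits, term by term, into invariant terms and exact terms
    (∀ ε : ℝ, 0 < ε → ∀ z ∈ W.dom,
      (∀ j : ℕ, 1 ≤ j →
        DifferentiableAt ℝ (W.potTerm ε j) z ∧
        W.lieTerm ε j z = W.invTerm ε j z + extDeriv (W.potTerm ε j) z) ∧
      ∀ N : ℕ, ∑ j ∈ Finset.range (N + 1), W.lieTerm ε j z =
        (W.gammaW ε z + ∑ j ∈ Finset.Icc 1 N, W.invTerm ε j z) +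
          extDeriv (fun y => ∑ j ∈ Finset.Icc 1 N, W.potTerm ε j y) z) ∧
    -- the invariant terms see a one-form only through its exterior derivative
    (∀ γ₁ γ₂ : OneForm, (∀ z ∈ W.dom, extDeriv γ₁ z = extDeriv γ₂ z) →
      ∀ j : ℕ, 1 ≤ j → ∀ z ∈ W.dom, (intD W.g)^[j] γ₁ z = (intD W.g)^[j] γ₂ z) ∧
    -- `F̃` is unchanged when `Ã` is replaced by `Ã + i k Λ`
    (∀ r : Spacetime, ∀ Λ : ℂ,
      waveTensor (W.k r) (fun α => W.At r α + Complex.I * (W.k r α : ℂ) * Λ) = W.Ft r) ∧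
    -- the leading terms, for smooth data, uniformly on compact sets
    (∀ K : Set PhaseSpace, IsCompact K → K ⊆ W.dom →
      (∃ C : ℝ, ∃ ε₀ > 0, ∀ ε ∈ Ioo (0 : ℝ) ε₀, ∀ z ∈ K, ∀ u v : PhaseSpace,
        |extDeriv (W.gammaW ε) z ![u, v] -
          cc ((W.e / (ε * W.c) : ℂ) * contract2 u.1 (W.Ft z.1) v.1 * W.eik ε z.1)| ≤
        C * ‖u‖ * ‖v‖) ∧
      ∀ j : ℕ, 1 ≤ j →
        (∀ β, UnifO K (1 - (j : ℤ)) fun ε z => (intD W.g)^[j] (W.gammaW ε) z ![vR β] -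
          cc (W.leadR (W.Ft z.1) ε j z β)) ∧
        (UnifO K (2 - (j : ℤ)) fun ε z => (intD W.g)^[j] (W.gammaW ε) z ![vMu] -
          cc (W.leadAng (W.Ft z.1) (W.dgrMu z) ε j z)) ∧
        (UnifO K (2 - (j : ℤ)) fun ε z => (intD W.g)^[j] (W.gammaW ε) z ![vTheta] -
          cc (W.leadAng (W.Ft z.1) (W.dgrTheta z) ε j z)) ∧
        (UnifO K (1 - (j : ℤ)) fun ε z => W.potIter ε j z ![] - cc (W.leadPot ε j z))) ∧
    -- summation of the leading terms over all `j`, in closed form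
    (∀ ε : ℝ, 0 < ε → ∀ z ∈ W.dom,
      (∀ F β, HasSum (fun j : ℕ => ((-ε : ℂ) ^ (j + 1) / ((j + 1).factorial : ℂ)) *
        W.leadR F ε (j + 1) z β) (W.sumR F ε z β)) ∧
      (∀ F v, HasSum (fun j : ℕ => ((-ε : ℂ) ^ (j + 1) / ((j + 1).factorial : ℂ)) *
        W.leadAng F v ε (j + 1) z) (W.sumAng F v ε z)) ∧
      HasSum (fun j : ℕ => ((-ε : ℂ) ^ (j + 1) / ((j + 1).factorial : ℂ)) *
        W.leadPot ε j z) (-W.STc ε z)) ∧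
    -- for smooth data: transport of `γ_w` along the flow of `g`; its Taylor series in the flow
    -- parameter is the Lie series, and adding `dS_T` makes it manifestly gauge invariant
    (∀ (S : Set PhaseSpace) (δ : ℝ) (φ : ℝ → PhaseSpace → PhaseSpace),
      IsLocalFlow W.g W.dom S δ φ →
      (∀ ε : ℝ, 0 < ε → ∀ z ∈ S, ∀ j : ℕ,
        iteratedDeriv j (fun s => pullback (φ (-s)) (W.gammaW ε) z) 0 =
          (-1 : ℝ) ^ j • (lieDeriv W.g)^[j] (W.gammaW ε) z) ∧
      ∀ K : Set PhaseSpace, IsCompact K → K ⊆ S →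
        W.HasInvariantExpansion
          (W.gaugeTransform fun ε => pullback (φ (-ε)) (W.gammaW ε)) K) ∧
    -- for analytic data: the full series converge, with the stated splitting and expansions
    (W.IsAnalytic → ∀ K : Set PhaseSpace, IsCompact K → K ⊆ W.dom →
      (∃ ε₀ > 0, ∀ ε ∈ Ioo (0 : ℝ) ε₀, ∀ z ∈ K,
        Summable (fun j : ℕ => W.lieTerm ε j z) ∧
        Summable (fun j : ℕ => W.invTerm ε (j + 1) z) ∧
        Summable (fun j : ℕ => W.potTerm ε (j + 1) z) ∧
        DifferentiableAt ℝ (W.potSeries ε) z ∧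
        W.GammaW ε z = (W.gammaW ε z + W.invSeries ε z) + extDeriv (W.potSeries ε) z) ∧
      (∀ β, UnifO K 1 fun ε z => W.invSeries ε z ![vR β] - cc (W.sumR (W.Ft z.1) ε z β)) ∧
      (UnifO K 2 fun ε z => W.invSeries ε z ![vMu] -
        cc (W.sumAng (W.Ft z.1) (W.dgrMu z) ε z)) ∧
      (UnifO K 2 fun ε z => W.invSeries ε z ![vTheta] -
        cc (W.sumAng (W.Ft z.1) (W.dgrTheta z) ε z)) ∧
      (UnifO K 2 fun ε z => W.potSeries ε z ![] + W.ST ε z) ∧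
      W.HasInvariantExpansion (W.gaugeTransform W.GammaW) K) := by
  refine ⟨?_, ?_, ?_, Setting.waveTensor_gauge W, ?_, ?_, ?_, ?_⟩
  · intro n S V η hS hV hη j hj z hz
    obtain ⟨i, rfl⟩ := Nat.exists_eq_add_of_le' hj
    exact lieDeriv_iterate_eqOn hS hV hη i hz
  · exact fun ε _ z hz => ⟨fun j hj => ⟨Setting.differentiableAt_potTerm ε j hz,
      Setting.lieTerm_eq ε hj hz⟩, Setting.splitting W ε hz⟩
  · intro γ₁ γ₂ h j hj z hz
    obtain ⟨i, rfl⟩ := Nat.exists_eq_add_of_le' hj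
    exact intD_iterate_congr W.isOpen_dom h i hz
  · exact fun K hK hKd => ⟨Setting.extDeriv_gammaW_bound W hK hKd,
      Setting.leading_terms_clause W hK hKd⟩
  · exact fun ε hε z hz => ⟨fun F β => Setting.weighted_leadR W F hε z β,
      fun F v => Setting.weighted_leadAng W F v hε z, Setting.weighted_leadPot W hε z⟩
  · exact fun S δ φ h => ⟨fun ε _ z hz j => Setting.iteratedDeriv_pullback_gammaW h ε hz j,
      fun K hK hKS => Setting.hasInvariantExpansion_flow h hK hKS⟩
  · intro hW K hK hKd
    -- One neighbourhood of the compact set carries bounds for the phase and all amplitudes, so a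
    -- single threshold for `ε` serves all the series.
    obtain ⟨N, C, B, hKN, h⟩ := Setting.exists_lieBound hW hK hKd
    exact ⟨⟨Setting.lieRadius B, h.radius_pos, fun ε hε z hz => h.convergence hε (hKN hz)⟩,
      h.invSeries_vR hK hKN, h.invSeries_vertical hK hKN rfl, h.invSeries_vertical hK hKN rfl,
      h.potSeries_add_ST hKN, h.hasInvariantExpansion_GammaW hK hKN⟩
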